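/- Let $(M,h)$ be a smooth ($C^\infty$) compact Riemannian surface homeomorphic to the 2-sphere which is a 2-sphere of revolution with pole $p$: for all $q_1,q_2\in M$ with $d_h(p,q_1)=d_h(p,q_2)$ there is an $h$-isometry $f$ of $M$ with $f(p)=p$ and $f(q_1)=q_2$. Let $q$ be the unique cut point of $p$, let $d_h(p,q)=2a$, and let $(r,\theta)$ be geodesic polar coordinates around $p$ on $M\setminus\{p,q\}$, with $0<r<2a$ and $\theta$ modulo $2\pi$. Let $m=\sqrt{h(\partial/\partial\theta,\partial/\partial\theta)}$ (with $m=0$ at the poles $p$ and $q$), let $\mu\in\mathbb{R}$ be a constant with $|\mu|\, m<1$ on $M$, and let $W$ be the smooth vector field on $M$ that equals $\mu\,\partial/\partial\theta$ on $M\setminus\{p,q\}$. Let $$F(x,y)=\frac{\sqrt{\lambda\,\|y\|_h^2+h(W,y)^2}-h(W,y)}{\lambda},\qquad \lambda=1-\|W\|_h^2,\qquad x\in M,\ y\in T_xM,$$ be the Randers metric on $M$ with navigation data $(h,W)$. Then the flag curvature $\mathcal{K}$ of $F$ depends only on the base point and is equal to the Gaussian curvature $G$ of $(M,h)$: for every $x\in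 M$ (the poles included) and every $y\in T_xM\setminus\{0\}$, the flag curvature of $F$ at $x$ with flagpole $y$ (computed with any transverse edge $v\in T_xM$ linearly independent of $y$) is $$\mathcal{K}(x,y)=G(x).$$ -/

import Mathlib

open Bundle Manifold
open scoped ContDiff

noncomputable section

/-! ### Finsler geometry in local coordinates

A Finsler function on an open set of `ℝⁿ` is a function `F x y` of the position `x` and of the
tangent vector `y`. -/

namespace LocalFinsler

/-- The partial derivative `∂f/∂xⁱ` of a function `f x y` with respect to the position. -/
def dX {n : ℕ} (i : Fin n)
    (f : EuclideanSpace ℝ (Fin n) → EuclideanSpace ℝ (Fin n) → ℝ)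
    (x y : EuclideanSpace ℝ (Fin n)) : ℝ :=
  fderiv ℝ (fun u => f u y) x (EuclideanSpace.single i 1)

/-- The partial derivative `∂f/∂yⁱ` of a function `f x y` with respect to the direction. -/
def dY {n : ℕ} (i : Fin n)
    (f : EuclideanSpace ℝ (Fin n) → EuclideanSpace ℝ (Fin n) → ℝ)
    (x y : EuclideanSpace ℝ (Fin n)) : ℝ :=
  fderiv ℝ (fun w => f x w) y (EuclideanSpace.single i 1)

/-- The fundamental tensor `g_{ij}(x,y) = ½ ∂²F²/∂yⁱ∂yʲ`. -/
def fundamentalTensor {n : ℕ}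
    (F : EuclideanSpace ℝ (Fin n) → EuclideanSpace ℝ (Fin n) → ℝ)
    (x y : EuclideanSpace ℝ (Fin n)) : Matrix (Fin n) (Fin n) ℝ :=
  Matrix.of fun i j => (1 / 2 : ℝ) * dY i (dY j (fun u w => F u w ^ 2)) x y

/-- The geodesic spray coefficients
`Gⁱ = ¼ gⁱˡ ( (∂²F²/∂xᵏ∂yˡ) yᵏ - ∂F²/∂xˡ )`. -/
def spray {n : ℕ}
    (F : EuclideanSpace ℝ (Fin n) → EuclideanSpace ℝ (Fin n) → ℝ) (i : Fin n)
    (x y : EuclideanSpace ℝ (Fin n)) : ℝ :=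
  (1 / 4 : ℝ) * ∑ l, (fundamentalTensor F x y)⁻¹ i l *
    ((∑ k, dX k (dY l (fun u w => F u w ^ 2)) x y * y k) - dX l (fun u w => F u w ^ 2) x y)

/-- The Riemann curvature of a Finsler function,
`Rⁱₖ = 2 ∂Gⁱ/∂xᵏ - yʲ ∂²Gⁱ/∂xʲ∂yᵏ + 2 Gʲ ∂²Gⁱ/∂yʲ∂yᵏ - (∂Gⁱ/∂yʲ) (∂Gʲ/∂yᵏ)`. -/
def riemann {n : ℕ}
    (F : EuclideanSpace ℝ (Fin n) → EuclideanSpace ℝ (Fin n) → ℝ) (i k : Fin n)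
    (x y : EuclideanSpace ℝ (Fin n)) : ℝ :=
  2 * dX k (spray F i) x y
    - ∑ j, y j * dX j (dY k (spray F i)) x y
    + 2 * ∑ j, spray F j x y * dY j (dY k (spray F i)) x y
    - ∑ j, dY j (spray F i) x y * dY k (spray F j) x y

/-- The scalar product `g_{(x,y)}(u,v) = g_{ij}(x,y) uⁱ vʲ`. -/
def scalarProduct {n : ℕ}
    (F : EuclideanSpace ℝ (Fin n) → EuclideanSpace ℝ (Fin n) → ℝ)
    (x y u v : EuclideanSpace ℝ (Fin n)) : ℝ :=
  ∑ i, ∑ j, fundamentalTensor F x y i j * u i * v j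

/-- The flag curvature at `x` of the flag with flagpole `y` and transverse edge `v`:
`g_y(R_y v, v) / (g_y(y,y) g_y(v,v) - g_y(y,v)²)`. -/
def flagCurvature {n : ℕ}
    (F : EuclideanSpace ℝ (Fin n) → EuclideanSpace ℝ (Fin n) → ℝ)
    (x y v : EuclideanSpace ℝ (Fin n)) : ℝ :=
  (∑ i, ∑ j, ∑ k, fundamentalTensor F x y i j * riemann F i k x y * v k * v j) /
    (scalarProduct F x y y y * scalarProduct F x y v v - scalarProduct F x y y v ^ 2)

end LocalFinsler

/-! ### The Gaussian curvature in local coordinates -/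

namespace LocalRiemann

/-- The partial derivative `∂f/∂xⁱ`. -/
def pd {n : ℕ} (i : Fin n) (f : EuclideanSpace ℝ (Fin n) → ℝ)
    (x : EuclideanSpace ℝ (Fin n)) : ℝ :=
  fderiv ℝ f x (EuclideanSpace.single i 1)

/-- The Christoffel symbols `Γᵏᵢⱼ = ½ hᵏˡ (∂ᵢ hⱼₗ + ∂ⱼ hᵢₗ - ∂ₗ hᵢⱼ)` of the Levi-Civita
connection of a Riemannian metric `h`. -/
def christoffel {n : ℕ} (h : EuclideanSpace ℝ (Fin n) → Matrix (Fin n) (Fin n) ℝ)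
    (k i j : Fin n) (x : EuclideanSpace ℝ (Fin n)) : ℝ :=
  (1 / 2 : ℝ) * ∑ l, (h x)⁻¹ k l *
    (pd i (fun u => h u j l) x + pd j (fun u => h u i l) x - pd l (fun u => h u i j) x)

/-- The components `Rˡₖᵢⱼ` of the curvature tensor, `R(∂ᵢ, ∂ⱼ) ∂ₖ = Rˡₖᵢⱼ ∂ₗ`, where
`R(X, Y) = ∇_X ∇_Y - ∇_Y ∇_X - ∇_[X, Y]`. -/
def curvature {n : ℕ} (h : EuclideanSpace ℝ (Fin n) → Matrix (Fin n) (Fin n) ℝ)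
    (l k i j : Fin n) (x : EuclideanSpace ℝ (Fin n)) : ℝ :=
  pd i (christoffel h l j k) x - pd j (christoffel h l i k) x
    + ∑ s, (christoffel h l i s x * christoffel h s j k x
        - christoffel h l j s x * christoffel h s i k x)

/-- The Gaussian curvature `h(R(∂₀, ∂₁) ∂₁, ∂₀) / det h` of a Riemannian metric in dimension 2. -/
def gaussCurvature (h : EuclideanSpace ℝ (Fin 2) → Matrix (Fin 2) (Fin 2) ℝ)
    (x : EuclideanSpace ℝ (Fin 2)) : ℝ :=
  (∑ l, curvature h l 1 0 1 x * h x l 0) / (h x).det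

end LocalRiemann

/-! ### Curvatures on a surface -/

/-- The tangent vector of `M`, at the point with coordinates `u` in the preferred chart at `x₀`,
whose components in that chart are those of `w`. -/
def chartVec {n : ℕ} {M : Type*} [TopologicalSpace M]
    [ChartedSpace (EuclideanSpace ℝ (Fin n)) M] (x₀ : M) (u w : EuclideanSpace ℝ (Fin n)) :
    TangentSpace (𝓡 n) ((extChartAt (𝓡 n) x₀).symm u) :=
  mfderiv 𝓘(ℝ, EuclideanSpace ℝ (Fin n)) (𝓡 n) (extChartAt (𝓡 n) x₀).symm u w

/-- The components, in the preferred chart at `x₀`, of a tangent vector of `M` at `x₀`. -/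
def components {n : ℕ} {M : Type*} [TopologicalSpace M]
    [ChartedSpace (EuclideanSpace ℝ (Fin n)) M] (x₀ : M) (y : TangentSpace (𝓡 n) x₀) :
    EuclideanSpace ℝ (Fin n) :=
  mfderiv (𝓡 n) 𝓘(ℝ, EuclideanSpace ℝ (Fin n)) (extChartAt (𝓡 n) x₀) x₀ y

/-- The flag curvature of a Finsler metric `F` on a manifold `M`, at the point `x`, for the flag
with flagpole `y` and transverse edge `v`. It does not depend on the chart in which it is
computed. -/
def flagCurvature {n : ℕ} {M : Type*} [TopologicalSpace M]
    [ChartedSpace (EuclideanSpace ℝ (Fin n)) M] (F : (x : M) → TangentSpace (𝓡 n) x → ℝ)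
    (x : M) (y v : TangentSpace (𝓡 n) x) : ℝ :=
  LocalFinsler.flagCurvature
    (fun u w => F ((extChartAt (𝓡 n) x).symm u) (chartVec x u w))
    (extChartAt (𝓡 n) x x) (components x y) (components x v)

/-- The Gaussian curvature of a Riemannian surface `M` at the point `x`. It does not depend on
the chart in which it is computed. -/
def gaussCurvature {M : Type*} [TopologicalSpace M] [ChartedSpace (EuclideanSpace ℝ (Fin 2)) M]
    [RiemannianBundle (fun x : M => TangentSpace (𝓡 2) x)] (x : M) : ℝ :=
  LocalRiemann.gaussCurvature
    (fun u => Matrix.of fun i j =>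
      inner ℝ (chartVec x u (EuclideanSpace.single i 1)) (chartVec x u (EuclideanSpace.single j 1)))
    (extChartAt (𝓡 2) x x)

/-! ### Spheres of revolution and geodesic polar coordinates -/

/-- The compact Riemannian surface `M` is a 2-sphere of revolution with pole `p`: it is homeomorphic
to the 2-sphere, and any two points at the same distance from `p` are exchanged by some Riemannian
isometry of `M` that fixes `p`. -/
structure IsSphereOfRevolution {M : Type*} [MetricSpace M]
    [ChartedSpace (EuclideanSpace ℝ (Fin 2)) M]
    [RiemannianBundle (fun x : M => TangentSpace (𝓡 2) x)] (p : M) : Prop where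
  homeo : Nonempty (M ≃ₜ Metric.sphere (0 : EuclideanSpace ℝ (Fin 3)) 1)
  exists_isometry : ∀ q₁ q₂ : M, dist p q₁ = dist p q₂ →
    ∃ f : M ≃ₘ^∞⟮𝓡 2, 𝓡 2⟯ M,
      (∀ (x : M) (v : TangentSpace (𝓡 2) x), ‖mfderiv (𝓡 2) (𝓡 2) f x v‖ = ‖v‖) ∧
      f p = p ∧ f q₁ = q₂

/-- The coordinate vector `∂/∂r` at the point `Φ r θ` with polar coordinates `(r, θ)`. -/
def radialVec {M : Type*} [TopologicalSpace M] [ChartedSpace (EuclideanSpace ℝ (Fin 2)) M]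
    (Φ : ℝ → ℝ → M) (r θ : ℝ) : TangentSpace (𝓡 2) (Φ r θ) :=
  mfderiv 𝓘(ℝ, ℝ) (𝓡 2) (fun t => Φ t θ) r (1 : ℝ)

/-- The coordinate vector `∂/∂θ` at the point `Φ r θ` with polar coordinates `(r, θ)`. -/
def angularVec {M : Type*} [TopologicalSpace M] [ChartedSpace (EuclideanSpace ℝ (Fin 2)) M]
    (Φ : ℝ → ℝ → M) (r θ : ℝ) : TangentSpace (𝓡 2) (Φ r θ) :=
  mfderiv 𝓘(ℝ, ℝ) (𝓡 2) (fun t => Φ r t) θ (1 : ℝ)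

/-- `Φ` is the parametrization of `M` by geodesic polar coordinates `(r, θ)` around `p`, where `q`
is the unique cut point of `p` and `dist p q = 2 * a`: the curve `Φ · θ` is the unit speed geodesic
that leaves `p` in the direction of angle `θ`; it minimizes the length up to the parameter `2 * a`,
where it reaches `q`; and `(r, θ)`, with `θ` modulo `2π`, are smooth coordinates on `M ∖ {p, q}`. -/
structure IsGeodesicPolar {M : Type*} [MetricSpace M]
    [ChartedSpace (EuclideanSpace ℝ (Fin 2)) M]
    [RiemannianBundle (fun x : M => TangentSpace (𝓡 2) x)]
    (p q : M) (a : ℝ) (Φ : ℝ → ℝ → M) : Prop where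
  pos : 0 < a
  smooth : ContMDiff 𝓘(ℝ, ℝ × ℝ) (𝓡 2) ∞ (fun z : ℝ × ℝ => Φ z.1 z.2)
  -- the geodesics start at `p`, in the direction of angle `θ` for an orthonormal basis of `T_p M`
  initial : ∃ e₁ e₂ : TangentSpace (𝓡 2) p, ‖e₁‖ = 1 ∧ ‖e₂‖ = 1 ∧ inner ℝ e₁ e₂ = 0 ∧
    ∀ θ : ℝ, (⟨Φ 0 θ, radialVec Φ 0 θ⟩ : TangentBundle (𝓡 2) M) =
      ⟨p, Real.cos θ • e₁ + Real.sin θ • e₂⟩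
  endpoint : ∀ θ : ℝ, Φ (2 * a) θ = q
  -- they are unit speed curves that realize the distance from `p`
  unit_speed : ∀ r ∈ Set.Icc 0 (2 * a), ∀ θ : ℝ, ‖radialVec Φ r θ‖ = 1
  minimizing : ∀ r ∈ Set.Icc 0 (2 * a), ∀ θ : ℝ, dist p (Φ r θ) = r
  -- `(r, θ)` are coordinates on the complement of the two poles
  regular : ∀ r ∈ Set.Ioo 0 (2 * a), ∀ θ : ℝ,
    LinearIndependent ℝ ![radialVec Φ r θ, angularVec Φ r θ]
  eq_iff : ∀ r ∈ Set.Ioo 0 (2 * a), ∀ θ θ' : ℝ,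
    Φ r θ = Φ r θ' ↔ ∃ k : ℤ, θ' = θ + 2 * Real.pi * k
  surj : ∀ x : M, x ≠ p → x ≠ q → ∃ r ∈ Set.Ioo 0 (2 * a), ∃ θ : ℝ, Φ r θ = x

/-! ### Zermelo navigation -/

/-- The Randers metric with navigation data `(h, W)`, where `h` is the Riemannian metric of `M`:
`F(x,y) = (√(λ ‖y‖²_h + W₀²) - W₀) / λ` with `λ = 1 - ‖W‖²_h` and `W₀ = h(W, y)`. -/
def randersMetric {n : ℕ} {M : Type*} [TopologicalSpace M]
    [ChartedSpace (EuclideanSpace ℝ (Fin n)) M]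
    [RiemannianBundle (fun x : M => TangentSpace (𝓡 n) x)]
    (W : (x : M) → TangentSpace (𝓡 n) x) (x : M) (y : TangentSpace (𝓡 n) x) : ℝ :=
  (Real.sqrt ((1 - ‖W x‖ ^ 2) * ‖y‖ ^ 2 + (inner ℝ (W x) y) ^ 2) - inner ℝ (W x) y) /
    (1 - ‖W x‖ ^ 2)

end

/-! The field W generates the rotations about p, so it is a Killing field, and navigation by a
Killing field preserves curvature: unit speed geodesics of F are unit speed geodesics of h carried
along by the flow of W, which consists of isometries of h. Two independent arguments make this
precise.

Local computation. Put A = ∇W, X = w - F W and N = F + h(X, W). The Randers formula says that h(X,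
X) = F² (`metric_unwind_self`), and implicit differentiation gives dF (`fderiv_finsler`). Along the
vector field defined by G = ½ Γ(w, w) - F A w + ½ F² A W, both F and N are constant and the
Euler-Lagrange equation holds (`hasDerivAt_dirDeriv_geodesic`), so G is the spray of F (`spray_eq`).
A Killing field satisfies (∇_v A) a = -R(W, v) a, which trades the second derivatives of W in the
Riemann curvature of F for the curvature of h. On a surface R(a, b) c = K (h(b, c) a - h(a, c) b)
(`curvatureTensor_eq`), and the curvature of F collapses to v ↦ K (F² v - F F_v w) (`riemann_eq`),
whose flag curvature is K (`flagCurvature_eq`).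

Rotational symmetry. Since the meridians minimize the distance from p, the Gauss lemma holds and h =
dr² + m² dθ² (`inner_polarDeriv`). An isometry fixing p that matches two points at the same distance
from p carries one whole meridian to the other and changes m² by a constant factor along it. Since m
/ r → 1 at p, the factor is 1, so m depends on r alone (`norm_angularVec_eq`). Hence the Lie
derivative of h along W vanishes off the poles, and by continuity at the poles
(`lieDerivForm_eq_zero`). It is computed in charts of M, so the poles need no separate curvature
computation. -/

/-! ### Derivatives along lines -/

section Line

variable {V V' : Type*} [NormedAddCommGroup V] [NormedSpace ℝ V]
  [NormedAddCommGroup V'] [NormedSpace ℝ V']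

noncomputable local instance : NormedAddCommGroup (V →L[ℝ] V →L[ℝ] V') :=
  ContinuousLinearMap.toNormedAddCommGroup

noncomputable local instance : NormedSpace ℝ (V →L[ℝ] V →L[ℝ] V') :=
  ContinuousLinearMap.toNormedSpace

theorem DifferentiableAt.hasDerivAt_comp_line {f : V → V'} {u : V} (hf : DifferentiableAt ℝ f u)
    (v : V) : HasDerivAt (fun t : ℝ => f (u + t • v)) (fderiv ℝ f u v) 0 := by
  have hl : HasDerivAt (fun t : ℝ => u + t • v) v 0 := by
    simpa using ((hasDerivAt_id (0 : ℝ)).smul_const v).const_add u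
  have hf' : HasFDerivAt f (fderiv ℝ f u) (u + (0 : ℝ) • v) := by
    simpa using hf.hasFDerivAt
  exact hf'.comp_hasDerivAt (0 : ℝ) hl

/-- Reduces a total derivative on E × E to one-variable product rules along a line, which is how the
derivatives of the Randers metric and of its spray are computed. -/
theorem fderiv_apply_eq_of_hasDerivAt_line {f : V → V'} {u v : V} {c : V'}
    (hf : DifferentiableAt ℝ f u) (h : HasDerivAt (fun t : ℝ => f (u + t • v)) c 0) :
    fderiv ℝ f u v = c :=
  (hf.hasDerivAt_comp_line v).unique h

theorem DifferentiableAt.hasDerivAt_comp_line_fst {f : V → V'} {u : V}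
    (hf : DifferentiableAt ℝ f u) (w : V) (z : V × V) :
    HasDerivAt (fun t : ℝ => f ((u, w) + t • z).1) (fderiv ℝ f u z.1) 0 := by
  simpa using hf.hasDerivAt_comp_line z.1

theorem hasDerivAt_line_snd (u w : V) (z : V × V) :
    HasDerivAt (fun t : ℝ => ((u, w) + t • z).2) z.2 0 := by
  simpa using ((hasDerivAt_id (0 : ℝ)).smul_const z.2).const_add w

theorem HasDerivAt.clm_apply_line_fst {L : V → V →L[ℝ] V'} {u w : V}
    (hL : DifferentiableAt ℝ L u) {z : V × V} {a : ℝ → V} {a' : V} (ha : HasDerivAt a a' 0) :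
    HasDerivAt (fun t : ℝ => L ((u, w) + t • z).1 (a t))
      (fderiv ℝ L u z.1 (a 0) + L u a') 0 := by
  have h := (DifferentiableAt.hasDerivAt_comp_line_fst (V' := V →L[ℝ] V') hL w z).clm_apply ha
  convert h using 1
  simp

theorem HasDerivAt.clm_apply₂_line_fst {B : V → V →L[ℝ] V →L[ℝ] V'} {u w : V}
    (hB : DifferentiableAt ℝ B u) {z : V × V} {a b : ℝ → V} {a' b' : V}
    (ha : HasDerivAt a a' 0) (hb : HasDerivAt b b' 0) :
    HasDerivAt (fun t : ℝ => B ((u, w) + t • z).1 (a t) (b t))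
      (fderiv ℝ B u z.1 (a 0) (b 0) + B u a' (b 0) + B u (a 0) b') 0 := by
  have h := ((DifferentiableAt.hasDerivAt_comp_line_fst (V' := V →L[ℝ] V →L[ℝ] V') hB w z).clm_apply
    ha).clm_apply hb
  convert h using 1
  simp

theorem DifferentiableAt.clm_apply_fst {L : V → V →L[ℝ] V'} {z : V × V} {a : V × V → V}
    (hL : DifferentiableAt ℝ L z.1) (ha : DifferentiableAt ℝ a z) :
    DifferentiableAt ℝ (fun x : V × V => L x.1 (a x)) z :=
  (DifferentiableAt.comp (G := V →L[ℝ] V') z hL differentiableAt_fst).clm_apply ha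

theorem DifferentiableAt.clm_apply₂_fst {B : V → V →L[ℝ] V →L[ℝ] V'} {z : V × V}
    {a b : V × V → V} (hB : DifferentiableAt ℝ B z.1) (ha : DifferentiableAt ℝ a z)
    (hb : DifferentiableAt ℝ b z) :
    DifferentiableAt ℝ (fun x : V × V => B x.1 (a x) (b x)) z :=
  ((DifferentiableAt.comp (G := V →L[ℝ] V →L[ℝ] V') (g := B) (f := Prod.fst) z hB differentiableAt_fst).clm_apply
    ha).clm_apply hb

end Line

/-! ### The Randers metric of a Killing navigation problem and its differential -/

section Navigation

variable {E : Type*} [NormedAddCommGroup E] [NormedSpace ℝ E]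

noncomputable local instance : NormedAddCommGroup (E →L[ℝ] E →L[ℝ] ℝ) :=
  ContinuousLinearMap.toNormedAddCommGroup
noncomputable local instance : NormedAddCommGroup (E →L[ℝ] E →L[ℝ] E) :=
  ContinuousLinearMap.toNormedAddCommGroup

noncomputable local instance : NormedSpace ℝ (E →L[ℝ] E →L[ℝ] ℝ) :=
  ContinuousLinearMap.toNormedSpace
noncomputable local instance : NormedSpace ℝ (E →L[ℝ] E →L[ℝ] E) :=
  ContinuousLinearMap.toNormedSpace

/-- The covariant derivative `∇W` of the vector field `W` for the connection with Christoffel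
symbols `Γ`. -/
noncomputable def covDeriv (Γ : E → E →L[ℝ] E →L[ℝ] E) (W : E → E) (u : E) : E →L[ℝ] E :=
  fderiv ℝ W u + (Γ u).flip (W u)

/-- The curvature tensor `R(a, b) c` of the connection with Christoffel symbols `Γ`. -/
noncomputable def curvatureTensor (Γ : E → E →L[ℝ] E →L[ℝ] E) (u a b c : E) : E :=
  fderiv ℝ Γ u a b c - fderiv ℝ Γ u b a c + Γ u a (Γ u b c) - Γ u b (Γ u a c)

/-- `F` is the Randers metric on `U` whose navigation data are the Riemannian metric `H`, with
Levi-Civita connection `Γ`, and the Killing vector field `W`. -/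
structure IsKillingNavigation (U : Set E) (H : E → E →L[ℝ] E →L[ℝ] ℝ)
    (Γ : E → E →L[ℝ] E →L[ℝ] E) (W : E → E) (F : E → E → ℝ) : Prop where
  isOpen : IsOpen U
  contDiffOn_metric : ContDiffOn ℝ ∞ H U
  contDiffOn_connection : ContDiffOn ℝ ∞ Γ U
  contDiffOn_field : ContDiffOn ℝ ∞ W U
  metric_symm : ∀ u ∈ U, ∀ a b, H u a b = H u b a
  metric_pos : ∀ u ∈ U, ∀ a, a ≠ 0 → 0 < H u a a
  connection_symm : ∀ u ∈ U, ∀ a b, Γ u a b = Γ u b a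
  compatible : ∀ u ∈ U, ∀ v a b, fderiv ℝ H u v a b = H u (Γ u v a) b + H u a (Γ u v b)
  killing : ∀ u ∈ U, ∀ a b, H u (covDeriv Γ W u a) b + H u a (covDeriv Γ W u b) = 0
  speed : ∀ u ∈ U, H u (W u) (W u) < 1
  eq_randers : ∀ u ∈ U, ∀ w, F u w =
    (√((1 - H u (W u) (W u)) * H u w w + (H u (W u) w) ^ 2) - H u (W u) w) /
      (1 - H u (W u) (W u))

namespace IsKillingNavigation

variable {U : Set E} {H : E → E →L[ℝ] E →L[ℝ] ℝ} {Γ : E → E →L[ℝ] E →L[ℝ] E} {W : E → E}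
  {F : E → E → ℝ}

/-- The vector `w - F W`, of `H`-length `F`. -/
noncomputable def unwind (W : E → E) (F : E → E → ℝ) (u w : E) : E := w - F u w • W u

/-- The factor `F + h(w - F W, W)`. -/
noncomputable def lapse (H : E → E →L[ℝ] E →L[ℝ] ℝ) (W : E → E) (F : E → E → ℝ) (u w : E) : ℝ :=
  F u w + H u (unwind W F u w) (W u)

theorem differentiableAt_metric (h : IsKillingNavigation U H Γ W F) {u : E} (hu : u ∈ U) :
    DifferentiableAt ℝ H u :=
  (h.contDiffOn_metric.contDiffAt (h.isOpen.mem_nhds hu)).differentiableAt (by simp)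

theorem differentiableAt_connection (h : IsKillingNavigation U H Γ W F) {u : E} (hu : u ∈ U) :
    DifferentiableAt ℝ Γ u :=
  (h.contDiffOn_connection.contDiffAt (h.isOpen.mem_nhds hu)).differentiableAt (by simp)

theorem differentiableAt_field (h : IsKillingNavigation U H Γ W F) {u : E} (hu : u ∈ U) :
    DifferentiableAt ℝ W u :=
  (h.contDiffOn_field.contDiffAt (h.isOpen.mem_nhds hu)).differentiableAt (by simp)

theorem differentiableAt_fderiv_field (h : IsKillingNavigation U H Γ W F) {u : E} (hu : u ∈ U) :
    DifferentiableAt ℝ (fderiv ℝ W) u :=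
  ((h.contDiffOn_field.contDiffAt (h.isOpen.mem_nhds hu)).fderiv_right (m := 1)
    (by norm_cast)).differentiableAt (by simp)

theorem differentiableAt_covDeriv (h : IsKillingNavigation U H Γ W F) {u : E} (hu : u ∈ U) :
    DifferentiableAt ℝ (covDeriv Γ W) u := by
  have h1 := h.differentiableAt_fderiv_field hu
  have h2 : DifferentiableAt ℝ (fun u => (Γ u).flip) u :=
    (ContinuousLinearMap.flipₗᵢ ℝ E E E).toContinuousLinearEquiv.differentiableAt.comp u
      (h.differentiableAt_connection hu)
  exact h1.add (h2.clm_apply (h.differentiableAt_field hu))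

theorem fderiv_covDeriv (h : IsKillingNavigation U H Γ W F) {u : E} (hu : u ∈ U) (v a : E) :
    fderiv ℝ (covDeriv Γ W) u v a = fderiv ℝ (fderiv ℝ W) u v a + fderiv ℝ Γ u v a (W u) +
      Γ u a (fderiv ℝ W u v) := by
  have hA := h.differentiableAt_covDeriv hu
  have h1 := HasDerivAt.clm_apply_line_fst (w := 0) (z := (v, 0))
    (h.differentiableAt_fderiv_field hu) (hasDerivAt_const (0 : ℝ) a)
  have h2 := HasDerivAt.clm_apply₂_line_fst (w := 0) (z := (v, 0))
    (h.differentiableAt_connection hu) (hasDerivAt_const (0 : ℝ) a)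
    ((h.differentiableAt_field hu).hasDerivAt_comp_line_fst 0 (v, 0))
  have h3 := HasDerivAt.clm_apply_line_fst (w := 0) (z := (v, 0)) hA (hasDerivAt_const (0 : ℝ) a)
  have h4 := h3.unique (h1.add h2)
  simpa [add_assoc] using h4

section Pointwise

variable (h : IsKillingNavigation U H Γ W F) {u w : E} (hu : u ∈ U)
include h hu

theorem metric_nonneg (a : E) : 0 ≤ H u a a := by
  by_cases ha : a = 0
  · simp [ha]
  · exact (h.metric_pos u hu a ha).le

theorem sq_le_mul_metric (a b : E) : (H u a b) ^ 2 ≤ H u a a * H u b b := by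
  by_cases hb : b = 0
  · simp [hb]
  have hpos := h.metric_pos u hu b hb
  -- The usual Cauchy-Schwarz vector: its square length is H(b, b) times the Gram determinant of a
  -- and b.
  have h1 := h.metric_nonneg hu (H u b b • a - H u a b • b)
  simp only [map_sub, map_smul, sub_apply, smul_apply,
    smul_eq_mul, h.metric_symm u hu b a] at h1
  have h2 : 0 ≤ H u b b * (H u a a * H u b b - (H u a b) ^ 2) := by nlinarith
  nlinarith [nonneg_of_mul_nonneg_right h2 hpos]

theorem metric_covDeriv_self (a : E) : H u a (covDeriv Γ W u a) = 0 := by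
  have := h.killing u hu a a
  rw [h.metric_symm u hu] at this
  linarith

theorem discr_pos (hw : w ≠ 0) :
    0 < (1 - H u (W u) (W u)) * H u w w + (H u (W u) w) ^ 2 := by
  have := h.metric_pos u hu w hw
  have := h.speed u hu
  have : 0 < (1 - H u (W u) (W u)) * H u w w := mul_pos (by linarith) (by assumption)
  positivity

/-- Expanding the definition, N = λF + H(W, w), which is exactly the square root in the Randers
formula. So N is positive for w ≠ 0, and dividing by it is legitimate. -/
theorem lapse_eq : lapse H W F u w =
    √((1 - H u (W u) (W u)) * H u w w + (H u (W u) w) ^ 2) := by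
  have := h.speed u hu
  have hne : 1 - H u (W u) (W u) ≠ 0 := by linarith
  simp only [lapse, unwind, map_sub, map_smul, sub_apply,
    smul_apply, smul_eq_mul, h.metric_symm u hu w (W u)]
  have h1 := h.eq_randers u hu w
  field_simp at h1
  linarith

theorem lapse_pos (hw : w ≠ 0) : 0 < lapse H W F u w := by
  rw [h.lapse_eq hu]
  exact Real.sqrt_pos.2 (h.discr_pos hu hw)

theorem finsler_pos (hw : w ≠ 0) : 0 < F u w := by
  have h1 := h.speed u hu
  have h2 := h.metric_pos u hu w hw
  rw [h.eq_randers u hu w]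
  refine div_pos ?_ (by linarith)
  rw [sub_pos]
  apply Real.lt_sqrt_of_sq_lt
  nlinarith [mul_pos (sub_pos.2 h1) h2]

/-- Zermelo's condition: w is F times the sum of W and an H-unit vector. Squaring N = λF + H(W, w)
and cancelling λ > 0 leaves this quadratic equation for F. -/
theorem metric_unwind_self (hw : w ≠ 0) :
    H u (unwind W F u w) (unwind W F u w) = F u w ^ 2 := by
  have h1 := h.speed u hu
  have hD := Real.sq_sqrt (h.discr_pos hu hw).le
  rw [← h.lapse_eq hu] at hD
  simp only [lapse, unwind, map_sub, map_smul, sub_apply,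
    smul_apply, smul_eq_mul, h.metric_symm u hu w (W u)] at hD ⊢
  have h2 : (1 - H u (W u) (W u)) * (H u w w - F u w * H u (W u) w -
      F u w * (H u (W u) w - F u w * H u (W u) (W u)) - F u w ^ 2) = 0 := by
    linear_combination -hD
  have h3 := (mul_eq_zero.1 h2).resolve_left (by linarith)
  linarith

theorem differentiableAt_finsler (hw : w ≠ 0) :
    DifferentiableAt ℝ (fun z : E × E => F z.1 z.2) (u, w) := by
  have hW : DifferentiableAt ℝ (fun z : E × E => W z.1) (u, w) :=
    (h.differentiableAt_field hu).comp (u, w) differentiableAt_fst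
  have hs : DifferentiableAt ℝ (fun z : E × E => z.2) (u, w) := differentiableAt_snd
  have hne := (h.discr_pos hu hw).ne'
  have hl : 1 - H u (W u) (W u) ≠ 0 := by linarith [h.speed u hu]
  have hH := h.differentiableAt_metric hu
  have e1 := (DifferentiableAt.clm_apply₂_fst (z := (u, w)) hH hW hW).const_sub 1
  have e2 := DifferentiableAt.clm_apply₂_fst (z := (u, w)) hH hs hs
  have e3 := DifferentiableAt.clm_apply₂_fst (z := (u, w)) hH hW hs
  refine DifferentiableAt.congr_of_eventuallyEq
    (((((e1.mul e2).add (e3.pow 2)).sqrt hne).sub e3).mul (e1.inv hl)) ?_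
  have hU : ∀ᶠ z : E × E in nhds (u, w), z.1 ∈ U :=
    continuous_fst.continuousAt.eventually (h.isOpen.mem_nhds hu)
  filter_upwards [hU] with z hz
  simp only [h.eq_randers z.1 hz z.2, div_eq_mul_inv]
  rfl

/-- Implicit differentiation of H(X, X) = F². Metric compatibility groups the position derivatives
into covariant ones, the Killing equation moves ∇W onto X, and the total coefficient of dF is N. -/
theorem fderiv_finsler (hw : w ≠ 0) (z : E × E) :
    fderiv ℝ (fun z : E × E => F z.1 z.2) (u, w) z =
      (H u (unwind W F u w) (z.2 + Γ u z.1 w) +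
        F u w * H u (covDeriv Γ W u (unwind W F u w)) z.1) / lapse H W F u w := by
  have hF := (h.differentiableAt_finsler hu hw).hasDerivAt_comp_line z
  have hW := (h.differentiableAt_field hu).hasDerivAt_comp_line_fst w z
  have hX := (hasDerivAt_line_snd u w z).sub (hF.smul hW)
  have h1 := HasDerivAt.clm_apply₂_line_fst (w := w) (z := z) (h.differentiableAt_metric hu) hX hX
  have h2 := hF.pow 2
  -- The identity H(X, X) = F² requires a point of U and a nonzero vector; both persist for small t.
  have hev : ∀ᶠ t : ℝ in nhds 0, ((u, w) + t • z).1 ∈ U ∧ ((u, w) + t • z).2 ≠ 0 := by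
    have hc : ContinuousAt (fun t : ℝ => (u, w) + t • z) 0 := by fun_prop
    have ho : IsOpen (U ×ˢ ({0}ᶜ : Set E)) := h.isOpen.prod isOpen_compl_singleton
    have := hc.eventually (ho.mem_nhds (by simpa using ⟨hu, hw⟩))
    filter_upwards [this] with t ht using ⟨ht.1, ht.2⟩
  have h3 := h1.unique (h2.congr_of_eventuallyEq (by
    filter_upwards [hev] with t ht using h.metric_unwind_self ht.1 ht.2))
  simp only [zero_smul, add_zero] at h3
  set c := fderiv ℝ (fun z : E × E => F z.1 z.2) (u, w) z with hc
  have hN := h.lapse_pos hu hw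
  rw [eq_div_iff hN.ne']
  set X := unwind W F u w with hXd
  have hX' : w - F u w • W u = X := rfl
  have hwX : w = X + F u w • W u := by rw [← hX']; abel
  have hk := h.killing u hu X z.1
  have hcov : fderiv ℝ W u z.1 = covDeriv Γ W u z.1 - Γ u z.1 (W u) := by
    simp [covDeriv]
  have hG : Γ u z.1 w = Γ u z.1 X + F u w • Γ u z.1 (W u) := by
    conv_lhs => rw [hwX]
    simp
  simp only [Pi.sub_apply, Pi.smul_apply', hX', h.compatible u hu, hcov, map_sub, map_add, map_smul,
    sub_apply, add_apply, smul_apply,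
    smul_eq_mul, zero_smul, add_zero, hG, lapse, ← hXd, h.metric_symm u hu _ X] at h3 hk ⊢
  push_cast at h3
  linear_combination (-1/2) * h3 - F u w * hk

end Pointwise
end IsKillingNavigation
end Navigation

/-! ### The geodesic spray of the Randers metric -/

section NavigationSpray

variable {E : Type*} [NormedAddCommGroup E] [NormedSpace ℝ E]

noncomputable local instance : NormedAddCommGroup (E →L[ℝ] E →L[ℝ] ℝ) :=
  ContinuousLinearMap.toNormedAddCommGroup
noncomputable local instance : NormedAddCommGroup (E →L[ℝ] E →L[ℝ] E) :=
  ContinuousLinearMap.toNormedAddCommGroup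
noncomputable local instance : NormedSpace ℝ (E →L[ℝ] E →L[ℝ] ℝ) :=
  ContinuousLinearMap.toNormedSpace
noncomputable local instance : NormedSpace ℝ (E →L[ℝ] E →L[ℝ] E) :=
  ContinuousLinearMap.toNormedSpace

namespace IsKillingNavigation

variable {U : Set E} {H : E → E →L[ℝ] E →L[ℝ] ℝ} {Γ : E → E →L[ℝ] E →L[ℝ] E} {W : E → E}
  {F : E → E → ℝ}

/-- The derivative `F_v` of the Randers metric with respect to the direction. -/
noncomputable def dirDeriv (H : E → E →L[ℝ] E →L[ℝ] ℝ) (W : E → E) (F : E → E → ℝ)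
    (v u w : E) : ℝ :=
  H u (unwind W F u w) v / lapse H W F u w

/-- The geodesic spray of the Randers metric. -/
noncomputable def geodSpray (Γ : E → E →L[ℝ] E →L[ℝ] E) (W : E → E) (F : E → E → ℝ)
    (u w : E) : E :=
  (1 / 2 : ℝ) • Γ u w w - F u w • covDeriv Γ W u w + (F u w ^ 2 / 2) • covDeriv Γ W u (W u)

/-- The derivative in the direction `v` of the geodesic spray of the Randers metric. -/
noncomputable def sprayDeriv (H : E → E →L[ℝ] E →L[ℝ] ℝ) (Γ : E → E →L[ℝ] E →L[ℝ] E)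
    (W : E → E) (F : E → E → ℝ) (v u w : E) : E :=
  Γ u w v - dirDeriv H W F v u w • covDeriv Γ W u (unwind W F u w) - F u w • covDeriv Γ W u v

variable (h : IsKillingNavigation U H Γ W F) {u w : E} (hu : u ∈ U)
include h hu

omit h hu in
theorem covDeriv_apply_eq (v : E) :
    fderiv ℝ W u v = covDeriv Γ W u v - Γ u v (W u) := by
  simp [covDeriv]

theorem hasDerivAt_unwind (hw : w ≠ 0) (z : E × E) :
    HasDerivAt (fun t : ℝ => unwind W F ((u, w) + t • z).1 ((u, w) + t • z).2)
      (z.2 - (F u w • fderiv ℝ W u z.1 +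
        fderiv ℝ (fun z : E × E => F z.1 z.2) (u, w) z • W u)) 0 := by
  have hF := (h.differentiableAt_finsler hu hw).hasDerivAt_comp_line z
  have hW := (h.differentiableAt_field hu).hasDerivAt_comp_line_fst w z
  have hX := (hasDerivAt_line_snd u w z).sub (hF.smul hW)
  refine hX.congr_deriv ?_
  simp

/-- The derivative X' of X is left as a parameter, so that the same computation serves the vertical
directions (fundamental tensor) and the spray direction (geodesics). -/
theorem hasDerivAt_lapse (hw : w ≠ 0) (z : E × E) {X' : E}
    (hX : HasDerivAt (fun t : ℝ => unwind W F ((u, w) + t • z).1 ((u, w) + t • z).2) X' 0) :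
    HasDerivAt (fun t : ℝ => lapse H W F ((u, w) + t • z).1 ((u, w) + t • z).2)
      (fderiv ℝ (fun z : E × E => F z.1 z.2) (u, w) z +
        (H u (Γ u z.1 (unwind W F u w) + X') (W u) +
          H u (unwind W F u w) (covDeriv Γ W u z.1))) 0 := by
  have hF := (h.differentiableAt_finsler hu hw).hasDerivAt_comp_line z
  have hW := (h.differentiableAt_field hu).hasDerivAt_comp_line_fst w z
  have := hF.add
    (HasDerivAt.clm_apply₂_line_fst (w := w) (z := z) (h.differentiableAt_metric hu) hX hW)
  refine HasDerivAt.congr_deriv this ?_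
  simp only [zero_smul, add_zero, h.compatible u hu, covDeriv_apply_eq (Γ := Γ), map_add, map_sub,
    add_apply]
  ring

theorem hasDerivAt_dirDeriv (hw : w ≠ 0) (v : E) (z : E × E) {X' : E} {N' : ℝ}
    (hX : HasDerivAt (fun t : ℝ => unwind W F ((u, w) + t • z).1 ((u, w) + t • z).2) X' 0)
    (hN : HasDerivAt (fun t : ℝ => lapse H W F ((u, w) + t • z).1 ((u, w) + t • z).2) N' 0) :
    HasDerivAt (fun t : ℝ => dirDeriv H W F v ((u, w) + t • z).1 ((u, w) + t • z).2)
      ((H u (Γ u z.1 (unwind W F u w) + X') v + H u (unwind W F u w) (Γ u z.1 v)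
        - dirDeriv H W F v u w * N') / lapse H W F u w) 0 := by
  have hN0 := (h.lapse_pos hu hw).ne'
  have := (HasDerivAt.clm_apply₂_line_fst (w := w) (z := z) (h.differentiableAt_metric hu) hX
    (hasDerivAt_const (0 : ℝ) v)).div hN (by simpa using hN0)
  refine HasDerivAt.congr_deriv this ?_
  simp only [zero_smul, add_zero, h.compatible u hu, map_add, map_zero, dirDeriv, add_apply]
  field_simp
  ring

theorem differentiableAt_unwind (hw : w ≠ 0) :
    DifferentiableAt ℝ (fun z : E × E => unwind W F z.1 z.2) (u, w) := by
  have hW : DifferentiableAt ℝ (fun z : E × E => W z.1) (u, w) :=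
    (h.differentiableAt_field hu).comp (u, w) differentiableAt_fst
  exact differentiableAt_snd.sub ((h.differentiableAt_finsler hu hw).smul hW)

theorem differentiableAt_dirDeriv (hw : w ≠ 0) (v : E) :
    DifferentiableAt ℝ (fun z : E × E => dirDeriv H W F v z.1 z.2) (u, w) := by
  have hW : DifferentiableAt ℝ (fun z : E × E => W z.1) (u, w) :=
    (h.differentiableAt_field hu).comp (u, w) differentiableAt_fst
  have hX := h.differentiableAt_unwind hu hw
  have hH := h.differentiableAt_metric hu
  have hN : DifferentiableAt ℝ (fun z : E × E => lapse H W F z.1 z.2) (u, w) :=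
    (h.differentiableAt_finsler hu hw).add
      (DifferentiableAt.clm_apply₂_fst (z := (u, w)) hH hX hW)
  have h1 := DifferentiableAt.clm_apply₂_fst (z := (u, w)) hH hX (differentiableAt_const v)
  simpa only [dirDeriv, div_eq_mul_inv] using! h1.mul (hN.inv (h.lapse_pos hu hw).ne')

theorem differentiableAt_geodSpray (hw : w ≠ 0) :
    DifferentiableAt ℝ (fun z : E × E => geodSpray Γ W F z.1 z.2) (u, w) := by
  have hW : DifferentiableAt ℝ (fun z : E × E => W z.1) (u, w) :=
    (h.differentiableAt_field hu).comp (u, w) differentiableAt_fst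
  have hF := h.differentiableAt_finsler hu hw
  have hA := h.differentiableAt_covDeriv hu
  have hs : DifferentiableAt ℝ (fun z : E × E => z.2) (u, w) := differentiableAt_snd
  have h1 := DifferentiableAt.clm_apply₂_fst (z := (u, w)) (h.differentiableAt_connection hu) hs hs
  have h2 := DifferentiableAt.clm_apply_fst (z := (u, w)) hA hs
  have h3 := DifferentiableAt.clm_apply_fst (z := (u, w)) hA hW
  have h4 : DifferentiableAt ℝ (fun z : E × E => F z.1 z.2 ^ 2 / 2) (u, w) := by
    simpa only [div_eq_mul_inv] using! (hF.pow 2).mul_const (2 : ℝ)⁻¹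
  exact ((h1.const_smul (1 / 2 : ℝ)).sub (hF.smul h2)).add (h4.smul h3)

theorem differentiableAt_sprayDeriv (hw : w ≠ 0) (v : E) :
    DifferentiableAt ℝ (fun z : E × E => sprayDeriv H Γ W F v z.1 z.2) (u, w) := by
  have hF := h.differentiableAt_finsler hu hw
  have hA := h.differentiableAt_covDeriv hu
  have hs : DifferentiableAt ℝ (fun z : E × E => z.2) (u, w) := differentiableAt_snd
  have hv : DifferentiableAt ℝ (fun _ : E × E => v) (u, w) := differentiableAt_const v
  have h1 := DifferentiableAt.clm_apply₂_fst (z := (u, w)) (h.differentiableAt_connection hu) hs hv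
  have h2 := DifferentiableAt.clm_apply_fst (z := (u, w)) hA (h.differentiableAt_unwind hu hw)
  have h3 := DifferentiableAt.clm_apply_fst (z := (u, w)) hA hv
  exact (h1.sub ((h.differentiableAt_dirDeriv hu hw v).smul h2)).sub (hF.smul h3)

theorem fderiv_finsler_snd (hw : w ≠ 0) (v : E) :
    fderiv ℝ (fun z : E × E => F z.1 z.2) (u, w) (0, v) = dirDeriv H W F v u w := by
  simp [h.fderiv_finsler hu hw, dirDeriv]

theorem fderiv_geodSpray (hw : w ≠ 0) (z : E × E) :
    fderiv ℝ (fun z : E × E => geodSpray Γ W F z.1 z.2) (u, w) z =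
      (1 / 2 : ℝ) • fderiv ℝ Γ u z.1 w w + Γ u w z.2
      - fderiv ℝ (fun z : E × E => F z.1 z.2) (u, w) z • covDeriv Γ W u (unwind W F u w)
      - F u w • (fderiv ℝ (covDeriv Γ W) u z.1 w + covDeriv Γ W u z.2)
      + (F u w ^ 2 / 2) • (fderiv ℝ (covDeriv Γ W) u z.1 (W u)
          + covDeriv Γ W u (fderiv ℝ W u z.1)) := by
  have hW := (h.differentiableAt_field hu).hasDerivAt_comp_line_fst w z
  have hF := (h.differentiableAt_finsler hu hw).hasDerivAt_comp_line z
  have hA := h.differentiableAt_covDeriv hu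
  have hs := hasDerivAt_line_snd u w z
  have h1 := HasDerivAt.clm_apply₂_line_fst (w := w) (z := z)
    (h.differentiableAt_connection hu) hs hs
  have h2 := HasDerivAt.clm_apply_line_fst (w := w) (z := z) hA hs
  have h3 := HasDerivAt.clm_apply_line_fst (w := w) (z := z) hA hW
  refine fderiv_apply_eq_of_hasDerivAt_line (h.differentiableAt_geodSpray hu hw) ?_
  have h4 := ((h1.const_smul (1 / 2 : ℝ)).sub (hF.smul h2)).add
    (((hF.pow 2).div_const (2 : ℝ)).smul h3)
  refine HasDerivAt.congr_deriv h4 ?_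
  simp only [zero_smul, add_zero, unwind, map_sub, map_smul, h.connection_symm u hu z.2 w, Pi.pow_apply]
  push_cast
  module

theorem fderiv_geodSpray_snd (hw : w ≠ 0) (v : E) :
    fderiv ℝ (fun z : E × E => geodSpray Γ W F z.1 z.2) (u, w) (0, v) =
      sprayDeriv H Γ W F v u w := by
  rw [h.fderiv_geodSpray hu hw, h.fderiv_finsler_snd hu hw, sprayDeriv]
  simp

theorem hasDerivAt_sprayDeriv (hw : w ≠ 0) (v : E) (z : E × E) {X' : E} {c' : ℝ}
    (hX : HasDerivAt (fun t : ℝ => unwind W F ((u, w) + t • z).1 ((u, w) + t • z).2) X' 0)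
    (hc : HasDerivAt (fun t : ℝ => dirDeriv H W F v ((u, w) + t • z).1 ((u, w) + t • z).2) c' 0) :
    HasDerivAt (fun t : ℝ => sprayDeriv H Γ W F v ((u, w) + t • z).1 ((u, w) + t • z).2)
      (fderiv ℝ Γ u z.1 w v + Γ u z.2 v - c' • covDeriv Γ W u (unwind W F u w)
        - dirDeriv H W F v u w • (fderiv ℝ (covDeriv Γ W) u z.1 (unwind W F u w)
          + covDeriv Γ W u X')
        - fderiv ℝ (fun z : E × E => F z.1 z.2) (u, w) z • covDeriv Γ W u v
        - F u w • fderiv ℝ (covDeriv Γ W) u z.1 v) 0 := by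
  have hF := (h.differentiableAt_finsler hu hw).hasDerivAt_comp_line z
  have hA := h.differentiableAt_covDeriv hu
  have hs := hasDerivAt_line_snd u w z
  have h1 := HasDerivAt.clm_apply₂_line_fst (w := w) (z := z)
    (h.differentiableAt_connection hu) hs (hasDerivAt_const (0 : ℝ) v)
  have h2 := HasDerivAt.clm_apply_line_fst (w := w) (z := z) hA hX
  have h3 := HasDerivAt.clm_apply_line_fst (w := w) (z := z) hA (hasDerivAt_const (0 : ℝ) v)
  have h4 := (h1.sub (hc.smul h2)).sub (hF.smul h3)
  refine HasDerivAt.congr_deriv h4 ?_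
  simp only [zero_smul, add_zero, map_zero]
  module

omit h hu in
theorem unwind_add : unwind W F u w + F u w • W u = w := by
  simp [unwind]

/-- `F` is constant along its geodesics. -/
theorem fderiv_finsler_geodesic (hw : w ≠ 0) :
    fderiv ℝ (fun z : E × E => F z.1 z.2) (u, w) (w, (-2 : ℝ) • geodSpray Γ W F u w) = 0 := by
  rw [h.fderiv_finsler hu hw, div_eq_zero_iff]
  left
  have hX := unwind_add (W := W) (F := F) (u := u) (w := w)
  have h0 := h.metric_covDeriv_self hu (unwind W F u w)
  -- Splitting w = X + F W, only the skewness of ∇W on the pairs (X, X) and (X, W) is needed.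
  have h1 := h.killing u hu (unwind W F u w) (W u)
  have h2 : H u (covDeriv Γ W u (unwind W F u w)) w =
      F u w * H u (covDeriv Γ W u (unwind W F u w)) (W u) := by
    nth_rw 2 [← hX]
    rw [map_add, map_smul, h.metric_symm u hu, h0, smul_eq_mul, zero_add]
  have h3 : covDeriv Γ W u w =
      covDeriv Γ W u (unwind W F u w) + F u w • covDeriv Γ W u (W u) := by
    rw [← map_smul, ← map_add, hX]
  simp only [geodSpray, h2, h3, map_add, map_sub, map_smul, smul_eq_mul, h0]
  linear_combination (F u w ^ 2) * h1

/-- X has covariant derivative F ∇_X W along a geodesic of F; the term with Γ is the connection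
term. This is the behaviour of a velocity vector of an h-geodesic that is dragged by the flow of W.
-/
theorem hasDerivAt_unwind_geodesic (hw : w ≠ 0) :
    HasDerivAt (fun t : ℝ => unwind W F ((u, w) + t • (w, (-2 : ℝ) • geodSpray Γ W F u w)).1
        ((u, w) + t • (w, (-2 : ℝ) • geodSpray Γ W F u w)).2)
      (F u w • covDeriv Γ W u (unwind W F u w) - Γ u w (unwind W F u w)) 0 := by
  have h1 := h.hasDerivAt_unwind hu hw (w, (-2 : ℝ) • geodSpray Γ W F u w)
  rw [h.fderiv_finsler_geodesic hu hw] at h1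
  convert h1 using 1
  simp only [geodSpray, unwind, covDeriv_apply_eq (Γ := Γ), map_sub, map_smul]
  module

/-- A Clairaut relation: h(X, W) is conserved along the geodesics of F because W is Killing, and F
is conserved too. -/
theorem hasDerivAt_lapse_geodesic (hw : w ≠ 0) :
    HasDerivAt (fun t : ℝ => lapse H W F ((u, w) + t • (w, (-2 : ℝ) • geodSpray Γ W F u w)).1
        ((u, w) + t • (w, (-2 : ℝ) • geodSpray Γ W F u w)).2) 0 0 := by
  have h1 := h.hasDerivAt_lapse hu hw _ (h.hasDerivAt_unwind_geodesic hu hw)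
  rw [h.fderiv_finsler_geodesic hu hw] at h1
  convert h1 using 1
  have hX := unwind_add (W := W) (F := F) (u := u) (w := w)
  have h0 := h.metric_covDeriv_self hu (unwind W F u w)
  have h1 := h.killing u hu (unwind W F u w) (W u)
  have h3 : covDeriv Γ W u w =
      covDeriv Γ W u (unwind W F u w) + F u w • covDeriv Γ W u (W u) := by
    rw [← map_smul, ← map_add, hX]
  simp only [h3, map_add, map_sub, map_smul, smul_eq_mul, h0, add_apply, sub_apply, smul_apply]
  linear_combination - F u w * h1

/-- The Euler-Lagrange equation of F. As F is constant in the spray direction, it yields the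
equation for F², which is what identifies `geodSpray` with the spray defined by coordinates. -/
theorem hasDerivAt_dirDeriv_geodesic (hw : w ≠ 0) (v : E) :
    HasDerivAt (fun t : ℝ => dirDeriv H W F v
        ((u, w) + t • (w, (-2 : ℝ) • geodSpray Γ W F u w)).1
        ((u, w) + t • (w, (-2 : ℝ) • geodSpray Γ W F u w)).2)
      (fderiv ℝ (fun z : E × E => F z.1 z.2) (u, w) (v, 0)) 0 := by
  have h1 := h.hasDerivAt_dirDeriv hu hw v _ (h.hasDerivAt_unwind_geodesic hu hw)
    (h.hasDerivAt_lapse_geodesic hu hw)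
  convert h1 using 1
  rw [h.fderiv_finsler hu hw]
  simp [h.connection_symm u hu v w]
  ring

end IsKillingNavigation
end NavigationSpray

/-! ### The Riemann curvature of the Randers metric -/

section NavigationCurvature

variable {E : Type*} [NormedAddCommGroup E] [NormedSpace ℝ E]

noncomputable local instance : NormedAddCommGroup (E →L[ℝ] E →L[ℝ] ℝ) :=
  ContinuousLinearMap.toNormedAddCommGroup
noncomputable local instance : NormedAddCommGroup (E →L[ℝ] E →L[ℝ] E) :=
  ContinuousLinearMap.toNormedAddCommGroup
noncomputable local instance : NormedSpace ℝ (E →L[ℝ] E →L[ℝ] ℝ) :=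
  ContinuousLinearMap.toNormedSpace
noncomputable local instance : NormedSpace ℝ (E →L[ℝ] E →L[ℝ] E) :=
  ContinuousLinearMap.toNormedSpace

namespace IsKillingNavigation

variable {U : Set E} {H : E → E →L[ℝ] E →L[ℝ] ℝ} {Γ : E → E →L[ℝ] E →L[ℝ] E} {W : E → E}
  {F : E → E → ℝ}

variable (h : IsKillingNavigation U H Γ W F) {u w : E} (hu : u ∈ U)
include h hu

theorem eq_of_forall_metric_eq {a b : E} (hab : ∀ c, H u a c = H u b c) : a = b := by
  by_contra hne
  have := h.metric_pos u hu (a - b) (sub_ne_zero.2 hne)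
  rw [map_sub (H u), sub_apply, hab, sub_self] at this
  exact lt_irrefl _ this

theorem fderiv_connection_symm (v a b : E) :
    fderiv ℝ Γ u v a b = fderiv ℝ Γ u v b a := by
  have h1 := fun a b => HasDerivAt.clm_apply₂_line_fst (w := 0) (z := (v, 0))
    (h.differentiableAt_connection hu) (hasDerivAt_const (0 : ℝ) a) (hasDerivAt_const (0 : ℝ) b)
  have hev : ∀ᶠ t : ℝ in nhds 0, ((u, (0 : E)) + t • (v, (0 : E))).1 ∈ U := by
    have hc : ContinuousAt (fun t : ℝ => ((u, (0 : E)) + t • (v, (0 : E))).1) 0 := by fun_prop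
    exact hc.eventually (h.isOpen.mem_nhds (by simpa using hu))
  have h2 := (h1 a b).unique ((h1 b a).congr_of_eventuallyEq (by
    filter_upwards [hev] with t ht using h.connection_symm _ ht a b))
  simpa using h2

/-- The covariant derivative of the Killing equation: the brackets are (∇_v ∇W) a and (∇_v ∇W) b,
and skewness of ∇W passes to ∇_v ∇W. -/
theorem metric_fderiv_covDeriv (v a b : E) :
    H u (fderiv ℝ (covDeriv Γ W) u v a + Γ u v (covDeriv Γ W u a) - covDeriv Γ W u (Γ u v a)) b +
    H u (fderiv ℝ (covDeriv Γ W) u v b + Γ u v (covDeriv Γ W u b) - covDeriv Γ W u (Γ u v b)) a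
      = 0 := by
  have hA := fun a => HasDerivAt.clm_apply_line_fst (w := 0) (z := (v, 0))
    (h.differentiableAt_covDeriv hu) (hasDerivAt_const (0 : ℝ) a)
  have h1 := fun a b => HasDerivAt.clm_apply₂_line_fst (w := 0) (z := (v, 0))
    (h.differentiableAt_metric hu) (hA a) (hasDerivAt_const (0 : ℝ) b)
  have hev : ∀ᶠ t : ℝ in nhds 0, ((u, (0 : E)) + t • (v, (0 : E))).1 ∈ U := by
    have hc : ContinuousAt (fun t : ℝ => ((u, (0 : E)) + t • (v, (0 : E))).1) 0 := by fun_prop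
    exact hc.eventually (h.isOpen.mem_nhds (by simpa using hu))
  have h2 := ((h1 a b).add (h1 b a)).unique ((hasDerivAt_const (0 : ℝ) (0 : ℝ)).congr_of_eventuallyEq
    (by
      filter_upwards [hev] with t ht
      have := h.killing _ ht a b
      rw [h.metric_symm _ ht a] at this
      exact this))
  simp only [add_zero, zero_smul, map_zero, h.compatible u hu] at h2
  have h3 := h.killing u hu (Γ u v a) b
  have h4 := h.killing u hu (Γ u v b) a
  simp only [map_add, map_sub, add_apply, sub_apply]
  rw [h.metric_symm u hu _ (covDeriv Γ W u b)] at h3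
  rw [h.metric_symm u hu _ (covDeriv Γ W u a)] at h4
  linear_combination h2 - h3 - h4

/-- The Ricci identity for W: second derivatives of W commute, so antisymmetrizing ∇∇W leaves only
curvature. -/
theorem fderiv_covDeriv_sub (v a : E) :
    (fderiv ℝ (covDeriv Γ W) u v a + Γ u v (covDeriv Γ W u a) - covDeriv Γ W u (Γ u v a)) -
    (fderiv ℝ (covDeriv Γ W) u a v + Γ u a (covDeriv Γ W u v) - covDeriv Γ W u (Γ u a v))
      = curvatureTensor Γ u v a (W u) := by
  have hs : fderiv ℝ (fderiv ℝ W) u v a = fderiv ℝ (fderiv ℝ W) u a v :=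
    ((h.contDiffOn_field.contDiffAt (h.isOpen.mem_nhds hu)).isSymmSndFDerivAt
      (by rw [minSmoothness_of_isRCLikeNormedField]; norm_cast)).eq v a
  have e : ∀ x, covDeriv Γ W u x = fderiv ℝ W u x + Γ u x (W u) := fun x => by simp [covDeriv]
  simp only [h.fderiv_covDeriv hu, curvatureTensor, hs, h.connection_symm u hu a v, e, map_add]
  module

/-- A Killing field satisfies `(∇_v ∇W) a = -R(W, v) a`; here the curvature is constant on
planes. -/
theorem fderiv_covDeriv_eq {K : ℝ}
    (hK : ∀ a b c, curvatureTensor Γ u a b c = K • (H u b c • a - H u a c • b)) (v a : E) :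
    fderiv ℝ (covDeriv Γ W) u v a = K • (H u (W u) a • v - H u v a • W u)
      - Γ u v (covDeriv Γ W u a) + covDeriv Γ W u (Γ u v a) := by
  set T : E → E → E := fun v a =>
    fderiv ℝ (covDeriv Γ W) u v a + Γ u v (covDeriv Γ W u a) - covDeriv Γ W u (Γ u v a) with hT
  suffices hs : T v a = K • (H u (W u) a • v - H u v a • W u) by
    rw [← hs, hT]; module
  refine h.eq_of_forall_metric_eq hu fun b => ?_
  -- As in the Koszul formula, skewness in the last two slots together with the known
  -- antisymmetrization in the first two determines the trilinear form H(T v a, b).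
  have skew : ∀ v a b, H u (T v a) b + H u (T v b) a = 0 := h.metric_fderiv_covDeriv hu
  have exch : ∀ v a b, H u (T v a) b - H u (T a v) b =
      K * (H u a (W u) * H u v b - H u v (W u) * H u a b) := fun v a b => by
    rw [← sub_apply, ← map_sub, h.fderiv_covDeriv_sub hu, hK]
    simp
  have e1 := skew v a b
  have e2 := exch v b a
  have e3 := skew b v a
  have e4 := exch b a v
  have e5 := skew a b v
  have e6 := exch v a b
  simp only [map_sub, map_smul, sub_apply, smul_apply, smul_eq_mul]
  rw [h.metric_symm u hu a v, h.metric_symm u hu b v, h.metric_symm u hu b a,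
    h.metric_symm u hu a (W u), h.metric_symm u hu b (W u), h.metric_symm u hu v (W u)] at *
  linear_combination (1 / 2) * (e1 - e2 - e3 + e4 + e5 + e6)

omit h hu in
theorem metric_unwind_apply (a : E) :
    H u (unwind W F u w) a = H u w a - F u w * H u (W u) a := by
  simp [unwind]

theorem metric_apply_unwind (a : E) :
    H u a (unwind W F u w) = H u w a - F u w * H u (W u) a := by
  rw [h.metric_symm u hu, metric_unwind_apply]

/-- If `h` has constant curvature `K` at a point, then so has the Randers metric. -/
theorem riemann_eq (hw : w ≠ 0) {K : ℝ}
    (hK : ∀ a b c, curvatureTensor Γ u a b c = K • (H u b c • a - H u a c • b)) (v : E) :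
    (2 : ℝ) • fderiv ℝ (fun z : E × E => geodSpray Γ W F z.1 z.2) (u, w) (v, 0)
      - fderiv ℝ (fun z : E × E => sprayDeriv H Γ W F v z.1 z.2) (u, w)
          (w, (-2 : ℝ) • geodSpray Γ W F u w)
      - sprayDeriv H Γ W F (sprayDeriv H Γ W F v u w) u w =
    K • (F u w ^ 2 • v - (F u w * dirDeriv H W F v u w) • w) := by
  have hN := (h.lapse_pos hu hw).ne'
  have hS := fderiv_apply_eq_of_hasDerivAt_line (h.differentiableAt_sprayDeriv hu hw v)
    (h.hasDerivAt_sprayDeriv hu hw v _ (h.hasDerivAt_unwind_geodesic hu hw)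
      (h.hasDerivAt_dirDeriv_geodesic hu hw v))
  -- F is constant in horizontal directions: its derivative along (v, -∂_v G) vanishes.
  have hc : dirDeriv H W F (sprayDeriv H Γ W F v u w) u w =
      fderiv ℝ (fun z : E × E => F z.1 z.2) (u, w) (v, 0) := by
    have h1 := h.killing u hu (unwind W F u w) v
    have h0 := h.metric_covDeriv_self hu (unwind W F u w)
    rw [h.fderiv_finsler hu hw, dirDeriv, sprayDeriv]
    simp only [map_sub, map_smul, smul_eq_mul, h0, zero_add, h.connection_symm u hu v w]
    congr 1
    linear_combination - F u w * h1
  rw [hS, h.fderiv_finsler_geodesic hu hw]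
  nth_rw 1 [sprayDeriv]
  rw [hc, h.fderiv_geodSpray hu hw]
  simp only [h.fderiv_covDeriv_eq hu hK]
  have hR := hK v w w
  have hD := h.fderiv_connection_symm hu w v w
  have r1 := h.metric_unwind_self hu hw
  have r2 : dirDeriv H W F v u w * lapse H W F u w = H u (unwind W F u w) v := by
    rw [dirDeriv, div_mul_cancel₀ _ hN]
  have hAX : covDeriv Γ W u (unwind W F u w) = covDeriv Γ W u w - F u w • covDeriv Γ W u (W u) := by
    simp [unwind]
  have hΓX : ∀ a, Γ u a (unwind W F u w) = Γ u a w - F u w • Γ u a (W u) := by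
    simp [unwind]
  have s1 := h.metric_symm u hu w (W u)
  have s2 := h.metric_symm u hu w v
  have s3 := h.metric_symm u hu v (W u)
  simp only [lapse, metric_unwind_apply, h.metric_apply_unwind hu, s1, s2] at r1 r2
  simp only [curvatureTensor] at hR
  simp only [sprayDeriv, geodSpray, hAX, hΓX, covDeriv_apply_eq (Γ := Γ), map_add, map_sub, map_smul,
    h.connection_symm u hu _ v, h.metric_apply_unwind hu, s1, s2, s3, map_zero, add_apply, sub_apply,
    smul_apply] at hR ⊢
  rw [hD] at hR
  -- All terms that are not curvature cancel. The remaining multiples of v, w and W vanish by `r1`,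
  -- which is |X|² = F², and by `r2`, which is F_v N = H(X, v).
  linear_combination (norm := module) hR + r1 • (K • v) + (K * r2) • w
    - (K * F u w * r2 + K * dirDeriv H W F v u w * r1) • W u

end IsKillingNavigation
end NavigationCurvature

/-! ### Fundamental tensor and spray in coordinates -/

section FlagCurvature

variable {n : ℕ}

theorem EuclideanSpace.sum_smul_map_single {G : Type*} [AddCommGroup G] [Module ℝ G]
    (L : EuclideanSpace ℝ (Fin n) →ₗ[ℝ] G) (z : EuclideanSpace ℝ (Fin n)) : ∑ k, z k • L (EuclideanSpace.single k 1) = L z := by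
  have := (EuclideanSpace.basisFun (Fin n) ℝ).sum_repr z
  conv_rhs => rw [← this]
  simp

theorem EuclideanSpace.sum_mul_map_single (L : EuclideanSpace ℝ (Fin n) →ₗ[ℝ] ℝ) (z : EuclideanSpace ℝ (Fin n)) :
    ∑ k, z k * L (EuclideanSpace.single k 1) = L z :=
  EuclideanSpace.sum_smul_map_single L z

namespace LocalFinsler

theorem dX_eq_fderiv {f : EuclideanSpace ℝ (Fin n) → EuclideanSpace ℝ (Fin n) → ℝ} {u w : EuclideanSpace ℝ (Fin n)} (i : Fin n)
    (hf : DifferentiableAt ℝ (fun z : EuclideanSpace ℝ (Fin n) × EuclideanSpace ℝ (Fin n) => f z.1 z.2) (u, w)) :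
    dX i f u w = fderiv ℝ (fun z : _ × _ => f z.1 z.2) (u, w) (EuclideanSpace.single i 1, 0) := by
  have h1 : HasFDerivAt (fun x : EuclideanSpace ℝ (Fin n) => (x, w)) (ContinuousLinearMap.inl ℝ _ _) u :=
    hasFDerivAt_prodMk_left u w
  have h2 := (HasFDerivAt.comp u (g := fun z : EuclideanSpace ℝ (Fin n) × EuclideanSpace ℝ (Fin n) => f z.1 z.2) hf.hasFDerivAt h1).fderiv
  rw [dX]
  exact congrArg (fun L => L (EuclideanSpace.single i 1)) h2

theorem dY_eq_fderiv {f : EuclideanSpace ℝ (Fin n) → EuclideanSpace ℝ (Fin n) → ℝ} {u w : EuclideanSpace ℝ (Fin n)} (i : Fin n)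
    (hf : DifferentiableAt ℝ (fun z : EuclideanSpace ℝ (Fin n) × EuclideanSpace ℝ (Fin n) => f z.1 z.2) (u, w)) :
    dY i f u w = fderiv ℝ (fun z : _ × _ => f z.1 z.2) (u, w) (0, EuclideanSpace.single i 1) := by
  have h1 : HasFDerivAt (fun x : EuclideanSpace ℝ (Fin n) => (u, x)) (ContinuousLinearMap.inr ℝ _ _) w :=
    hasFDerivAt_prodMk_right u w
  have h2 := (HasFDerivAt.comp w (g := fun z : EuclideanSpace ℝ (Fin n) × EuclideanSpace ℝ (Fin n) => f z.1 z.2) hf.hasFDerivAt h1).fderiv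
  rw [dY]
  exact congrArg (fun L => L (EuclideanSpace.single i 1)) h2

/-- The closed formulas for F and its derivatives hold only over U and for nonzero vectors. That set
is open, so they may be substituted inside iterated partial derivatives. -/
theorem dX_congr {f g : EuclideanSpace ℝ (Fin n) → EuclideanSpace ℝ (Fin n) → ℝ} {u w : EuclideanSpace ℝ (Fin n)} {D : Set (EuclideanSpace ℝ (Fin n) × EuclideanSpace ℝ (Fin n))} (hD : IsOpen D)
    (hu : (u, w) ∈ D) (hfg : ∀ z ∈ D, f z.1 z.2 = g z.1 z.2) (i : Fin n) :
    dX i f u w = dX i g u w := by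
  have : ∀ᶠ x in nhds u, (x, w) ∈ D :=
    (Continuous.prodMk_left w).continuousAt.eventually (hD.mem_nhds hu)
  rw [dX, dX, Filter.EventuallyEq.fderiv_eq]
  filter_upwards [this] with x hx using hfg _ hx

theorem dY_congr {f g : EuclideanSpace ℝ (Fin n) → EuclideanSpace ℝ (Fin n) → ℝ} {u w : EuclideanSpace ℝ (Fin n)} {D : Set (EuclideanSpace ℝ (Fin n) × EuclideanSpace ℝ (Fin n))} (hD : IsOpen D)
    (hu : (u, w) ∈ D) (hfg : ∀ z ∈ D, f z.1 z.2 = g z.1 z.2) (i : Fin n) :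
    dY i f u w = dY i g u w := by
  have : ∀ᶠ x in nhds w, (u, x) ∈ D :=
    (Continuous.prodMk_right u).continuousAt.eventually (hD.mem_nhds hu)
  rw [dY, dY, Filter.EventuallyEq.fderiv_eq]
  filter_upwards [this] with x hx using hfg _ hx

end LocalFinsler

namespace IsKillingNavigation

open LocalFinsler

variable {U : Set (EuclideanSpace ℝ (Fin n))} {H : EuclideanSpace ℝ (Fin n) → EuclideanSpace ℝ (Fin n) →L[ℝ] EuclideanSpace ℝ (Fin n) →L[ℝ] ℝ} {Γ : EuclideanSpace ℝ (Fin n) → EuclideanSpace ℝ (Fin n) →L[ℝ] EuclideanSpace ℝ (Fin n) →L[ℝ] EuclideanSpace ℝ (Fin n)}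
  {W : EuclideanSpace ℝ (Fin n) → EuclideanSpace ℝ (Fin n)} {F : EuclideanSpace ℝ (Fin n) → EuclideanSpace ℝ (Fin n) → ℝ}

theorem isOpen_slit (h : IsKillingNavigation U H Γ W F) : IsOpen (U ×ˢ ({0}ᶜ : Set (EuclideanSpace ℝ (Fin n)))) :=
  h.isOpen.prod isOpen_compl_singleton

theorem dirDeriv_add (u w a b : EuclideanSpace ℝ (Fin n)) :
    dirDeriv H W F (a + b) u w = dirDeriv H W F a u w + dirDeriv H W F b u w := by
  simp [dirDeriv, add_div]

theorem dirDeriv_smul (u w : EuclideanSpace ℝ (Fin n)) (c : ℝ) (a : EuclideanSpace ℝ (Fin n)) :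
    dirDeriv H W F (c • a) u w = c * dirDeriv H W F a u w := by
  simp [dirDeriv, mul_div_assoc]

/-- The fundamental tensor of the Randers metric. -/
noncomputable def fundamentalForm
    (H : EuclideanSpace ℝ (Fin n) → EuclideanSpace ℝ (Fin n) →L[ℝ] EuclideanSpace ℝ (Fin n) →L[ℝ] ℝ)
    (W : EuclideanSpace ℝ (Fin n) → EuclideanSpace ℝ (Fin n))
    (F : EuclideanSpace ℝ (Fin n) → EuclideanSpace ℝ (Fin n) → ℝ)
    (u w : EuclideanSpace ℝ (Fin n)) :
    EuclideanSpace ℝ (Fin n) →ₗ[ℝ] EuclideanSpace ℝ (Fin n) →ₗ[ℝ] ℝ :=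
  LinearMap.mk₂ ℝ (fun a b =>
    dirDeriv H W F a u w * dirDeriv H W F b u w + F u w *
      ((H u (a - dirDeriv H W F a u w • W u) b - dirDeriv H W F b u w *
        (dirDeriv H W F a u w + H u (a - dirDeriv H W F a u w • W u) (W u))) / lapse H W F u w))
    (fun a a' b => by
      simp only [dirDeriv_add, map_add, map_sub, map_smul, add_apply, sub_apply,
        smul_apply, smul_eq_mul]
      ring)
    (fun c a b => by
      simp only [dirDeriv_smul, map_sub, map_smul, sub_apply, smul_apply, smul_eq_mul]
      ring)
    (fun a b b' => by simp only [dirDeriv_add, map_add]; ring)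
    (fun c a b => by simp only [dirDeriv_smul, map_smul, smul_eq_mul]; ring)

theorem fundamentalForm_apply (u w a b : EuclideanSpace ℝ (Fin n)) :
    fundamentalForm H W F u w a b =
      dirDeriv H W F a u w * dirDeriv H W F b u w + F u w *
        ((H u (a - dirDeriv H W F a u w • W u) b - dirDeriv H W F b u w *
          (dirDeriv H W F a u w + H u (a - dirDeriv H W F a u w • W u) (W u))) /
            lapse H W F u w) :=
  rfl

section Pointwise

variable (h : IsKillingNavigation U H Γ W F) {u w : EuclideanSpace ℝ (Fin n)} (hu : u ∈ U) (hw : w ≠ 0)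
include h hu hw

theorem dX_sq (l : Fin n) : dX l (fun u w => F u w ^ 2) u w =
    2 * F u w * fderiv ℝ (fun z : _ × _ => F z.1 z.2) (u, w) (EuclideanSpace.single l 1, 0) := by
  have hF := h.differentiableAt_finsler hu hw
  rw [dX_eq_fderiv l (hF.pow 2)]
  exact fderiv_apply_eq_of_hasDerivAt_line (hF.pow 2)
    (((hF.hasDerivAt_comp_line _).pow 2).congr_deriv (by simp))

theorem dY_sq (l : Fin n) : dY l (fun u w => F u w ^ 2) u w =
    2 * F u w * dirDeriv H W F (EuclideanSpace.single l 1) u w := by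
  have hF := h.differentiableAt_finsler hu hw
  rw [dY_eq_fderiv l (hF.pow 2), ← h.fderiv_finsler_snd hu hw]
  exact fderiv_apply_eq_of_hasDerivAt_line (hF.pow 2)
    (((hF.hasDerivAt_comp_line _).pow 2).congr_deriv (by simp))

theorem fderiv_mul_dirDeriv (b : EuclideanSpace ℝ (Fin n)) (z : EuclideanSpace ℝ (Fin n) × EuclideanSpace ℝ (Fin n)) {c : ℝ}
    (hc : HasDerivAt (fun t : ℝ => dirDeriv H W F b ((u, w) + t • z).1 ((u, w) + t • z).2) c 0) :
    fderiv ℝ (fun z : _ × _ => 2 * F z.1 z.2 * dirDeriv H W F b z.1 z.2) (u, w) z =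
      2 * fderiv ℝ (fun z : _ × _ => F z.1 z.2) (u, w) z * dirDeriv H W F b u w
        + 2 * F u w * c := by
  have hF := h.differentiableAt_finsler hu hw
  refine fderiv_apply_eq_of_hasDerivAt_line
    ((hF.const_mul 2).mul (h.differentiableAt_dirDeriv hu hw b)) ?_
  exact (((hF.hasDerivAt_comp_line z).const_mul 2).mul hc).congr_deriv (by simp)

theorem fderiv_mul_dirDeriv_snd (a b : EuclideanSpace ℝ (Fin n)) :
    fderiv ℝ (fun z : _ × _ => 2 * F z.1 z.2 * dirDeriv H W F b z.1 z.2) (u, w) (0, a) =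
      2 * fundamentalForm H W F u w a b := by
  have h1 := h.hasDerivAt_unwind hu hw (0, a)
  have h2 := h.hasDerivAt_lapse hu hw _ h1
  have h3 := h.hasDerivAt_dirDeriv hu hw b _ h1 h2
  rw [h.fderiv_mul_dirDeriv hu hw b _ h3, h.fderiv_finsler_snd hu hw, fundamentalForm_apply]
  simp
  ring

theorem dY_dY_sq (i l : Fin n) : dY i (dY l (fun u w => F u w ^ 2)) u w =
    2 * fundamentalForm H W F u w (EuclideanSpace.single i 1) (EuclideanSpace.single l 1) := by
  rw [dY_congr h.isOpen_slit (u := u) (w := w) ⟨hu, hw⟩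
    (g := fun u w => 2 * F u w * dirDeriv H W F (EuclideanSpace.single l 1) u w)
    (fun z hz => h.dY_sq hz.1 hz.2 l), dY_eq_fderiv, h.fderiv_mul_dirDeriv_snd hu hw]
  exact ((h.differentiableAt_finsler hu hw).const_mul 2).mul (h.differentiableAt_dirDeriv hu hw _)

theorem dX_dY_sq (i l : Fin n) : dX i (dY l (fun u w => F u w ^ 2)) u w =
    fderiv ℝ (fun z : _ × _ => 2 * F z.1 z.2 *
      dirDeriv H W F (EuclideanSpace.single l 1) z.1 z.2) (u, w)
      (EuclideanSpace.single i 1, 0) := by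
  rw [dX_congr h.isOpen_slit (u := u) (w := w) ⟨hu, hw⟩
    (g := fun u w => 2 * F u w * dirDeriv H W F (EuclideanSpace.single l 1) u w)
    (fun z hz => h.dY_sq hz.1 hz.2 l), dX_eq_fderiv]
  exact ((h.differentiableAt_finsler hu hw).const_mul 2).mul (h.differentiableAt_dirDeriv hu hw _)

theorem fundamentalTensor_apply (i j : Fin n) : fundamentalTensor F u w i j =
    fundamentalForm H W F u w (EuclideanSpace.single i 1) (EuclideanSpace.single j 1) := by
  rw [fundamentalTensor, Matrix.of_apply, h.dY_dY_sq hu hw]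
  ring

theorem sum_fundamentalTensor (a b : EuclideanSpace ℝ (Fin n)) :
    ∑ i, ∑ j, fundamentalTensor F u w i j * a i * b j = fundamentalForm H W F u w a b := by
  rw [← EuclideanSpace.sum_smul_map_single (fundamentalForm H W F u w) a,
    LinearMap.sum_apply]
  refine Finset.sum_congr rfl fun i _ => ?_
  rw [LinearMap.smul_apply, ← EuclideanSpace.sum_mul_map_single _ b, smul_eq_mul, Finset.mul_sum]
  refine Finset.sum_congr rfl fun j _ => ?_
  rw [h.fundamentalTensor_apply hu hw]
  ring

theorem scalarProduct_eq (a b : EuclideanSpace ℝ (Fin n)) :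
    scalarProduct F u w a b = fundamentalForm H W F u w a b :=
  h.sum_fundamentalTensor hu hw a b

theorem dirDeriv_mul_lapse (a : EuclideanSpace ℝ (Fin n)) :
    dirDeriv H W F a u w * lapse H W F u w = H u (unwind W F u w) a :=
  div_mul_cancel₀ _ (h.lapse_pos hu hw).ne'

/-- Euler's relation for the 1-homogeneous function F; here it follows from H(X, X + F W) = F² + F
H(X, W) = F N. -/
theorem dirDeriv_self : dirDeriv H W F w u w = F u w := by
  rw [dirDeriv, div_eq_iff (h.lapse_pos hu hw).ne']
  have h1 : H u (unwind W F u w) (unwind W F u w + F u w • W u) = H u (unwind W F u w) w := by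
    rw [unwind_add]
  rw [← h1, map_add, map_smul, h.metric_unwind_self hu hw, lapse, smul_eq_mul]
  ring

theorem fundamentalForm_self (b : EuclideanSpace ℝ (Fin n)) :
    fundamentalForm H W F u w w b = F u w * dirDeriv H W F b u w := by
  have h1 := h.dirDeriv_mul_lapse hu hw b
  have h2 : H u (w - F u w • W u) b = H u (unwind W F u w) b := rfl
  have h3 : F u w + H u (w - F u w • W u) (W u) = lapse H W F u w := rfl
  rw [fundamentalForm_apply, h.dirDeriv_self hu hw, h2, h3, h1]
  simp

omit hw in
theorem fundamentalForm_symm (a b : EuclideanSpace ℝ (Fin n)) :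
    fundamentalForm H W F u w a b = fundamentalForm H W F u w b a := by
  simp only [fundamentalForm_apply, map_sub, map_smul, sub_apply, smul_apply, smul_eq_mul,
    h.metric_symm u hu a, h.metric_symm u hu b (W u)]
  ring

/-- With d = F_a the value is d² + (F / N)(|a - d W|² - d²). Since H(X, a - d W) = d F and |X| = F,
Cauchy-Schwarz makes the second summand nonnegative; when d = 0 that summand is (F / N)|a|² > 0. -/
theorem fundamentalForm_pos {a : EuclideanSpace ℝ (Fin n)} (ha : a ≠ 0) : 0 < fundamentalForm H W F u w a a := by
  have hN := h.lapse_pos hu hw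
  have hF := h.finsler_pos hu hw
  have hd := h.dirDeriv_mul_lapse hu hw a
  have hX := h.metric_unwind_self hu hw
  have cs := h.sq_le_mul_metric hu (unwind W F u w) (a - dirDeriv H W F a u w • W u)
  have hp := h.metric_pos u hu a ha
  have hsa := h.metric_symm u hu a (W u)
  have hlap : lapse H W F u w = F u w + H u (unwind W F u w) (W u) := rfl
  set d := dirDeriv H W F a u w with hd0
  set N := lapse H W F u w with hN0
  have e1 : H u (unwind W F u w) (a - d • W u) = d * F u w := by
    rw [map_sub, map_smul, smul_eq_mul, ← hd, hlap]; ring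
  rw [e1, hX] at cs
  have cs' : d ^ 2 ≤ H u (a - d • W u) (a - d • W u) := by
    have : F u w ^ 2 * d ^ 2 ≤ F u w ^ 2 * H u (a - d • W u) (a - d • W u) := by linarith
    exact le_of_mul_le_mul_left this (by positivity)
  have e2 : fundamentalForm H W F u w a a =
      d ^ 2 + F u w / N * (H u (a - d • W u) (a - d • W u) - d ^ 2) := by
    simp only [fundamentalForm_apply, ← hd0, ← hN0, map_sub, map_smul, sub_apply, smul_apply,
      smul_eq_mul, hsa]
    ring
  have hq : 0 < F u w / N := by positivity
  rw [e2]
  rcases eq_or_ne d 0 with h0 | h0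
  · rw [h0]; simpa using mul_pos hq hp
  · have := mul_nonneg hq.le (sub_nonneg.2 cs')
    positivity

theorem isUnit_det_fundamentalTensor : IsUnit (fundamentalTensor F u w).det := by
  rw [← Matrix.isUnit_iff_isUnit_det, ← Matrix.mulVec_injective_iff_isUnit]
  intro x y hxy
  by_contra hne
  have hne' : WithLp.toLp 2 (x - y) ≠ 0 := by
    simpa [sub_eq_zero] using hne
  have hpos := h.fundamentalForm_pos hu hw hne'
  rw [← h.sum_fundamentalTensor hu hw] at hpos
  have h0 : (fundamentalTensor F u w).mulVec (x - y) = 0 := by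
    rw [Matrix.mulVec_sub, sub_eq_zero]; exact hxy
  have h1 : ∀ i, ∑ j, fundamentalTensor F u w i j * (x - y) j = 0 := fun i => congrFun h0 i
  have h2 : ∑ i, ∑ j, fundamentalTensor F u w i j * (x - y) i * (x - y) j = 0 := by
    refine Finset.sum_eq_zero fun i _ => ?_
    rw [← mul_zero ((x - y) i), ← h1 i, Finset.mul_sum]
    exact Finset.sum_congr rfl fun j _ => by ring
  exact hpos.ne' h2

/-- The spray is the unique solution of a linear system with the fundamental tensor as matrix. The
Euler-Lagrange equation says that `geodSpray` solves it (`hb`), and positive definiteness allows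
inversion. -/
theorem spray_eq (i : Fin n) : spray F i u w = geodSpray Γ W F u w i := by
  have hb : ∀ l, (∑ k, dX k (dY l (fun u w => F u w ^ 2)) u w * w k)
      - dX l (fun u w => F u w ^ 2) u w =
      ((fundamentalTensor F u w).mulVec (fun j => 4 * geodSpray Γ W F u w j)) l := by
    intro l
    set e : EuclideanSpace ℝ (Fin n) := EuclideanSpace.single l 1 with he
    set Φ := fderiv ℝ (fun z : _ × _ => 2 * F z.1 z.2 * dirDeriv H W F e z.1 z.2) (u, w) with hΦ
    have h1 : ∑ k, dX k (dY l (fun u w => F u w ^ 2)) u w * w k = Φ (w, 0) := by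
      have := EuclideanSpace.sum_mul_map_single
        ((Φ.comp (ContinuousLinearMap.inl ℝ _ _)).toLinearMap) w
      simp only [ContinuousLinearMap.coe_coe, ContinuousLinearMap.comp_apply,
        ContinuousLinearMap.inl_apply] at this
      rw [← this]
      refine Finset.sum_congr rfl fun k _ => ?_
      rw [h.dX_dY_sq hu hw, mul_comm]
    have h2 : Φ (w, (-2 : ℝ) • geodSpray Γ W F u w) = dX l (fun u w => F u w ^ 2) u w := by
      rw [hΦ, h.fderiv_mul_dirDeriv hu hw e _ (h.hasDerivAt_dirDeriv_geodesic hu hw e),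
        h.fderiv_finsler_geodesic hu hw, h.dX_sq hu hw]
      ring
    have h3 : Φ (0, geodSpray Γ W F u w) =
        2 * fundamentalForm H W F u w (geodSpray Γ W F u w) e :=
      h.fderiv_mul_dirDeriv_snd hu hw _ _
    -- Separates the horizontal and vertical parts of the spray direction: Φ(w, 0) - ∂F²/∂xˡ is then
    -- 2 Φ(0, G), that is 4 g(G, e).
    have h4 : Φ (w, (-2 : ℝ) • geodSpray Γ W F u w) =
        Φ (w, 0) - 2 * Φ (0, geodSpray Γ W F u w) := by
      rw [← smul_eq_mul, ← map_smul, ← map_sub]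
      congr 1
      ext <;> simp
    have h5 : ((fundamentalTensor F u w).mulVec (fun j => 4 * geodSpray Γ W F u w j)) l =
        4 * fundamentalForm H W F u w (geodSpray Γ W F u w) e := by
      have := EuclideanSpace.sum_mul_map_single (fundamentalForm H W F u w e)
        (geodSpray Γ W F u w)
      rw [h.fundamentalForm_symm hu, ← this, Matrix.mulVec, dotProduct, Finset.mul_sum]
      refine Finset.sum_congr rfl fun j _ => ?_
      rw [h.fundamentalTensor_apply hu hw]
      ring
    rw [h1, ← h2, h5, h4, h3]
    ring
  have hdet := h.isUnit_det_fundamentalTensor hu hw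
  rw [spray]
  simp only [hb]
  change (1 / 4 : ℝ) * ((fundamentalTensor F u w)⁻¹.mulVec _) i = _
  rw [Matrix.mulVec_mulVec, Matrix.nonsing_inv_mul _ hdet, Matrix.one_mulVec]
  ring

end Pointwise
end IsKillingNavigation
end FlagCurvature

/-! ### Riemann curvature and flag curvature in coordinates -/

section FlagCurvature

variable {n : ℕ}

namespace IsKillingNavigation

open LocalFinsler

variable {U : Set (EuclideanSpace ℝ (Fin n))}
  {H : EuclideanSpace ℝ (Fin n) → EuclideanSpace ℝ (Fin n) →L[ℝ] EuclideanSpace ℝ (Fin n) →L[ℝ] ℝ}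
  {Γ : EuclideanSpace ℝ (Fin n) →
    EuclideanSpace ℝ (Fin n) →L[ℝ] EuclideanSpace ℝ (Fin n) →L[ℝ] EuclideanSpace ℝ (Fin n)}
  {W : EuclideanSpace ℝ (Fin n) → EuclideanSpace ℝ (Fin n)}
  {F : EuclideanSpace ℝ (Fin n) → EuclideanSpace ℝ (Fin n) → ℝ}
  (h : IsKillingNavigation U H Γ W F) {u w : EuclideanSpace ℝ (Fin n)} (hu : u ∈ U) (hw : w ≠ 0)

theorem fderiv_coord {V : Type*} [NormedAddCommGroup V] [NormedSpace ℝ V]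
    {f : V → EuclideanSpace ℝ (Fin n)} {x : V} (hf : DifferentiableAt ℝ f x) (i : Fin n) (v : V) :
    DifferentiableAt ℝ (fun x => f x i) x ∧ fderiv ℝ (fun x => f x i) x v = fderiv ℝ f x v i := by
  have h1 := (EuclideanSpace.proj i : EuclideanSpace ℝ (Fin n) →L[ℝ] ℝ).hasFDerivAt.comp x
    hf.hasFDerivAt
  exact ⟨h1.differentiableAt, congrArg (fun L => L v) h1.fderiv⟩

theorem sprayDeriv_add (u w a b : EuclideanSpace ℝ (Fin n)) :
    sprayDeriv H Γ W F (a + b) u w = sprayDeriv H Γ W F a u w + sprayDeriv H Γ W F b u w := by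
  simp only [sprayDeriv, dirDeriv_add, map_add]
  module

theorem sprayDeriv_smul (u w : EuclideanSpace ℝ (Fin n)) (c : ℝ)
    (a : EuclideanSpace ℝ (Fin n)) :
    sprayDeriv H Γ W F (c • a) u w = c • sprayDeriv H Γ W F a u w := by
  simp only [sprayDeriv, dirDeriv_smul, map_smul]
  module

include h hu hw

theorem dX_spray (i k : Fin n) : dX k (spray F i) u w =
    fderiv ℝ (fun z : _ × _ => geodSpray Γ W F z.1 z.2) (u, w) (EuclideanSpace.single k 1, 0) i := by
  have hd := h.differentiableAt_geodSpray hu hw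
  rw [dX_congr h.isOpen_slit (u := u) (w := w) ⟨hu, hw⟩
    (g := fun u w => geodSpray Γ W F u w i) (fun z hz => h.spray_eq hz.1 hz.2 i),
    dX_eq_fderiv k (fderiv_coord hd i 0).1, (fderiv_coord hd i _).2]

theorem dY_spray (i k : Fin n) : dY k (spray F i) u w =
    sprayDeriv H Γ W F (EuclideanSpace.single k 1) u w i := by
  have hd := h.differentiableAt_geodSpray hu hw
  rw [dY_congr h.isOpen_slit (u := u) (w := w) ⟨hu, hw⟩
    (g := fun u w => geodSpray Γ W F u w i) (fun z hz => h.spray_eq hz.1 hz.2 i),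
    dY_eq_fderiv k (fderiv_coord hd i 0).1, (fderiv_coord hd i _).2,
    h.fderiv_geodSpray_snd hu hw]

theorem dX_dY_spray (i j k : Fin n) : dX j (dY k (spray F i)) u w =
    fderiv ℝ (fun z : _ × _ => sprayDeriv H Γ W F (EuclideanSpace.single k 1) z.1 z.2) (u, w)
      (EuclideanSpace.single j 1, 0) i := by
  have hd := h.differentiableAt_sprayDeriv hu hw (EuclideanSpace.single k 1)
  rw [dX_congr h.isOpen_slit (u := u) (w := w) ⟨hu, hw⟩
    (g := fun u w => sprayDeriv H Γ W F (EuclideanSpace.single k 1) u w i)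
    (fun z hz => h.dY_spray hz.1 hz.2 i k),
    dX_eq_fderiv j (fderiv_coord hd i 0).1, (fderiv_coord hd i _).2]

theorem dY_dY_spray (i j k : Fin n) : dY j (dY k (spray F i)) u w =
    fderiv ℝ (fun z : _ × _ => sprayDeriv H Γ W F (EuclideanSpace.single k 1) z.1 z.2) (u, w)
      (0, EuclideanSpace.single j 1) i := by
  have hd := h.differentiableAt_sprayDeriv hu hw (EuclideanSpace.single k 1)
  rw [dY_congr h.isOpen_slit (u := u) (w := w) ⟨hu, hw⟩
    (g := fun u w => sprayDeriv H Γ W F (EuclideanSpace.single k 1) u w i)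
    (fun z hz => h.dY_spray hz.1 hz.2 i k),
    dY_eq_fderiv j (fderiv_coord hd i 0).1, (fderiv_coord hd i _).2]

theorem riemann_eq_coord {K : ℝ}
    (hK : ∀ a b c, curvatureTensor Γ u a b c = K • (H u b c • a - H u a c • b)) (i k : Fin n) :
    riemann F i k u w = (K • (F u w ^ 2 • EuclideanSpace.single k (1 : ℝ) -
      (F u w * dirDeriv H W F (EuclideanSpace.single k 1) u w) • w)) i := by
  rw [← h.riemann_eq hu hw hK]
  set e : EuclideanSpace ℝ (Fin n) := EuclideanSpace.single k 1 with he
  set Φ := fderiv ℝ (fun z : _ × _ => sprayDeriv H Γ W F e z.1 z.2) (u, w) with hΦ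
  let pr : EuclideanSpace ℝ (Fin n) →L[ℝ] ℝ := EuclideanSpace.proj i
  have h1 : ∑ j, w j * dX j (dY k (spray F i)) u w = Φ (w, 0) i := by
    have := EuclideanSpace.sum_mul_map_single
      ((pr.comp (Φ.comp (ContinuousLinearMap.inl ℝ _ _))).toLinearMap) w
    simp only [h.dX_dY_spray hu hw]
    exact this
  have h2 : ∑ j, spray F j u w * dY j (dY k (spray F i)) u w = Φ (0, geodSpray Γ W F u w) i := by
    have := EuclideanSpace.sum_mul_map_single
      ((pr.comp (Φ.comp (ContinuousLinearMap.inr ℝ _ _))).toLinearMap) (geodSpray Γ W F u w)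
    simp only [h.dY_dY_spray hu hw, h.spray_eq hu hw]
    exact this
  have h3 : ∑ j, dY j (spray F i) u w * dY k (spray F j) u w =
      sprayDeriv H Γ W F (sprayDeriv H Γ W F e u w) u w i := by
    have := EuclideanSpace.sum_mul_map_single
      (pr.toLinearMap.comp (IsLinearMap.mk' (fun v => sprayDeriv H Γ W F v u w)
        ⟨sprayDeriv_add u w, sprayDeriv_smul u w⟩)) (sprayDeriv H Γ W F e u w)
    simp only [h.dY_spray hu hw]
    refine Eq.trans (Finset.sum_congr rfl fun j _ => ?_) this
    exact mul_comm _ _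
  -- The terms -yʲ ∂/∂xʲ and 2 Gʲ ∂/∂yʲ of the Riemann curvature combine into minus the derivative
  -- in the spray direction (w, -2G).
  have h4 : Φ (w, (-2 : ℝ) • geodSpray Γ W F u w) =
      Φ (w, 0) - (2 : ℝ) • Φ (0, geodSpray Γ W F u w) := by
    rw [← map_smul, ← map_sub]
    congr 1
    ext <;> simp
  rw [riemann, h1, h2, h3, h4, h.dX_spray hu hw]
  simp only [PiLp.sub_apply, PiLp.smul_apply, smul_eq_mul, he]
  ring

/-- Since g(w, w) = F² and g(w, v) = F F_v, pairing K (F² v - F F_v w) with v gives K times the Gram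
determinant of the flag. -/
theorem flagCurvature_eq {K : ℝ}
    (hK : ∀ a b c, curvatureTensor Γ u a b c = K • (H u b c • a - H u a c • b))
    {v : EuclideanSpace ℝ (Fin n)} (hwv : LinearIndependent ℝ ![w, v]) :
    LocalFinsler.flagCurvature F u w v = K := by
  set g := fundamentalForm H W F u w with hg
  set d := dirDeriv H W F v u w with hd
  have hww : g w w = F u w ^ 2 := by
    rw [hg, h.fundamentalForm_self hu hw, h.dirDeriv_self hu hw, sq]
  have hwv' : g w v = F u w * d := h.fundamentalForm_self hu hw v
  have hvw : g v w = F u w * d := by rw [hg, h.fundamentalForm_symm hu]; exact hwv'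
  have hF := h.finsler_pos hu hw
  have hnum : ∑ i, ∑ j, ∑ k, fundamentalTensor F u w i j * riemann F i k u w * v k * v j =
      K * (F u w ^ 2 * g v v - (F u w * d) ^ 2) := by
    have hR : ∀ i, ∑ k, riemann F i k u w * v k = (K • (F u w ^ 2 • v - (F u w * d) • w)) i := by
      intro i
      have := EuclideanSpace.sum_mul_map_single (IsLinearMap.mk'
        (fun v : EuclideanSpace ℝ (Fin n) =>
          (K • (F u w ^ 2 • v - (F u w * dirDeriv H W F v u w) • w)) i)
        ⟨fun a b => by simp [dirDeriv_add]; ring, fun c a => by simp [dirDeriv_smul]; ring⟩) v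
      simp only [h.riemann_eq_coord hu hw hK]
      refine Eq.trans (Finset.sum_congr rfl fun j _ => ?_) this
      exact mul_comm _ _
    have h1 := h.sum_fundamentalTensor hu hw (K • (F u w ^ 2 • v - (F u w * d) • w)) v
    have h2 : fundamentalForm H W F u w (K • (F u w ^ 2 • v - (F u w * d) • w)) v =
        K * (F u w ^ 2 * g v v - (F u w * d) ^ 2) := by
      simp only [map_smul, map_sub, LinearMap.smul_apply, LinearMap.sub_apply, smul_eq_mul, ← hg,
        hwv']
      ring
    rw [← h2, ← h1]
    refine Finset.sum_congr rfl fun i _ => Finset.sum_congr rfl fun j _ => ?_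
    rw [← hR, Finset.mul_sum, Finset.sum_mul]
    exact Finset.sum_congr rfl fun k _ => by ring
  -- F² times the Gram determinant is the g-square of F² v - F F_v w, which is nonzero because w and
  -- v are independent.
  have hne : F u w ^ 2 * g v v - (F u w * d) ^ 2 ≠ 0 := by
    have hx : F u w ^ 2 • v - (F u w * d) • w ≠ 0 := by
      intro h0
      have := LinearIndependent.pair_iff.1 hwv (-(F u w * d)) (F u w ^ 2) (by
        rw [← h0]; module)
      exact (pow_pos hF 2).ne' this.2
    have hp := h.fundamentalForm_pos hu hw hx
    have he : fundamentalForm H W F u w (F u w ^ 2 • v - (F u w * d) • w)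
        (F u w ^ 2 • v - (F u w * d) • w) =
        F u w ^ 2 * (F u w ^ 2 * g v v - (F u w * d) ^ 2) := by
      simp only [map_smul, map_sub, LinearMap.smul_apply, LinearMap.sub_apply, smul_eq_mul, ← hg,
        hwv', hww, hvw]
      ring
    rw [he] at hp
    exact (pos_of_mul_pos_right hp (by positivity)).ne'
  rw [LocalFinsler.flagCurvature, hnum, h.scalarProduct_eq hu hw, h.scalarProduct_eq hu hw,
    h.scalarProduct_eq hu hw, ← hg, hww, hwv', mul_div_assoc, div_self hne, mul_one]

end IsKillingNavigation
end FlagCurvature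

/-! ### Skew-symmetry of the curvature tensor -/

section MetricCurvature

variable {E : Type*} [NormedAddCommGroup E] [NormedSpace ℝ E]

noncomputable local instance : NormedAddCommGroup (E →L[ℝ] E →L[ℝ] ℝ) :=
  ContinuousLinearMap.toNormedAddCommGroup
noncomputable local instance : NormedAddCommGroup (E →L[ℝ] E →L[ℝ] E) :=
  ContinuousLinearMap.toNormedAddCommGroup
noncomputable local instance : NormedSpace ℝ (E →L[ℝ] E →L[ℝ] ℝ) :=
  ContinuousLinearMap.toNormedSpace
noncomputable local instance : NormedSpace ℝ (E →L[ℝ] E →L[ℝ] E) :=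
  ContinuousLinearMap.toNormedSpace

theorem fderiv_clm_apply₂ {V V' : Type*} [NormedAddCommGroup V] [NormedSpace ℝ V]
    [NormedAddCommGroup V'] [NormedSpace ℝ V']
    {B : V → V →L[ℝ] V →L[ℝ] V'} {u : V} (hB : DifferentiableAt ℝ B u) (v a b : V) :
    DifferentiableAt ℝ (fun x => B x a b) u ∧
      fderiv ℝ B u v a b = fderiv ℝ (fun x => B x a b) u v := by
  have hd : DifferentiableAt ℝ (fun x => B x a b) u := by
    have h1 := DifferentiableAt.clm_apply₂_fst (z := (u, u)) hB (differentiableAt_const a)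
      (differentiableAt_const b)
    exact h1.comp (f := fun x => (x, u)) u (by fun_prop)
  refine ⟨hd, ?_⟩
  have h1 := HasDerivAt.clm_apply₂_line_fst (w := u) (z := (v, 0)) hB
    (hasDerivAt_const (0 : ℝ) a) (hasDerivAt_const (0 : ℝ) b)
  rw [fderiv_apply_eq_of_hasDerivAt_line hd (v := v) (c := fderiv ℝ B u v a b)]
  simpa using h1

namespace IsKillingNavigation

variable {U : Set E} {H : E → E →L[ℝ] E →L[ℝ] ℝ} {Γ : E → E →L[ℝ] E →L[ℝ] E} {W : E → E}
  {F : E → E → ℝ}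

set_option synthInstance.maxHeartbeats 200000 in
-- Differentiating metric compatibility once more expresses the second derivative of H through Γ
-- (`key`); its symmetry in v and v' is exactly the skewness of R(v, v').
theorem metric_curvatureTensor (h : IsKillingNavigation U H Γ W F) {u : E} (hu : u ∈ U)
    (v v' a b : E) :
    H u (curvatureTensor Γ u v v' a) b + H u a (curvatureTensor Γ u v v' b) = 0 := by
  have hH2 : DifferentiableAt ℝ (fderiv ℝ H) u :=
    ((h.contDiffOn_metric.contDiffAt (h.isOpen.mem_nhds hu)).fderiv_right (m := 1)
      (by norm_cast)).differentiableAt (by simp)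
  have hs : ∀ v v', fderiv ℝ (fderiv ℝ H) u v v' = fderiv ℝ (fderiv ℝ H) u v' v :=
    fun v v' => ((h.contDiffOn_metric.contDiffAt (h.isOpen.mem_nhds hu)).isSymmSndFDerivAt
      (by rw [minSmoothness_of_isRCLikeNormedField]; norm_cast)).eq v v'
  have key : ∀ v v', fderiv ℝ (fderiv ℝ H) u v v' a b =
      H u (Γ u v (Γ u v' a)) b + H u (Γ u v' a) (Γ u v b) + H u (fderiv ℝ Γ u v v' a) b +
      (H u (Γ u v a) (Γ u v' b) + H u a (Γ u v (Γ u v' b)) + H u a (fderiv ℝ Γ u v v' b)) := by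
    intro v v'
    have hΓ := fun a => HasDerivAt.clm_apply₂_line_fst (w := u) (z := (v, 0))
      (h.differentiableAt_connection hu) (hasDerivAt_const (0 : ℝ) v') (hasDerivAt_const (0 : ℝ) a)
    have e1 := HasDerivAt.clm_apply₂_line_fst (w := u) (z := (v, 0))
      (h.differentiableAt_metric hu) (hΓ a) (hasDerivAt_const (0 : ℝ) b)
    have e2 := HasDerivAt.clm_apply₂_line_fst (w := u) (z := (v, 0))
      (h.differentiableAt_metric hu) (hasDerivAt_const (0 : ℝ) a) (hΓ b)
    have e3 : HasDerivAt (fun t : ℝ => fderiv ℝ H (u + t • v) v' a b)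
        (fderiv ℝ (fderiv ℝ H) u v v' a b) 0 := by
      have e4 := DifferentiableAt.hasDerivAt_comp_line hH2 v
      have e5 := ((e4.clm_apply (hasDerivAt_const (0 : ℝ) v')).clm_apply
        (hasDerivAt_const (0 : ℝ) a)).clm_apply (hasDerivAt_const (0 : ℝ) b)
      exact e5.congr_deriv (by simp only [map_zero, add_zero])
    have hev : ∀ᶠ t : ℝ in nhds 0, u + t • v ∈ U := by
      have hc : ContinuousAt (fun t : ℝ => u + t • v) 0 := by fun_prop
      exact hc.eventually (h.isOpen.mem_nhds (by simpa using hu))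
    have e6 := e3.unique ((e1.add e2).congr_of_eventuallyEq (by
      filter_upwards [hev] with t ht
      simpa using h.compatible _ ht v' a b))
    rw [e6]
    simp only [zero_smul, add_zero, h.compatible u hu, map_zero, zero_apply]
  have h1 := key v v'
  have h2 := key v' v
  rw [hs v' v] at h2
  simp only [curvatureTensor, map_add, map_sub, add_apply, sub_apply]
  linear_combination h2 - h1

end IsKillingNavigation
end MetricCurvature

/-! ### The Levi-Civita connection of a metric in coordinates -/

section ChristoffelForm

open LocalRiemann

variable {n : ℕ}

noncomputable local instance {V V' : Type*} [NormedAddCommGroup V] [NormedSpace ℝ V]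
    [NormedAddCommGroup V'] [NormedSpace ℝ V'] : NormedAddCommGroup (V →L[ℝ] V →L[ℝ] V') :=
  ContinuousLinearMap.toNormedAddCommGroup
noncomputable local instance {V V' : Type*} [NormedAddCommGroup V] [NormedSpace ℝ V]
    [NormedAddCommGroup V'] [NormedSpace ℝ V'] : NormedSpace ℝ (V →L[ℝ] V →L[ℝ] V') :=
  ContinuousLinearMap.toNormedSpace

/-- The Riemannian metric with the coefficients `hm`. -/
noncomputable def metricForm (hm : EuclideanSpace ℝ (Fin n) → Matrix (Fin n) (Fin n) ℝ)
    (u : EuclideanSpace ℝ (Fin n)) :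
    EuclideanSpace ℝ (Fin n) →L[ℝ] EuclideanSpace ℝ (Fin n) →L[ℝ] ℝ :=
  ∑ i, ∑ j, hm u i j • (EuclideanSpace.proj i : EuclideanSpace ℝ (Fin n) →L[ℝ] ℝ).smulRight
    (EuclideanSpace.proj j : EuclideanSpace ℝ (Fin n) →L[ℝ] ℝ)

/-- The Christoffel symbols of the Riemannian metric with the coefficients `hm`. -/
noncomputable def christoffelForm (hm : EuclideanSpace ℝ (Fin n) → Matrix (Fin n) (Fin n) ℝ)
    (u : EuclideanSpace ℝ (Fin n)) :
    EuclideanSpace ℝ (Fin n) →L[ℝ] EuclideanSpace ℝ (Fin n) →L[ℝ] EuclideanSpace ℝ (Fin n) :=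
  ∑ i, ∑ j, ∑ k, christoffel hm k i j u •
    (EuclideanSpace.proj i : EuclideanSpace ℝ (Fin n) →L[ℝ] ℝ).smulRight
      ((EuclideanSpace.proj j : EuclideanSpace ℝ (Fin n) →L[ℝ] ℝ).smulRight
        (EuclideanSpace.single k (1 : ℝ) : EuclideanSpace ℝ (Fin n)))

theorem metricForm_apply (hm : EuclideanSpace ℝ (Fin n) → Matrix (Fin n) (Fin n) ℝ)
    (u a b : EuclideanSpace ℝ (Fin n)) :
    metricForm hm u a b = ∑ i, ∑ j, hm u i j * (a i * b j) := by
  simp [metricForm]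

theorem christoffelForm_apply (hm : EuclideanSpace ℝ (Fin n) → Matrix (Fin n) (Fin n) ℝ)
    (u a b : EuclideanSpace ℝ (Fin n)) (k : Fin n) :
    christoffelForm hm u a b k = ∑ i, ∑ j, christoffel hm k i j u * (a i * b j) := by
  simp [christoffelForm, Pi.single_apply]

theorem pd_sum_eq {f : EuclideanSpace ℝ (Fin n) → ℝ} (u v : EuclideanSpace ℝ (Fin n)) :
    fderiv ℝ f u v = ∑ k, v k * pd k f u :=
  (EuclideanSpace.sum_mul_map_single (fderiv ℝ f u).toLinearMap v).symm

/-- Smooth coefficients of a Riemannian metric. -/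
structure IsMetricCoeff (U : Set (EuclideanSpace ℝ (Fin n)))
    (hm : EuclideanSpace ℝ (Fin n) → Matrix (Fin n) (Fin n) ℝ) : Prop where
  isOpen : IsOpen U
  contDiffOn : ∀ i j, ContDiffOn ℝ ∞ (fun u => hm u i j) U
  symm : ∀ u ∈ U, ∀ i j, hm u i j = hm u j i
  pos : ∀ u ∈ U, ∀ a, a ≠ 0 → 0 < metricForm hm u a a

namespace IsMetricCoeff

variable {U : Set (EuclideanSpace ℝ (Fin n))}
  {hm : EuclideanSpace ℝ (Fin n) → Matrix (Fin n) (Fin n) ℝ} (h : IsMetricCoeff U hm)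
include h

theorem det_ne_zero {u : EuclideanSpace ℝ (Fin n)} (hu : u ∈ U) : (hm u).det ≠ 0 := by
  intro h0
  obtain ⟨x, hx, hx0⟩ := Matrix.exists_mulVec_eq_zero_iff.2 h0
  have hpos := h.pos u hu (WithLp.toLp 2 x) (by simpa using hx)
  rw [metricForm_apply] at hpos
  refine hpos.ne' (Finset.sum_eq_zero fun i _ => ?_)
  have h1 : ∑ j, hm u i j * x j = 0 := congrFun hx0 i
  rw [← mul_zero (x i), ← h1, Finset.mul_sum]
  exact Finset.sum_congr rfl fun j _ => by ring

theorem pd_symm {u : EuclideanSpace ℝ (Fin n)} (hu : u ∈ U) (k i j : Fin n) :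
    pd k (fun u => hm u i j) u = pd k (fun u => hm u j i) u := by
  rw [pd, pd, Filter.EventuallyEq.fderiv_eq]
  filter_upwards [h.isOpen.mem_nhds hu] with x hx using h.symm x hx i j

theorem contDiffOn_metricForm : ContDiffOn ℝ ∞ (metricForm hm) U := by
  refine ContDiffOn.sum fun i _ => ContDiffOn.sum fun j _ => ?_
  exact (h.contDiffOn i j).smul contDiffOn_const

theorem contDiffOn_pd (k i j : Fin n) : ContDiffOn ℝ ∞ (pd k (fun u => hm u i j)) U :=
  ((h.contDiffOn i j).fderiv_of_isOpen h.isOpen (by simp)).clm_apply contDiffOn_const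

theorem contDiffOn_det : ContDiffOn ℝ ∞ (fun u => (hm u).det) U := by
  simp only [Matrix.det_apply]
  refine ContDiffOn.sum fun σ _ => ContDiffOn.const_smul _ ?_
  exact contDiffOn_prod fun i _ => h.contDiffOn _ _

theorem contDiffOn_inv (i j : Fin n) : ContDiffOn ℝ ∞ (fun u => (hm u)⁻¹ i j) U := by
  -- Cramer's rule: the entries of the inverse are smooth as cofactors divided by the determinant.
  have hdet := h.contDiffOn_det.inv fun u hu => h.det_ne_zero hu
  have hadj : ContDiffOn ℝ ∞ (fun u => (hm u).adjugate i j) U := by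
    simp only [Matrix.adjugate_apply, Matrix.det_apply]
    refine ContDiffOn.sum fun σ _ => ContDiffOn.const_smul _ ?_
    refine contDiffOn_prod fun k _ => ?_
    by_cases hk : σ k = j
    · simp only [hk, Matrix.updateRow_self]; exact contDiffOn_const
    · simp only [Matrix.updateRow_ne hk]; exact h.contDiffOn _ _
  refine (hdet.mul hadj).congr fun u _ => ?_
  simp [Matrix.inv_def]

theorem contDiffOn_christoffel (k i j : Fin n) : ContDiffOn ℝ ∞ (christoffel hm k i j) U := by
  refine contDiffOn_const.mul (ContDiffOn.sum fun l _ => (h.contDiffOn_inv k l).mul ?_)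
  exact ((h.contDiffOn_pd i j l).add (h.contDiffOn_pd j i l)).sub (h.contDiffOn_pd l i j)

theorem contDiffOn_christoffelForm : ContDiffOn ℝ ∞ (christoffelForm hm) U := by
  refine ContDiffOn.sum fun i _ => ContDiffOn.sum fun j _ => ContDiffOn.sum fun k _ => ?_
  exact (h.contDiffOn_christoffel k i j).smul contDiffOn_const

theorem christoffel_symm {u : EuclideanSpace ℝ (Fin n)} (hu : u ∈ U) (k i j : Fin n) :
    christoffel hm k i j u = christoffel hm k j i u := by
  simp only [christoffel]
  congr 1
  refine Finset.sum_congr rfl fun l _ => ?_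
  rw [h.pd_symm hu l i j]
  ring

theorem christoffelForm_symm {u : EuclideanSpace ℝ (Fin n)} (hu : u ∈ U)
    (a b : EuclideanSpace ℝ (Fin n)) : christoffelForm hm u a b = christoffelForm hm u b a := by
  ext k
  rw [christoffelForm_apply, christoffelForm_apply, Finset.sum_comm]
  refine Finset.sum_congr rfl fun i _ => Finset.sum_congr rfl fun j _ => ?_
  rw [h.christoffel_symm hu k i j]
  ring

theorem metricForm_symm {u : EuclideanSpace ℝ (Fin n)} (hu : u ∈ U)
    (a b : EuclideanSpace ℝ (Fin n)) : metricForm hm u a b = metricForm hm u b a := by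
  rw [metricForm_apply, metricForm_apply, Finset.sum_comm]
  refine Finset.sum_congr rfl fun i _ => Finset.sum_congr rfl fun j _ => ?_
  rw [h.symm u hu i j]
  ring

/-- Lowering the index removes the inverse matrix, so that compatibility becomes an identity between
first partial derivatives of the coefficients. -/
theorem sum_mul_christoffel {u : EuclideanSpace ℝ (Fin n)} (hu : u ∈ U) (i j l : Fin n) :
    ∑ k, hm u l k * christoffel hm k i j u = (1 / 2 : ℝ) *
      (pd i (fun u => hm u j l) u + pd j (fun u => hm u i l) u - pd l (fun u => hm u i j) u) := by
  have h1 := Matrix.mul_nonsing_inv (hm u) (isUnit_iff_ne_zero.2 (h.det_ne_zero hu))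
  set c : Fin n → ℝ := fun l =>
    pd i (fun u => hm u j l) u + pd j (fun u => hm u i l) u - pd l (fun u => hm u i j) u with hc
  have h2 : (hm u).mulVec ((hm u)⁻¹.mulVec c) l = c l := by
    rw [Matrix.mulVec_mulVec, h1, Matrix.one_mulVec]
  change _ = (1 / 2 : ℝ) * c l
  rw [← h2]
  simp only [Matrix.mulVec, dotProduct, christoffel, Finset.mul_sum]
  exact Finset.sum_congr rfl fun k _ => Finset.sum_congr rfl fun m _ => by ring

theorem differentiableAt_metricForm {u : EuclideanSpace ℝ (Fin n)} (hu : u ∈ U) :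
    DifferentiableAt ℝ (metricForm hm) u :=
  (h.contDiffOn_metricForm.contDiffAt (h.isOpen.mem_nhds hu)).differentiableAt (by simp)

theorem differentiableAt_christoffelForm {u : EuclideanSpace ℝ (Fin n)} (hu : u ∈ U) :
    DifferentiableAt ℝ (christoffelForm hm) u :=
  (h.contDiffOn_christoffelForm.contDiffAt (h.isOpen.mem_nhds hu)).differentiableAt (by simp)

theorem fderiv_metricForm {u : EuclideanSpace ℝ (Fin n)} (hu : u ∈ U)
    (v a b : EuclideanSpace ℝ (Fin n)) : fderiv ℝ (metricForm hm) u v a b =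
      ∑ i, ∑ j, ∑ k, pd k (fun u => hm u i j) u * (v k * a i * b j) := by
  rw [(fderiv_clm_apply₂ (h.differentiableAt_metricForm hu) v a b).2]
  simp only [metricForm_apply]
  have hd : ∀ i j, HasFDerivAt (fun u => hm u i j) (fderiv ℝ (fun u => hm u i j) u) u :=
    fun i j => (((h.contDiffOn i j).contDiffAt (h.isOpen.mem_nhds hu)).differentiableAt
      (by simp)).hasFDerivAt
  have h1 : HasFDerivAt (fun x => ∑ i, ∑ j, hm x i j * (a i * b j))
      (∑ i, ∑ j, (a i * b j) • fderiv ℝ (fun u => hm u i j) u) u :=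
    HasFDerivAt.fun_sum fun i _ => HasFDerivAt.fun_sum fun j _ => (hd i j).mul_const _
  rw [h1.fderiv]
  simp only [sum_apply, smul_apply, smul_eq_mul, pd_sum_eq, Finset.mul_sum]
  exact Finset.sum_congr rfl fun i _ => Finset.sum_congr rfl fun j _ =>
    Finset.sum_congr rfl fun k _ => by ring

theorem metricForm_christoffelForm {u : EuclideanSpace ℝ (Fin n)} (hu : u ∈ U)
    (v a b : EuclideanSpace ℝ (Fin n)) :
    metricForm hm u b (christoffelForm hm u v a) = ∑ i, ∑ j, ∑ k, (1 / 2 : ℝ) *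
      (pd k (fun u => hm u j i) u + pd j (fun u => hm u k i) u - pd i (fun u => hm u k j) u) *
        (v k * a j * b i) := by
  rw [metricForm_apply]
  refine Finset.sum_congr rfl fun i _ => ?_
  simp only [← h.sum_mul_christoffel hu, christoffelForm_apply, Finset.mul_sum, Finset.sum_mul]
  rw [Finset.sum_comm]
  conv_lhs => enter [2, x]; rw [Finset.sum_comm]
  rw [Finset.sum_comm]
  refine Finset.sum_congr rfl fun i _ => Finset.sum_congr rfl fun j _ =>
    Finset.sum_congr rfl fun k _ => by ring

theorem compatible {u : EuclideanSpace ℝ (Fin n)} (hu : u ∈ U)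
    (v a b : EuclideanSpace ℝ (Fin n)) : fderiv ℝ (metricForm hm) u v a b =
      metricForm hm u (christoffelForm hm u v a) b +
        metricForm hm u a (christoffelForm hm u v b) := by
  rw [h.metricForm_symm hu _ b, h.metricForm_christoffelForm hu, h.metricForm_christoffelForm hu,
    h.fderiv_metricForm hu]
  conv_rhs => enter [1]; rw [Finset.sum_comm]
  simp only [← Finset.sum_add_distrib]
  refine Finset.sum_congr rfl fun i _ => Finset.sum_congr rfl fun j _ =>
    Finset.sum_congr rfl fun k _ => ?_
  rw [h.pd_symm hu k j i, h.pd_symm hu i k j, h.pd_symm hu j k i, h.pd_symm hu i j k,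
    h.pd_symm hu j i k]
  ring

end IsMetricCoeff
end ChristoffelForm

/-! ### Curvature in dimension two -/

section SurfaceCurvature

open LocalRiemann

noncomputable local instance {V V' : Type*} [NormedAddCommGroup V] [NormedSpace ℝ V]
    [NormedAddCommGroup V'] [NormedSpace ℝ V'] : NormedAddCommGroup (V →L[ℝ] V →L[ℝ] V') :=
  ContinuousLinearMap.toNormedAddCommGroup
noncomputable local instance {V V' : Type*} [NormedAddCommGroup V] [NormedSpace ℝ V]
    [NormedAddCommGroup V'] [NormedSpace ℝ V'] : NormedSpace ℝ (V →L[ℝ] V →L[ℝ] V') :=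
  ContinuousLinearMap.toNormedSpace

theorem IsMetricCoeff.isKillingNavigation {n : ℕ} {U : Set (EuclideanSpace ℝ (Fin n))}
    {hm : EuclideanSpace ℝ (Fin n) → Matrix (Fin n) (Fin n) ℝ} (h : IsMetricCoeff U hm)
    {W : EuclideanSpace ℝ (Fin n) → EuclideanSpace ℝ (Fin n)} (hW : ContDiffOn ℝ ∞ W U)
    (killing : ∀ u ∈ U, ∀ a b, fderiv ℝ (metricForm hm) u (W u) a b +
      metricForm hm u (fderiv ℝ W u a) b + metricForm hm u a (fderiv ℝ W u b) = 0)
    (speed : ∀ u ∈ U, metricForm hm u (W u) (W u) < 1)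
    {F : EuclideanSpace ℝ (Fin n) → EuclideanSpace ℝ (Fin n) → ℝ}
    (hF : ∀ u ∈ U, ∀ w, F u w =
      (√((1 - metricForm hm u (W u) (W u)) * metricForm hm u w w + (metricForm hm u (W u) w) ^ 2)
        - metricForm hm u (W u) w) / (1 - metricForm hm u (W u) (W u))) :
    IsKillingNavigation U (metricForm hm) (christoffelForm hm) W F where
  isOpen := h.isOpen
  contDiffOn_metric := h.contDiffOn_metricForm
  contDiffOn_connection := h.contDiffOn_christoffelForm
  contDiffOn_field := hW
  metric_symm _ hu := h.metricForm_symm hu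
  metric_pos := h.pos
  connection_symm _ hu := h.christoffelForm_symm hu
  compatible _ hu := h.compatible hu
  -- Compatibility rewrites ∂_W H as terms with Γ(W, ·), and the symmetry of Γ turns them into the
  -- connection part of ∇W.
  killing u hu a b := by
    have h1 := killing u hu a b
    rw [h.compatible hu] at h1
    simp only [covDeriv, add_apply, ContinuousLinearMap.flip_apply, map_add,
      h.christoffelForm_symm hu a, h.christoffelForm_symm hu b]
    linear_combination h1
  speed := speed
  eq_randers := hF

theorem IsMetricCoeff.curvatureTensor_single {n : ℕ} {U : Set (EuclideanSpace ℝ (Fin n))}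
    {hm : EuclideanSpace ℝ (Fin n) → Matrix (Fin n) (Fin n) ℝ} (h : IsMetricCoeff U hm)
    {u : EuclideanSpace ℝ (Fin n)} (hu : u ∈ U) (i j k l : Fin n) :
    curvatureTensor (christoffelForm hm) u (EuclideanSpace.single i 1) (EuclideanSpace.single j 1)
      (EuclideanSpace.single k 1) l = curvature hm l k i j u := by
  have hs : ∀ x i j, christoffelForm hm x (EuclideanSpace.single i 1)
      (EuclideanSpace.single j 1) = WithLp.toLp 2 fun k => christoffel hm k i j x := by
    intro x i j
    ext k
    simp [christoffelForm_apply]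
  have hd : ∀ i j k l, fderiv ℝ (christoffelForm hm) u (EuclideanSpace.single i 1)
      (EuclideanSpace.single j 1) (EuclideanSpace.single k 1) l =
      pd i (christoffel hm l j k) u := by
    intro i j k l
    obtain ⟨h1, h2⟩ := fderiv_clm_apply₂ (h.differentiableAt_christoffelForm hu)
      (EuclideanSpace.single i 1) (EuclideanSpace.single j 1) (EuclideanSpace.single k 1)
    rw [h2, ← (IsKillingNavigation.fderiv_coord h1 l _).2]
    simp only [hs, pd]
  have hq : ∀ i j k l, christoffelForm hm u (EuclideanSpace.single i 1)
      (christoffelForm hm u (EuclideanSpace.single j 1) (EuclideanSpace.single k 1)) l =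
      ∑ s, christoffel hm l i s u * christoffel hm s j k u := by
    intro i j k l
    rw [hs]
    simp [christoffelForm_apply]
  simp only [curvatureTensor, PiLp.sub_apply, PiLp.add_apply, hd, hq, curvature,
    Finset.sum_sub_distrib]
  ring

variable {U : Set (EuclideanSpace ℝ (Fin 2))}
  {hm : EuclideanSpace ℝ (Fin 2) → Matrix (Fin 2) (Fin 2) ℝ}
  {W : EuclideanSpace ℝ (Fin 2) → EuclideanSpace ℝ (Fin 2)}
  {F : EuclideanSpace ℝ (Fin 2) → EuclideanSpace ℝ (Fin 2) → ℝ}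

theorem EuclideanSpace.eq_smul_single_add (a : EuclideanSpace ℝ (Fin 2)) :
    a = a 0 • EuclideanSpace.single 0 (1 : ℝ) + a 1 • EuclideanSpace.single 1 (1 : ℝ) := by
  ext i
  fin_cases i <;> simp

/-- In the plane R(a, b) is the determinant of (a, b) times R(e₀, e₁). The latter is skew for the
metric, hence fixed by the single number H(R(e₀, e₁) e₁, e₀), which is G times det h. -/
theorem IsMetricCoeff.curvatureTensor_eq (h : IsMetricCoeff U hm)
    (hn : IsKillingNavigation U (metricForm hm) (christoffelForm hm) W F)
    {u : EuclideanSpace ℝ (Fin 2)} (hu : u ∈ U) (a b c : EuclideanSpace ℝ (Fin 2)) :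
    curvatureTensor (christoffelForm hm) u a b c = LocalRiemann.gaussCurvature hm u •
      (metricForm hm u b c • a - metricForm hm u a c • b) := by
  refine hn.eq_of_forall_metric_eq hu fun d => ?_
  set R := curvatureTensor (christoffelForm hm) u with hR
  set e₀ : EuclideanSpace ℝ (Fin 2) := EuclideanSpace.single 0 1 with he₀
  set e₁ : EuclideanSpace ℝ (Fin 2) := EuclideanSpace.single 1 1 with he₁
  have hgauss : LocalRiemann.gaussCurvature hm u * (hm u).det = metricForm hm u (R e₀ e₁ e₁) e₀ := by
    rw [LocalRiemann.gaussCurvature, div_mul_cancel₀ _ (h.det_ne_zero hu)]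
    simp only [← h.curvatureTensor_single hu, metricForm_apply]
    refine Finset.sum_congr rfl fun l _ => ?_
    simp [he₀, hR, he₁, mul_comm]
  have hab : R a b = (a 0 * b 1 - a 1 * b 0) • R e₀ e₁ := by
    funext c
    conv_lhs => rw [EuclideanSpace.eq_smul_single_add a, EuclideanSpace.eq_smul_single_add b]
    simp only [hR, Pi.smul_apply, curvatureTensor, map_add, map_smul, add_apply, smul_apply,
      ← he₀, ← he₁]
    module
  have skew : ∀ c d, metricForm hm u (R e₀ e₁ c) d + metricForm hm u (R e₀ e₁ d) c = 0 := by
    intro c d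
    have := hn.metric_curvatureTensor hu e₀ e₁ c d
    rwa [h.metricForm_symm hu c] at this
  have hlin : ∀ c, R e₀ e₁ c = c 0 • R e₀ e₁ e₀ + c 1 • R e₀ e₁ e₁ := by
    intro c
    conv_lhs => rw [EuclideanSpace.eq_smul_single_add c]
    simp only [hR, curvatureTensor, map_add, map_smul, ← he₀, ← he₁]
    module
  have hmet : ∀ x d, metricForm hm u x d = d 0 * metricForm hm u x e₀ + d 1 * metricForm hm u x e₁ := by
    intro x d
    conv_lhs => rw [EuclideanSpace.eq_smul_single_add d]
    simp [he₀, he₁]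
  have s00 := skew e₀ e₀
  have s01 := skew e₀ e₁
  have s11 := skew e₁ e₁
  rw [hab, Pi.smul_apply, map_smul, smul_apply, smul_eq_mul, hlin, hmet]
  simp only [map_add, map_smul, map_sub, add_apply, sub_apply, smul_apply, smul_eq_mul]
  have hdet : (hm u).det = hm u 0 0 * hm u 1 1 - hm u 0 1 * hm u 0 1 := by
    rw [Matrix.det_fin_two, h.symm u hu 1 0]
  rw [hdet] at hgauss
  rw [metricForm_apply hm u b c, metricForm_apply hm u a d, metricForm_apply hm u a c,
    metricForm_apply hm u b d]
  simp only [Fin.sum_univ_two, h.symm u hu 1 0]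
  linear_combination (a 0 * b 1 - a 1 * b 0) * (d 0 * c 0 / 2 * s00 + d 1 * c 1 / 2 * s11
    + d 1 * c 0 * s01 + (d 1 * c 0 - d 0 * c 1) * hgauss)

theorem IsMetricCoeff.flagCurvature_eq (h : IsMetricCoeff U hm) (hW : ContDiffOn ℝ ∞ W U)
    (killing : ∀ u ∈ U, ∀ a b, fderiv ℝ (metricForm hm) u (W u) a b +
      metricForm hm u (fderiv ℝ W u a) b + metricForm hm u a (fderiv ℝ W u b) = 0)
    (speed : ∀ u ∈ U, metricForm hm u (W u) (W u) < 1)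
    (hF : ∀ u ∈ U, ∀ w, F u w =
      (√((1 - metricForm hm u (W u) (W u)) * metricForm hm u w w + (metricForm hm u (W u) w) ^ 2)
        - metricForm hm u (W u) w) / (1 - metricForm hm u (W u) (W u)))
    {u w v : EuclideanSpace ℝ (Fin 2)} (hu : u ∈ U) (hwv : LinearIndependent ℝ ![w, v]) :
    LocalFinsler.flagCurvature F u w v = LocalRiemann.gaussCurvature hm u := by
  have hn := h.isKillingNavigation hW killing speed hF
  exact hn.flagCurvature_eq hu (by simpa using hwv.ne_zero 0) (h.curvatureTensor_eq hn hu) hwv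

end SurfaceCurvature

/-! ### Metric and vector fields read in a chart -/

section ChartMetric

variable {n : ℕ} {M : Type*} [TopologicalSpace M] [ChartedSpace (EuclideanSpace ℝ (Fin n)) M]

/-- The components, in the preferred chart at `x₀`, of a tangent vector of `M` at `y`. -/
noncomputable def chartComp (x₀ y : M) (v : TangentSpace (𝓡 n) y) : EuclideanSpace ℝ (Fin n) :=
  mfderiv (𝓡 n) 𝓘(ℝ, EuclideanSpace ℝ (Fin n)) (extChartAt (𝓡 n) x₀) y v

theorem chartComp_add (x₀ y : M) (v w : TangentSpace (𝓡 n) y) :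
    chartComp x₀ y (v + w) = chartComp x₀ y v + chartComp x₀ y w := map_add _ v w

theorem chartComp_smul (x₀ y : M) (c : ℝ) (v : TangentSpace (𝓡 n) y) :
    chartComp x₀ y (c • v) = c • chartComp x₀ y v := map_smul _ c v

section Inverse

variable [IsManifold (𝓡 n) ∞ M] {x₀ : M} {u : EuclideanSpace ℝ (Fin n)}

theorem chartComp_chartVec (hu : u ∈ (extChartAt (𝓡 n) x₀).target)
    (w : EuclideanSpace ℝ (Fin n)) :
    chartComp x₀ ((extChartAt (𝓡 n) x₀).symm u) (chartVec x₀ u w) = w := by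
  have : IsManifold (𝓡 n) 1 M := .of_le (n := ∞) (by norm_cast)
  have h := mfderiv_extChartAt_comp_mfderivWithin_extChartAt_symm (I := 𝓡 n) hu
  simp only [ModelWithCorners.range_eq_univ, mfderivWithin_univ] at h
  exact DFunLike.congr_fun h w

theorem chartVec_chartComp (hu : u ∈ (extChartAt (𝓡 n) x₀).target)
    (v : TangentSpace (𝓡 n) ((extChartAt (𝓡 n) x₀).symm u)) :
    chartVec x₀ u (chartComp x₀ ((extChartAt (𝓡 n) x₀).symm u) v) = v := by
  have : IsManifold (𝓡 n) 1 M := .of_le (n := ∞) (by norm_cast)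
  have h := mfderivWithin_extChartAt_symm_comp_mfderiv_extChartAt (I := 𝓡 n) hu
  simp only [ModelWithCorners.range_eq_univ, mfderivWithin_univ] at h
  exact DFunLike.congr_fun h v

theorem chartComp_injective {y : M} (hy : y ∈ (extChartAt (𝓡 n) x₀).source) :
    Function.Injective (chartComp (n := n) x₀ y) := by
  have : IsManifold (𝓡 n) 1 M := .of_le (n := ∞) (by norm_cast)
  exact (isInvertible_mfderiv_extChartAt (I := 𝓡 n) hy).injective

/-- The section is the tangent map of the inverse chart composed with a constant section, hence
smooth; the smoothness of the metric coefficients rests on it. -/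
theorem contMDiffOn_chartVec (x₀ : M) (w : EuclideanSpace ℝ (Fin n)) :
    ContMDiffOn 𝓘(ℝ, EuclideanSpace ℝ (Fin n)) (𝓡 n).tangent ∞
      (fun u => (⟨(extChartAt (𝓡 n) x₀).symm u, chartVec x₀ u w⟩ : TangentBundle (𝓡 n) M))
      (extChartAt (𝓡 n) x₀).target := by
  have : IsManifold (𝓡 n) 1 M := .of_le (n := ∞) (by norm_cast)
  have ho := isOpen_extChartAt_target (I := 𝓡 n) x₀
  have h := (contMDiffOn_extChartAt_symm (I := 𝓡 n) (n := ∞) x₀).contMDiffOn_tangentMapWithin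
    (m := ∞) (by norm_cast) ho.uniqueMDiffOn
  have h2 : ContMDiff 𝓘(ℝ, EuclideanSpace ℝ (Fin n)) 𝓘(ℝ, EuclideanSpace ℝ (Fin n)).tangent ∞
      (fun u => (⟨u, w⟩ : TangentBundle 𝓘(ℝ, EuclideanSpace ℝ (Fin n)) (EuclideanSpace ℝ (Fin n)))) := by
    rw [contMDiff_vectorSpace_iff_contDiff (V := fun _ => w)]
    exact contDiff_const
  refine (h.comp h2.contMDiffOn fun u hu => hu).congr fun u hu => ?_
  simp only [Function.comp_def, tangentMapWithin]
  rw [mfderivWithin_of_isOpen ho hu]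
  rfl

theorem contDiffOn_chartComp {x₀ : M} {W : (x : M) → TangentSpace (𝓡 n) x}
    (hW : ContMDiff (𝓡 n) (𝓡 n).tangent ∞ (fun x => (⟨x, W x⟩ : TangentBundle (𝓡 n) M))) :
    ContDiffOn ℝ ∞ (fun u => chartComp x₀ _ (W ((extChartAt (𝓡 n) x₀).symm u)))
      (extChartAt (𝓡 n) x₀).target := by
  have : IsManifold (𝓡 n) 1 M := .of_le (n := ∞) (by norm_cast)
  have ho := isOpen_extChartAt_source (I := 𝓡 n) x₀
  have hot := isOpen_extChartAt_target (I := 𝓡 n) x₀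
  have h0 : ContMDiffOn (𝓡 n) 𝓘(ℝ, EuclideanSpace ℝ (Fin n)) ∞ (extChartAt (𝓡 n) x₀)
      (extChartAt (𝓡 n) x₀).source := by
    rw [extChartAt_source]; exact contMDiffOn_extChartAt
  have h := h0.contMDiffOn_tangentMapWithin (m := ∞) (by norm_cast) ho.uniqueMDiffOn
  have h2 := (h.comp (hW.contMDiffOn (s := (extChartAt (𝓡 n) x₀).source)) fun u hu => hu).comp
    (contMDiffOn_extChartAt_symm (I := 𝓡 n) (n := ∞) x₀)
    fun u hu => (extChartAt (𝓡 n) x₀).map_target hu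
  have h3 : ContMDiffOn 𝓘(ℝ, EuclideanSpace ℝ (Fin n)) 𝓘(ℝ, EuclideanSpace ℝ (Fin n)).tangent ∞
      (fun u => (⟨u, chartComp x₀ _ (W ((extChartAt (𝓡 n) x₀).symm u))⟩ :
        TangentBundle 𝓘(ℝ, EuclideanSpace ℝ (Fin n)) (EuclideanSpace ℝ (Fin n))))
      (extChartAt (𝓡 n) x₀).target := by
    refine h2.congr fun u hu => ?_
    simp only [Function.comp_def, tangentMapWithin]
    rw [mfderivWithin_of_isOpen ho ((extChartAt (𝓡 n) x₀).map_target hu),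
      (extChartAt (𝓡 n) x₀).right_inv hu]
    rfl
  intro u hu
  exact (contMDiffWithinAt_vectorSpace_iff_contDiffWithinAt
    (V := fun u => chartComp x₀ _ (W ((extChartAt (𝓡 n) x₀).symm u)))).1 (h3 u hu)

end Inverse

variable [RiemannianBundle (fun x : M => TangentSpace (𝓡 n) x)]

/-- The coefficients of the metric of `M` in the preferred chart at `x₀`. -/
noncomputable def chartMetric (x₀ : M) (u : EuclideanSpace ℝ (Fin n)) : Matrix (Fin n) (Fin n) ℝ :=
  Matrix.of fun i j =>
    inner ℝ (chartVec x₀ u (EuclideanSpace.single i 1)) (chartVec x₀ u (EuclideanSpace.single j 1))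

theorem metricForm_chartMetric (x₀ : M) (u a b : EuclideanSpace ℝ (Fin n)) :
    metricForm (chartMetric x₀) u a b = inner ℝ (chartVec x₀ u a) (chartVec x₀ u b) := by
  have key (z : EuclideanSpace ℝ (Fin n)) :
      chartVec x₀ u z = ∑ k, z k • chartVec x₀ u (EuclideanSpace.single k 1) :=
    (EuclideanSpace.sum_smul_map_single
      (mfderiv 𝓘(ℝ, EuclideanSpace ℝ (Fin n)) (𝓡 n) (extChartAt (𝓡 n) x₀).symm u).toLinearMap z).symm
  rw [metricForm_apply, key a, key b, sum_inner]
  refine Finset.sum_congr rfl fun i _ => ?_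
  rw [inner_sum]
  refine Finset.sum_congr rfl fun j _ => ?_
  rw [real_inner_smul_left, real_inner_smul_right]
  simp only [chartMetric, Matrix.of_apply]
  ring

variable [IsManifold (𝓡 n) ∞ M]

theorem metricForm_chartMetric_comp {x₀ : M} {u : EuclideanSpace ℝ (Fin n)}
    (hu : u ∈ (extChartAt (𝓡 n) x₀).target)
    (v w : TangentSpace (𝓡 n) ((extChartAt (𝓡 n) x₀).symm u)) :
    metricForm (chartMetric x₀) u (chartComp x₀ _ v) (chartComp x₀ _ w) = inner ℝ v w := by
  rw [metricForm_chartMetric, chartVec_chartComp hu, chartVec_chartComp hu]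

theorem inner_eq_metricForm {x₀ y : M} (hy : y ∈ (extChartAt (𝓡 n) x₀).source)
    (v w : TangentSpace (𝓡 n) y) :
    metricForm (chartMetric x₀) (extChartAt (𝓡 n) x₀ y) (chartComp x₀ y v) (chartComp x₀ y w) =
      inner ℝ v w := by
  obtain ⟨u, hu, rfl⟩ : ∃ u ∈ (extChartAt (𝓡 n) x₀).target, (extChartAt (𝓡 n) x₀).symm u = y :=
    ⟨_, (extChartAt (𝓡 n) x₀).map_source hy, (extChartAt (𝓡 n) x₀).left_inv hy⟩
  rw [(extChartAt (𝓡 n) x₀).right_inv hu]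
  exact metricForm_chartMetric_comp hu v w

theorem isMetricCoeff_chartMetric
    [IsContMDiffRiemannianBundle (𝓡 n) ∞ (EuclideanSpace ℝ (Fin n))
      (fun x : M => TangentSpace (𝓡 n) x)] (x₀ : M) :
    IsMetricCoeff (extChartAt (𝓡 n) x₀).target (chartMetric x₀) where
  isOpen := isOpen_extChartAt_target x₀
  contDiffOn i j := ((contMDiffOn_chartVec x₀ (EuclideanSpace.single i 1)).inner_bundle
    (contMDiffOn_chartVec x₀ (EuclideanSpace.single j 1))).contDiffOn
  symm u _ i j := by simp only [chartMetric, Matrix.of_apply, real_inner_comm]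
  pos u hu a ha := by
    rw [metricForm_chartMetric]
    refine real_inner_self_pos.2 fun h0 => ha ?_
    have := chartComp_chartVec hu a
    rw [h0, chartComp, map_zero] at this
    exact this.symm

end ChartMetric

/-! ### Smoothness and norms of velocity vectors -/

section RiemannianDistance

open Filter Topology MeasureTheory

variable {n : ℕ} {M : Type*} [TopologicalSpace M] [ChartedSpace (EuclideanSpace ℝ (Fin n)) M]

theorem contMDiff_mfderiv_const [IsManifold (𝓡 n) ∞ M] {V : Type*} [NormedAddCommGroup V]
    [NormedSpace ℝ V] {f : V → M} (hf : ContMDiff 𝓘(ℝ, V) (𝓡 n) ∞ f) (v : V) :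
    ContMDiff 𝓘(ℝ, V) (𝓡 n).tangent ∞
      (fun z => (⟨f z, mfderiv 𝓘(ℝ, V) (𝓡 n) f z v⟩ : TangentBundle (𝓡 n) M)) := by
  have : IsManifold (𝓡 n) 1 M := .of_le (n := ∞) (by norm_cast)
  have h2 : ContMDiff 𝓘(ℝ, V) 𝓘(ℝ, V).tangent ∞
      (fun u => (⟨u, v⟩ : TangentBundle 𝓘(ℝ, V) V)) := by
    rw [contMDiff_vectorSpace_iff_contDiff (V := fun _ => v)]
    exact contDiff_const
  exact (hf.contMDiff_tangentMap (m := ∞) (by norm_cast)).comp h2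

variable [RiemannianBundle (fun x : M => TangentSpace (𝓡 n) x)]

theorem norm_mfderiv_eq_of_eventuallyEq {V : Type*} [NormedAddCommGroup V]
    [NormedSpace ℝ V] {f g : V → M} {z : V} (h : f =ᶠ[𝓝 z] g) (v : V) :
    ‖mfderiv 𝓘(ℝ, V) (𝓡 n) f z v‖ = ‖mfderiv 𝓘(ℝ, V) (𝓡 n) g z v‖ := by
  have h1 : (⟨f z, mfderiv 𝓘(ℝ, V) (𝓡 n) f z v⟩ : TangentBundle (𝓡 n) M) =
      ⟨g z, mfderiv 𝓘(ℝ, V) (𝓡 n) g z v⟩ := by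
    refine Bundle.TotalSpace.ext h.eq_of_nhds ?_
    have := DFunLike.congr_fun (h.mfderiv_eq (I := 𝓘(ℝ, V)) (I' := 𝓡 n)) v
    exact heq_of_eq this
  exact congrArg (fun w : TangentBundle (𝓡 n) M => ‖w.2‖) h1

theorem contDiff_inner_mfderiv [IsManifold (𝓡 n) ∞ M]
    [IsContMDiffRiemannianBundle (𝓡 n) ∞ (EuclideanSpace ℝ (Fin n))
      (fun x : M => TangentSpace (𝓡 n) x)] {V : Type*} [NormedAddCommGroup V]
    [NormedSpace ℝ V] {f : V → M} (hf : ContMDiff 𝓘(ℝ, V) (𝓡 n) ∞ f) (v w : V) :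
    ContDiff ℝ ∞ (fun z => inner ℝ (mfderiv 𝓘(ℝ, V) (𝓡 n) f z v)
      (mfderiv 𝓘(ℝ, V) (𝓡 n) f z w)) :=
  ((contMDiff_mfderiv_const hf v).inner_bundle (contMDiff_mfderiv_const hf w)).contDiff

theorem continuous_norm_mfderiv [IsManifold (𝓡 n) ∞ M]
    [IsContMDiffRiemannianBundle (𝓡 n) ∞ (EuclideanSpace ℝ (Fin n))
      (fun x : M => TangentSpace (𝓡 n) x)] {V : Type*} [NormedAddCommGroup V]
    [NormedSpace ℝ V] {f : V → M} (hf : ContMDiff 𝓘(ℝ, V) (𝓡 n) ∞ f) (v : V) :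
    Continuous (fun z => ‖mfderiv 𝓘(ℝ, V) (𝓡 n) f z v‖) := by
  simp only [norm_eq_sqrt_real_inner]
  exact (contDiff_inner_mfderiv hf v v).continuous.sqrt

end RiemannianDistance

/-! ### Riemannian distance: isometries and speed of curves -/

section RiemannianDistance

open Filter Topology MeasureTheory

variable {n : ℕ} {M : Type*} [MetricSpace M] [ChartedSpace (EuclideanSpace ℝ (Fin n)) M]
  [RiemannianBundle (fun x : M => TangentSpace (𝓡 n) x)]

theorem pathELength_comp_of_norm_mfderiv_eq {f : M → M} (hf : ContMDiff (𝓡 n) (𝓡 n) 1 f)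
    (hn : ∀ (x : M) (v : TangentSpace (𝓡 n) x), ‖mfderiv (𝓡 n) (𝓡 n) f x v‖ = ‖v‖)
    {γ : ℝ → M} (hγ : ContMDiff 𝓘(ℝ, ℝ) (𝓡 n) 1 γ) (a b : ℝ) :
    pathELength (𝓡 n) (f ∘ γ) a b = pathELength (𝓡 n) γ a b := by
  simp only [pathELength_eq_lintegral_mfderiv_Icc]
  refine lintegral_congr fun t => ?_
  rw [mfderiv_comp_apply _ (hf.mdifferentiable one_ne_zero _) (hγ.mdifferentiable one_ne_zero _)]
  exact enorm_eq_iff_norm_eq.2 (hn _ _)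

variable [IsRiemannianManifold (𝓡 n) M]

theorem Diffeomorph.dist_eq_of_norm_mfderiv_eq (f : M ≃ₘ^∞⟮𝓡 n, 𝓡 n⟯ M)
    (hn : ∀ (x : M) (v : TangentSpace (𝓡 n) x), ‖mfderiv (𝓡 n) (𝓡 n) f x v‖ = ‖v‖) (x y : M) :
    dist (f x) (f y) = dist x y := by
  have hf : ContMDiff (𝓡 n) (𝓡 n) 1 f := f.contMDiff.of_le (by norm_cast)
  have hf' : ContMDiff (𝓡 n) (𝓡 n) 1 f.symm := f.symm.contMDiff.of_le (by norm_cast)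
  have h : edist (f x) (f y) = edist x y := by
    rw [IsRiemannianManifold.out (I := 𝓡 n), IsRiemannianManifold.out (I := 𝓡 n)]
    refine le_antisymm (le_of_forall_gt fun c hc => ?_) (le_of_forall_gt fun c hc => ?_)
    · obtain ⟨γ, h0, h1, hγ, hlt, -⟩ := exists_lt_locally_constant_of_riemannianEDist_lt hc zero_lt_one
      refine lt_of_le_of_lt ?_ hlt
      rw [← pathELength_comp_of_norm_mfderiv_eq hf hn hγ]
      exact riemannianEDist_le_pathELength (hf.comp hγ).contMDiffOn (by simp [h0]) (by simp [h1])
        zero_le_one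
    · obtain ⟨γ, h0, h1, hγ, hlt, -⟩ := exists_lt_locally_constant_of_riemannianEDist_lt hc zero_lt_one
      refine lt_of_le_of_lt ?_ hlt
      -- Preservation of norms is known for `f` only, so the length of `γ` is transferred to `f.symm
      -- ∘ γ` through `f` itself.
      have h2 : f ∘ (f.symm ∘ γ) = γ := by ext t; simp
      rw [← h2, pathELength_comp_of_norm_mfderiv_eq hf hn (hf'.comp hγ)]
      exact riemannianEDist_le_pathELength (hf'.comp hγ).contMDiffOn (by simp [h0]) (by simp [h1])
        zero_le_one
  rw [dist_edist, dist_edist, h]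

/-- If the initial speed were below some c < 1, by continuity the length over a short interval would
be at most c (t - t₀), less than the distance between its ends. This replaces the first variation
formula in the Gauss lemma. -/
theorem one_le_norm_mfderiv_of_le_dist [IsManifold (𝓡 n) ∞ M]
    [IsContMDiffRiemannianBundle (𝓡 n) ∞ (EuclideanSpace ℝ (Fin n))
      (fun x : M => TangentSpace (𝓡 n) x)]
    {γ : ℝ → M} (hγ : ContMDiff 𝓘(ℝ, ℝ) (𝓡 n) ∞ γ) {t₀ : ℝ}
    (h : ∀ᶠ t in 𝓝[>] t₀, t - t₀ ≤ dist (γ t₀) (γ t)) :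
    1 ≤ ‖mfderiv 𝓘(ℝ, ℝ) (𝓡 n) γ t₀ (1 : ℝ)‖ := by
  by_contra! hlt
  obtain ⟨c, hc, hc1⟩ := exists_between hlt
  have hc0 : 0 < c := (norm_nonneg _).trans_lt hc
  have hev : ∀ᶠ t in 𝓝 t₀, ‖mfderiv 𝓘(ℝ, ℝ) (𝓡 n) γ t (1 : ℝ)‖ < c :=
    (continuous_norm_mfderiv hγ (1 : ℝ)).continuousAt.eventually_lt continuousAt_const hc
  obtain ⟨ε, hε, hball⟩ := Metric.eventually_nhds_iff.1 hev
  have hIoo : ∀ᶠ t in 𝓝[>] t₀, t ∈ Set.Ioo t₀ (t₀ + ε) := Ioo_mem_nhdsGT (by linarith)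
  obtain ⟨t, ht, ht1, ht2⟩ := (h.and hIoo).exists
  have hle : edist (γ t₀) (γ t) ≤ ENNReal.ofReal (c * (t - t₀)) := by
    rw [IsRiemannianManifold.out (I := 𝓡 n)]
    refine (riemannianEDist_le_pathELength (hγ.of_le (by norm_cast)).contMDiffOn rfl rfl
      ht1.le).trans ?_
    rw [pathELength_eq_lintegral_mfderiv_Icc]
    calc _ ≤ ∫⁻ s in Set.Icc t₀ t, ENNReal.ofReal c := by
          refine setLIntegral_mono measurable_const fun s hs => ?_
          rw [← ofReal_norm]
          refine ENNReal.ofReal_le_ofReal (hball ?_).le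
          rw [Real.dist_eq, abs_of_nonneg (by linarith [hs.1])]
          linarith [hs.2]
      _ = _ := by
          rw [setLIntegral_const, Real.volume_Icc, ENNReal.ofReal_mul hc0.le]
  rw [edist_dist, ENNReal.ofReal_le_ofReal_iff (by nlinarith)] at hle
  nlinarith

end RiemannianDistance

/-! ### Lifting maps through a local diffeomorphism -/

section Lift

open Filter Topology

theorem ContDiffAt.exists_contDiffAt_rightInverse {V V' : Type*} [NormedAddCommGroup V]
    [NormedSpace ℝ V] [NormedAddCommGroup V'] [NormedSpace ℝ V'] [FiniteDimensional ℝ V]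
    [FiniteDimensional ℝ V'] {ψ : V → V'} {z : V} (hψ : ContDiffAt ℝ ∞ ψ z)
    (hinj : Function.Injective (fderiv ℝ ψ z)) (hd : Module.finrank ℝ V = Module.finrank ℝ V') :
    ∃ L : V' → V, ContDiffAt ℝ ∞ L (ψ z) ∧ L (ψ z) = z ∧ ∀ᶠ y in 𝓝 (ψ z), ψ (L y) = y := by
  have : CompleteSpace V := FiniteDimensional.complete ℝ V
  let e : V ≃L[ℝ] V' :=
    (LinearEquiv.ofInjectiveOfFinrankEq (fderiv ℝ ψ z).toLinearMap hinj hd).toContinuousLinearEquiv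
  have he : HasFDerivAt ψ (e : V →L[ℝ] V') z := by
    have h1 : (e : V →L[ℝ] V') = fderiv ℝ ψ z := by ext v; rfl
    rw [h1]
    exact (hψ.differentiableAt (by simp)).hasFDerivAt
  refine ⟨hψ.localInverse he (by simp), hψ.to_localInverse he (by simp),
    hψ.localInverse_apply_image he (by simp), ?_⟩
  have h2 := hψ.hasStrictFDerivAt' he (by simp)
  exact h2.eventually_right_inverse

variable {n : ℕ} {M : Type*} [TopologicalSpace M] [ChartedSpace (EuclideanSpace ℝ (Fin n)) M]

theorem mfderiv_comp_curve {V : Type*} [NormedAddCommGroup V] [NormedSpace ℝ V] {f : V → M}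
    {c : ℝ → V} {t : ℝ} {v : V} (hf : MDifferentiableAt 𝓘(ℝ, V) (𝓡 n) f (c t))
    (hc : HasDerivAt c v t) :
    mfderiv 𝓘(ℝ, ℝ) (𝓡 n) (fun s => f (c s)) t (1 : ℝ) = mfderiv 𝓘(ℝ, V) (𝓡 n) f (c t) v := by
  have h := mfderiv_comp_apply (I := 𝓘(ℝ, ℝ)) (I' := 𝓘(ℝ, V)) (I'' := 𝓡 n) (g := f) t hf
    hc.differentiableAt.mdifferentiableAt (1 : ℝ)
  refine h.trans ?_
  rw [mfderiv_eq_fderiv]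
  congr 1
  exact (fderiv_eq_smul_deriv (f := c) (x := t) (1 : ℝ)).trans (by rw [hc.deriv, one_smul])

variable [IsManifold (𝓡 n) ∞ M]

theorem contDiffAt_extChartAt_comp {V : Type*} [NormedAddCommGroup V] [NormedSpace ℝ V] {f : V → M}
    {z : V} {x₀ : M} (hf : ContMDiffAt 𝓘(ℝ, V) (𝓡 n) ∞ f z)
    (hz : f z ∈ (extChartAt (𝓡 n) x₀).source) :
    ContDiffAt ℝ ∞ (fun y => extChartAt (𝓡 n) x₀ (f y)) z := by
  rw [extChartAt_source] at hz
  exact ((contMDiffAt_extChartAt' hz).comp z hf).contDiffAt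

theorem fderiv_extChartAt_comp {V : Type*} [NormedAddCommGroup V] [NormedSpace ℝ V] {f : V → M}
    {z : V} {x₀ : M} (hf : MDifferentiableAt 𝓘(ℝ, V) (𝓡 n) f z)
    (hz : f z ∈ (extChartAt (𝓡 n) x₀).source) (v : V) :
    fderiv ℝ (fun y => extChartAt (𝓡 n) x₀ (f y)) z v =
      chartComp x₀ (f z) (mfderiv 𝓘(ℝ, V) (𝓡 n) f z v) := by
  have : IsManifold (𝓡 n) 1 M := .of_le (n := ∞) (by norm_cast)
  rw [extChartAt_source] at hz
  rw [← mfderiv_eq_fderiv]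
  exact mfderiv_comp_apply z (mdifferentiableAt_extChartAt hz) hf v

/-- The inverse function theorem in a chart at f z. It serves to write an isometry locally in polar
coordinates, although Φ is only a local diffeomorphism. -/
theorem exists_contDiffAt_lift {V V' : Type*} [NormedAddCommGroup V] [NormedSpace ℝ V]
    [FiniteDimensional ℝ V] [NormedAddCommGroup V'] [NormedSpace ℝ V']
    {f : V → M} {k : V' → M} {z : V} {z' : V'}
    (hf : ContMDiff 𝓘(ℝ, V) (𝓡 n) ∞ f) (hk : ContMDiff 𝓘(ℝ, V') (𝓡 n) ∞ k)
    (hinj : Function.Injective (mfderiv 𝓘(ℝ, V) (𝓡 n) f z)) (hd : Module.finrank ℝ V = n)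
    (hz : k z' = f z) :
    ∃ G : V' → V, ContDiffAt ℝ ∞ G z' ∧ G z' = z ∧ ∀ᶠ y in 𝓝 z', f (G y) = k y := by
  have hs : f z ∈ (extChartAt (𝓡 n) (f z)).source := mem_extChartAt_source _
  obtain ⟨L, hL, hLz, hLr⟩ :=
    (contDiffAt_extChartAt_comp hf.contMDiffAt hs).exists_contDiffAt_rightInverse (by
      intro v w hvw
      rw [fderiv_extChartAt_comp (hf.mdifferentiable (by simp) _) hs,
        fderiv_extChartAt_comp (hf.mdifferentiable (by simp) _) hs] at hvw
      exact hinj (chartComp_injective hs hvw)) (by simp [hd])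
  have hk' : ContDiffAt ℝ ∞ (fun y => extChartAt (𝓡 n) (f z) (k y)) z' :=
    contDiffAt_extChartAt_comp hk.contMDiffAt (by rw [hz]; exact hs)
  have hG : ContDiffAt ℝ ∞ (fun y => L (extChartAt (𝓡 n) (f z) (k y))) z' :=
    ContDiffAt.comp z' (by rw [hz]; exact hL) hk'
  have hGz : L (extChartAt (𝓡 n) (f z) (k z')) = z := by rw [hz, hLz]
  refine ⟨_, hG, hGz, ?_⟩
  have h1 : ∀ᶠ y in 𝓝 z', f (L (extChartAt (𝓡 n) (f z) (k y))) ∈ (extChartAt (𝓡 n) (f z)).source := by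
    have hc : ContinuousAt (fun y => f (L (extChartAt (𝓡 n) (f z) (k y)))) z' :=
      hf.continuous.continuousAt.comp hG.continuousAt
    refine hc.eventually_mem ?_
    rw [hGz]
    exact extChartAt_source_mem_nhds _
  have h2 : ∀ᶠ y in 𝓝 z', k y ∈ (extChartAt (𝓡 n) (f z)).source := by
    refine hk.continuous.continuousAt.eventually_mem ?_
    rw [hz]
    exact extChartAt_source_mem_nhds _
  have hLr' : ∀ᶠ y in 𝓝 (extChartAt (𝓡 n) (f z) (k z')), extChartAt (𝓡 n) (f z) (f (L y)) = y := by
    rw [hz]; exact hLr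
  have h3 := hk'.continuousAt.eventually hLr'
  filter_upwards [h1, h2, h3] with y hy1 hy2 hy3
  exact (extChartAt (𝓡 n) (f z)).injOn hy1 hy2 hy3

end Lift

/-! ### The differential of polar coordinates -/

section Polar

open Filter Topology

variable {M : Type*} [TopologicalSpace M] [ChartedSpace (EuclideanSpace ℝ (Fin 2)) M]

/-- The derivative at `z` of the parametrization `Φ`, as a function of the pair of its arguments. -/
noncomputable def polarDeriv (Φ : ℝ → ℝ → M) (z α : ℝ × ℝ) : TangentSpace (𝓡 2) (Φ z.1 z.2) :=
  mfderiv 𝓘(ℝ, ℝ × ℝ) (𝓡 2) (fun z : ℝ × ℝ => Φ z.1 z.2) z α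

theorem polarDeriv_add (Φ : ℝ → ℝ → M) (z α β : ℝ × ℝ) :
    polarDeriv Φ z (α + β) = polarDeriv Φ z α + polarDeriv Φ z β := map_add _ α β

theorem polarDeriv_smul (Φ : ℝ → ℝ → M) (z : ℝ × ℝ) (c : ℝ) (α : ℝ × ℝ) :
    polarDeriv Φ z (c • α) = c • polarDeriv Φ z α := map_smul _ c α

theorem polarDeriv_eq (Φ : ℝ → ℝ → M) (z α : ℝ × ℝ) :
    polarDeriv Φ z α = α.1 • polarDeriv Φ z (1, 0) + α.2 • polarDeriv Φ z (0, 1) := by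
  rw [← polarDeriv_smul, ← polarDeriv_smul, ← polarDeriv_add]
  simp

variable {Φ : ℝ → ℝ → M}

theorem polarDeriv_radial (hΦ : ContMDiff 𝓘(ℝ, ℝ × ℝ) (𝓡 2) ∞ (fun z : ℝ × ℝ => Φ z.1 z.2))
    (r θ : ℝ) : polarDeriv Φ (r, θ) (1, 0) = radialVec Φ r θ :=
  (mfderiv_comp_curve (f := fun z : ℝ × ℝ => Φ z.1 z.2) (hΦ.mdifferentiable (by simp) _)
    ((hasDerivAt_id r).prodMk (hasDerivAt_const r θ))).symm

theorem polarDeriv_angular (hΦ : ContMDiff 𝓘(ℝ, ℝ × ℝ) (𝓡 2) ∞ (fun z : ℝ × ℝ => Φ z.1 z.2))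
    (r θ : ℝ) : polarDeriv Φ (r, θ) (0, 1) = angularVec Φ r θ :=
  (mfderiv_comp_curve (f := fun z : ℝ × ℝ => Φ z.1 z.2) (hΦ.mdifferentiable (by simp) _)
    ((hasDerivAt_const θ r).prodMk (hasDerivAt_id θ))).symm

end Polar

/-! ### The Gauss lemma -/

namespace IsGeodesicPolar

open Filter Topology

variable {M : Type*} [MetricSpace M] [ChartedSpace (EuclideanSpace ℝ (Fin 2)) M]
  [RiemannianBundle (fun x : M => TangentSpace (𝓡 2) x)]
  {p q : M} {a : ℝ} {Φ : ℝ → ℝ → M}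

theorem polarDeriv_injective (hΦ : IsGeodesicPolar p q a Φ) {z : ℝ × ℝ}
    (hz : z.1 ∈ Set.Ioo 0 (2 * a)) : Function.Injective (polarDeriv Φ z) := by
  have hli := hΦ.regular z.1 hz z.2
  rw [← polarDeriv_radial hΦ.smooth, ← polarDeriv_angular hΦ.smooth, LinearIndependent.pair_iff] at hli
  refine (injective_iff_map_eq_zero
    (mfderiv 𝓘(ℝ, ℝ × ℝ) (𝓡 2) (fun z : ℝ × ℝ => Φ z.1 z.2) z)).2 fun α hα => ?_
  have h := hli α.1 α.2 ((polarDeriv_eq Φ z α).symm.trans hα)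
  exact Prod.ext h.1 h.2

theorem norm_angularVec_pos (hΦ : IsGeodesicPolar p q a Φ) {r : ℝ} (hr : r ∈ Set.Ioo 0 (2 * a))
    (θ : ℝ) : 0 < ‖angularVec Φ r θ‖ :=
  norm_pos_iff.2 ((hΦ.regular r hr θ).ne_zero 1)

variable [IsManifold (𝓡 2) ∞ M]
  [IsContMDiffRiemannianBundle (𝓡 2) ∞ (EuclideanSpace ℝ (Fin 2))
    (fun x : M => TangentSpace (𝓡 2) x)]

theorem continuous_norm_angularVec (hΦ : IsGeodesicPolar p q a Φ) :
    Continuous (fun z : ℝ × ℝ => ‖angularVec Φ z.1 z.2‖) := by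
  have h := continuous_norm_mfderiv hΦ.smooth ((0, 1) : ℝ × ℝ)
  refine h.congr fun z => ?_
  rw [← polarDeriv_angular hΦ.smooth]
  rfl

variable [IsRiemannianManifold (𝓡 2) M]

/-- The curve t ↦ Φ (r + t) (θ + t k) lies at distance r + t from p, so it moves away from its
starting point at least as fast as t. -/
theorem one_le_norm_radialVec_add (hΦ : IsGeodesicPolar p q a Φ) {r : ℝ}
    (hr : r ∈ Set.Ioo 0 (2 * a)) (θ k : ℝ) :
    1 ≤ ‖radialVec Φ r θ + k • angularVec Φ r θ‖ := by
  let c : ℝ → ℝ × ℝ := fun t => (r + t, θ + t * k)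
  have hc (t : ℝ) : HasDerivAt c (1, k) t :=
    ((hasDerivAt_id t).const_add r).prodMk
      (by simpa using ((hasDerivAt_id t).mul_const k).const_add θ)
  have hcs : ContDiff ℝ ∞ c := by fun_prop
  have hγ : ContMDiff 𝓘(ℝ, ℝ) (𝓡 2) ∞ (fun t => Φ (c t).1 (c t).2) :=
    hΦ.smooth.comp hcs.contMDiff
  have h := one_le_norm_mfderiv_of_le_dist hγ (t₀ := 0) (by
    have : Set.Ioo 0 (2 * a - r) ∈ 𝓝[>] (0 : ℝ) := Ioo_mem_nhdsGT (by linarith [hr.2])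
    filter_upwards [this] with t ht
    have h1 := hΦ.minimizing (r + t) ⟨by linarith [hr.1, ht.1], by linarith [ht.2]⟩ (θ + t * k)
    have h0 := hΦ.minimizing r ⟨hr.1.le, hr.2.le⟩ θ
    have h2 := dist_triangle p (Φ r θ) (Φ (r + t) (θ + t * k))
    simp only [c, add_zero, zero_mul]
    linarith)
  rw [mfderiv_comp_curve (f := fun z : ℝ × ℝ => Φ z.1 z.2) (hΦ.smooth.mdifferentiable (by simp) _)
    (hc 0)] at h
  have h3 : polarDeriv Φ (r, θ) (1, k) = radialVec Φ r θ + k • angularVec Φ r θ := by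
    rw [polarDeriv_eq, polarDeriv_radial hΦ.smooth, polarDeriv_angular hΦ.smooth, one_smul]
  rw [← h3]
  have h4 : c 0 = (r, θ) := by simp [c]
  rw [h4] at h
  exact h

/-- The Gauss lemma, without the geodesic equation: |∂_r + k ∂_θ|² ≥ 1 = |∂_r|² for every real k, so
the term linear in k must vanish. -/
theorem inner_radialVec_angularVec (hΦ : IsGeodesicPolar p q a Φ) {r : ℝ}
    (hr : r ∈ Set.Ioo 0 (2 * a)) (θ : ℝ) :
    inner ℝ (radialVec Φ r θ) (angularVec Φ r θ) = 0 := by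
  set b : ℝ := inner ℝ (radialVec Φ r θ) (angularVec Φ r θ) with hb
  set m : ℝ := ‖angularVec Φ r θ‖ with hm
  have key (k : ℝ) : 0 ≤ 2 * k * b + k ^ 2 * m ^ 2 := by
    have h1 := hΦ.one_le_norm_radialVec_add hr θ k
    have h2 : 1 ≤ ‖radialVec Φ r θ + k • angularVec Φ r θ‖ ^ 2 := one_le_pow₀ h1
    rw [norm_add_sq_real, hΦ.unit_speed r ⟨hr.1.le, hr.2.le⟩, norm_smul, real_inner_smul_right,
      mul_pow, Real.norm_eq_abs, sq_abs, ← hb, ← hm] at h2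
    linarith
  have hm0 : 0 < m := hΦ.norm_angularVec_pos hr θ
  -- The value of k that minimizes the quadratic polynomial.
  have h := key (-b / m ^ 2)
  have h2 : 2 * (-b / m ^ 2) * b + (-b / m ^ 2) ^ 2 * m ^ 2 = -(b ^ 2 / m ^ 2) := by
    field_simp; ring
  rw [h2] at h
  have h3 : b ^ 2 / m ^ 2 = 0 := le_antisymm (by linarith) (by positivity)
  have h4 : b ^ 2 = 0 := by
    rcases div_eq_zero_iff.1 h3 with h | h
    · exact h
    · exact absurd h (by positivity)
  exact pow_eq_zero_iff (two_ne_zero) |>.1 h4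

theorem inner_polarDeriv (hΦ : IsGeodesicPolar p q a Φ) {z : ℝ × ℝ}
    (hz : z.1 ∈ Set.Ioo 0 (2 * a)) (α β : ℝ × ℝ) :
    inner ℝ (polarDeriv Φ z α) (polarDeriv Φ z β) =
      α.1 * β.1 + α.2 * β.2 * ‖angularVec Φ z.1 z.2‖ ^ 2 := by
  obtain ⟨r, θ⟩ := z
  have h0 := hΦ.inner_radialVec_angularVec hz θ
  have h1 := hΦ.unit_speed r ⟨hz.1.le, hz.2.le⟩ θ
  rw [polarDeriv_eq Φ _ α, polarDeriv_eq Φ _ β, polarDeriv_radial hΦ.smooth,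
    polarDeriv_angular hΦ.smooth]
  have h0' : inner ℝ (angularVec Φ r θ) (radialVec Φ r θ) = 0 := by rw [real_inner_comm, h0]
  simp only [inner_add_left, inner_add_right, real_inner_smul_left, real_inner_smul_right, h0, h0',
    real_inner_self_eq_norm_sq, h1]
  ring

end IsGeodesicPolar

/-! ### Isometries in polar coordinates -/

namespace IsGeodesicPolar

open Filter Topology

variable {M : Type*} [MetricSpace M] [ChartedSpace (EuclideanSpace ℝ (Fin 2)) M]
  [RiemannianBundle (fun x : M => TangentSpace (𝓡 2) x)]
  {p q : M} {a : ℝ} {Φ : ℝ → ℝ → M}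
  [IsManifold (𝓡 2) ∞ M]
  [IsContMDiffRiemannianBundle (𝓡 2) ∞ (EuclideanSpace ℝ (Fin 2))
    (fun x : M => TangentSpace (𝓡 2) x)] [IsRiemannianManifold (𝓡 2) M]

/-- G expresses f in polar coordinates and preserves r. For the metric dr² + m² dθ² the dr² parts
then cancel, and comparing the dθ² parts on (1, 0) and (0, 1) gives the two claims. -/
theorem hasFDerivAt_lift (hΦ : IsGeodesicPolar p q a Φ) {f : M → M}
    (hf : ContMDiff (𝓡 2) (𝓡 2) ∞ f)
    (hn : ∀ (x : M) (v : TangentSpace (𝓡 2) x), ‖mfderiv (𝓡 2) (𝓡 2) f x v‖ = ‖v‖)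
    {G : ℝ × ℝ → ℝ × ℝ} {D : ℝ × ℝ →L[ℝ] ℝ × ℝ} {y : ℝ × ℝ} (hG : HasFDerivAt G D y)
    (hy : y.1 ∈ Set.Ioo 0 (2 * a))
    (hfst : ∀ᶠ z in 𝓝 y, (G z).1 = z.1)
    (hlift : ∀ᶠ z in 𝓝 y, Φ (G z).1 (G z).2 = f (Φ z.1 z.2)) :
    (D (1, 0)).2 = 0 ∧
      ‖angularVec Φ y.1 y.2‖ ^ 2 = (D (0, 1)).2 ^ 2 * ‖angularVec Φ y.1 (G y).2‖ ^ 2 := by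
  have hGy : (G y).1 = y.1 := hfst.self_of_nhds
  have hD (α : ℝ × ℝ) : (D α).1 = α.1 := by
    have h1 : HasFDerivAt (fun z => (G z).1) (ContinuousLinearMap.fst ℝ ℝ ℝ) y :=
      hasFDerivAt_fst.congr_of_eventuallyEq hfst
    exact DFunLike.congr_fun (hG.fst.unique h1) α
  have hpos : 0 < ‖angularVec Φ y.1 (G y).2‖ := hΦ.norm_angularVec_pos hy _
  have key (α : ℝ × ℝ) : (D α).2 ^ 2 * ‖angularVec Φ y.1 (G y).2‖ ^ 2 =
      α.2 ^ 2 * ‖angularVec Φ y.1 y.2‖ ^ 2 := by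
    have h1 := norm_mfderiv_eq_of_eventuallyEq (n := 2) (M := M) (f := (fun z : ℝ × ℝ => Φ z.1 z.2) ∘ G)
      (g := f ∘ fun z : ℝ × ℝ => Φ z.1 z.2) hlift α
    have h2 := mfderiv_comp_apply (I := 𝓘(ℝ, ℝ × ℝ)) (I' := 𝓘(ℝ, ℝ × ℝ)) (I'' := 𝓡 2)
      (f := G) (g := fun z : ℝ × ℝ => Φ z.1 z.2) y (hΦ.smooth.mdifferentiable (by simp) _)
      hG.differentiableAt.mdifferentiableAt α
    rw [mfderiv_eq_fderiv, hG.fderiv] at h2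
    have h4 := mfderiv_comp_apply (I := 𝓘(ℝ, ℝ × ℝ)) (I' := 𝓡 2) (I'' := 𝓡 2)
      (f := fun z : ℝ × ℝ => Φ z.1 z.2) (g := f) y (hf.mdifferentiable (by simp) _)
      (hΦ.smooth.mdifferentiable (by simp) _) α
    rw [h2, h4, hn] at h1
    have h3 : ‖polarDeriv Φ (G y) (D α)‖ ^ 2 = ‖polarDeriv Φ y α‖ ^ 2 :=
      congrArg (· ^ 2) h1
    rw [← real_inner_self_eq_norm_sq, ← real_inner_self_eq_norm_sq, hΦ.inner_polarDeriv hy,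
      hΦ.inner_polarDeriv (by rwa [hGy]), hD, hGy] at h3
    linarith
  constructor
  · have h := key (1, 0)
    have h' : (D (1, 0)).2 ^ 2 = 0 := by
      have h5 : (0 : ℝ) < ‖angularVec Φ y.1 (G y).2‖ ^ 2 := by positivity
      simp only [ne_eq, OfNat.ofNat_ne_zero, not_false_eq_true, zero_pow, zero_mul] at h
      exact (mul_eq_zero.1 h).resolve_right h5.ne'
    exact pow_eq_zero_iff two_ne_zero |>.1 h'
  · have h := key (0, 1)
    simp only [one_pow, one_mul] at h
    exact h.symm

/-- Locally the isometry has the form (r, θ) ↦ (r, g(θ)), since the angular component of its lift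
has zero r-derivative. So it maps meridians to meridians, and the ratio of the m² is g'(θ₁)², free
of r. -/
theorem eventually_map_eq (hΦ : IsGeodesicPolar p q a Φ) {f : M → M}
    (hf : ContMDiff (𝓡 2) (𝓡 2) ∞ f)
    (hn : ∀ (x : M) (v : TangentSpace (𝓡 2) x), ‖mfderiv (𝓡 2) (𝓡 2) f x v‖ = ‖v‖)
    (hd : ∀ x, dist p (f x) = dist p x) {r₁ θ₁ θ₂ : ℝ} (hr : r₁ ∈ Set.Ioo 0 (2 * a))
    (h : f (Φ r₁ θ₁) = Φ r₁ θ₂) :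
    ∃ c : ℝ, ∀ᶠ r in 𝓝 r₁, f (Φ r θ₁) = Φ r θ₂ ∧
      ‖angularVec Φ r θ₁‖ ^ 2 = c * ‖angularVec Φ r θ₂‖ ^ 2 := by
  obtain ⟨G, hG, hGz, hlift⟩ := exists_contDiffAt_lift (z := (r₁, θ₂)) (z' := (r₁, θ₁)) hΦ.smooth
    (hf.comp hΦ.smooth) (hΦ.polarDeriv_injective hr) (by simp) h
  have hGd : ∀ᶠ y in 𝓝 (r₁, θ₁), DifferentiableAt ℝ G y :=
    ((hG.of_le (m := 1) (by norm_cast)).eventually (by simp)).mono fun y hy =>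
      hy.differentiableAt (by simp)
  have hIoo : Set.Ioo 0 (2 * a) ∈ 𝓝 r₁ := isOpen_Ioo.mem_nhds hr
  have hmem : ∀ᶠ y : ℝ × ℝ in 𝓝 (r₁, θ₁), y.1 ∈ Set.Ioo 0 (2 * a) :=
    continuousAt_fst.eventually_mem hIoo
  have hmem' : ∀ᶠ y in 𝓝 (r₁, θ₁), (G y).1 ∈ Set.Ioo 0 (2 * a) :=
    (continuousAt_fst.comp hG.continuousAt).eventually_mem (by simpa [hGz] using hIoo)
  have hfst : ∀ᶠ y in 𝓝 (r₁, θ₁), (G y).1 = y.1 := by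
    filter_upwards [hmem, hmem', hlift] with y h1 h2 h3
    rw [← hΦ.minimizing (G y).1 ⟨h2.1.le, h2.2.le⟩ (G y).2,
      ← hΦ.minimizing y.1 ⟨h1.1.le, h1.2.le⟩ y.2, h3]
    exact hd _
  have hev := hGd.and (hmem.and (hfst.eventually_nhds.and hlift.eventually_nhds))
  obtain ⟨ε, hε, hball⟩ := Metric.eventually_nhds_iff.1 hev
  have hgood {r θ : ℝ} (h1 : dist r r₁ < ε) (h2 : dist θ θ₁ < ε) := hball (y := (r, θ))
    (max_lt h1 h2)
  have hconst {r θ : ℝ} (h1 : dist r r₁ < ε) (h2 : dist θ θ₁ < ε) :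
      (G (r, θ)).2 = (G (r₁, θ)).2 := by
    have hder {s : ℝ} (hs : s ∈ Metric.ball r₁ ε) : HasDerivAt (fun s => (G (s, θ)).2) 0 s := by
      obtain ⟨g1, g2, g3, g4⟩ := hgood hs h2
      have h3 := (hΦ.hasFDerivAt_lift hf hn g1.hasFDerivAt g2 g3 g4).1
      rw [← h3]
      exact g1.hasFDerivAt.snd.comp_hasDerivAt s
        ((hasDerivAt_id s).prodMk (hasDerivAt_const s θ))
    exact Metric.isOpen_ball.is_const_of_deriv_eq_zero
      (convex_ball r₁ ε).isPreconnected
      (fun s hs => (hder hs).differentiableAt.differentiableWithinAt)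
      (fun s hs => (hder hs).deriv) h1 (Metric.mem_ball_self hε)
  have hθ : dist θ₁ θ₁ < ε := by simpa using hε
  have hr₁ : dist r₁ r₁ < ε := by simpa using hε
  refine ⟨(fderiv ℝ G (r₁, θ₁) (0, 1)).2 ^ 2, ?_⟩
  filter_upwards [Metric.ball_mem_nhds r₁ hε] with r hrε
  obtain ⟨g1, g2, g3, g4⟩ := hgood hrε hθ
  have hGr : (G (r, θ₁)).2 = θ₂ := by rw [hconst hrε hθ, hGz]
  constructor
  · have h1 : (G (r, θ₁)).1 = r := g3.self_of_nhds
    have h2 := g4.self_of_nhds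
    simp only [h1, hGr] at h2
    exact h2.symm
  · have h3 := (hΦ.hasFDerivAt_lift hf hn g1.hasFDerivAt g2 g3 g4).2
    rw [hGr] at h3
    rw [h3]
    congr 2
    -- The angular components of G (r, ·) and G (r₁, ·) agree near θ₁, so their derivatives there
    -- agree: the constant does not depend on r.
    have hder {s : ℝ} (hs : dist s r₁ < ε) : HasDerivAt (fun t => (G (s, t)).2)
        (fderiv ℝ G (s, θ₁) (0, 1)).2 θ₁ :=
      (hgood hs hθ).1.hasFDerivAt.snd.comp_hasDerivAt θ₁
        ((hasDerivAt_const θ₁ s).prodMk (hasDerivAt_id θ₁))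
    refine (hder hrε).unique ((hder hr₁).congr_of_eventuallyEq ?_)
    filter_upwards [Metric.ball_mem_nhds θ₁ hε] with t ht
    exact hconst hrε ht

/-- Connectedness of the interval: the parameters near which f maps the one meridian to the other
form an open set, and at a limit point equality holds by continuity, so the local statement restarts
there. The ratio of the m² then has zero derivative throughout. -/
theorem exists_norm_angularVec_sq_eq_mul (hΦ : IsGeodesicPolar p q a Φ) {f : M → M}
    (hf : ContMDiff (𝓡 2) (𝓡 2) ∞ f)
    (hn : ∀ (x : M) (v : TangentSpace (𝓡 2) x), ‖mfderiv (𝓡 2) (𝓡 2) f x v‖ = ‖v‖)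
    (hd : ∀ x, dist p (f x) = dist p x) {r₁ θ₁ θ₂ : ℝ} (hr : r₁ ∈ Set.Ioo 0 (2 * a))
    (h : f (Φ r₁ θ₁) = Φ r₁ θ₂) :
    ∃ c : ℝ, ∀ r ∈ Set.Ioo 0 (2 * a),
      ‖angularVec Φ r θ₁‖ ^ 2 = c * ‖angularVec Φ r θ₂‖ ^ 2 := by
  have hcurve (θ : ℝ) : Continuous (fun r => Φ r θ) :=
    hΦ.smooth.continuous.comp (f := fun r => (r, θ)) (by fun_prop)
  have hsub : Set.Ioo 0 (2 * a) ⊆ {r | ∀ᶠ s in 𝓝 r, f (Φ s θ₁) = Φ s θ₂} := by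
    refine isPreconnected_Ioo.subset_of_closure_inter_subset ?_ ⟨r₁, hr, ?_⟩ ?_
    · exact isOpen_iff_mem_nhds.2 fun r hr => hr.eventually_nhds
    · exact (hΦ.eventually_map_eq hf hn hd hr h).elim fun c hc => hc.mono fun _ h => h.1
    · rintro r ⟨hrc, hr'⟩
      have h1 : f (Φ r θ₁) = Φ r θ₂ :=
        (isClosed_eq (hf.continuous.comp (hcurve θ₁)) (hcurve θ₂)).closure_subset_iff.2
          (fun s hs => hs.self_of_nhds) hrc
      exact (hΦ.eventually_map_eq hf hn hd hr' h1).elim fun c hc => hc.mono fun _ h => h.1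
  have hder {r : ℝ} (hr : r ∈ Set.Ioo 0 (2 * a)) :
      HasDerivAt (fun r => ‖angularVec Φ r θ₁‖ ^ 2 / ‖angularVec Φ r θ₂‖ ^ 2) 0 r := by
    obtain ⟨c, hc⟩ := hΦ.eventually_map_eq hf hn hd hr (hsub hr).self_of_nhds
    refine (hasDerivAt_const r c).congr_of_eventuallyEq ?_
    filter_upwards [hc, isOpen_Ioo.mem_nhds hr] with s hs hs'
    have := hΦ.norm_angularVec_pos hs' θ₂
    rw [hs.2]
    field_simp
  refine ⟨‖angularVec Φ r₁ θ₁‖ ^ 2 / ‖angularVec Φ r₁ θ₂‖ ^ 2, fun r hr' => ?_⟩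
  have h1 := isOpen_Ioo.is_const_of_deriv_eq_zero isPreconnected_Ioo
      (fun s hs => (hder hs).differentiableAt.differentiableWithinAt)
      (fun s hs => (hder hs).deriv) hr hr'
  have := hΦ.norm_angularVec_pos hr' θ₂
  rw [h1]
  field_simp

end IsGeodesicPolar

/-! ### Behaviour at the pole and independence of the angle -/

theorem Filter.Tendsto.continuousLinearMap_apply {ι V V' : Type*} [NormedAddCommGroup V]
    [NormedSpace ℝ V] [NormedAddCommGroup V'] [NormedSpace ℝ V'] {l : Filter ι}
    {L : ι → V →L[ℝ] V'} {L₀ : V →L[ℝ] V'} {v : ι → V} {v₀ : V}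
    (hL : Filter.Tendsto L l (nhds L₀)) (hv : Filter.Tendsto v l (nhds v₀)) :
    Filter.Tendsto (fun i => L i (v i)) l (nhds (L₀ v₀)) :=
  (isBoundedBilinearMap_apply.continuous.tendsto (L₀, v₀)).comp (hL.prodMk_nhds hv)

namespace IsGeodesicPolar

open Filter Topology

noncomputable local instance {V V' : Type*} [NormedAddCommGroup V] [NormedSpace ℝ V]
    [NormedAddCommGroup V'] [NormedSpace ℝ V'] : NormedAddCommGroup (V →L[ℝ] V →L[ℝ] V') :=
  ContinuousLinearMap.toNormedAddCommGroup
noncomputable local instance {V V' : Type*} [NormedAddCommGroup V] [NormedSpace ℝ V]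
    [NormedAddCommGroup V'] [NormedSpace ℝ V'] : NormedSpace ℝ (V →L[ℝ] V →L[ℝ] V') :=
  ContinuousLinearMap.toNormedSpace

variable {M : Type*} [MetricSpace M] [ChartedSpace (EuclideanSpace ℝ (Fin 2)) M]
  [RiemannianBundle (fun x : M => TangentSpace (𝓡 2) x)]
  {p q : M} {a : ℝ} {Φ : ℝ → ℝ → M}

theorem apply_zero (hΦ : IsGeodesicPolar p q a Φ) (θ : ℝ) : Φ 0 θ = p := by
  obtain ⟨e₁, e₂, -, -, -, h⟩ := hΦ.initial
  exact congrArg Bundle.TotalSpace.proj (h θ)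

variable [IsManifold (𝓡 2) ∞ M]

/-- All meridians start at p, so ∂_θ vanishes at r = 0. By symmetry of second derivatives its
r-derivative there is the θ-derivative of the initial velocity cos θ e₁ + sin θ e₂, a unit vector.
-/
theorem exists_hasDerivAt_angular (hΦ : IsGeodesicPolar p q a Φ) (θ : ℝ) :
    ∃ w : TangentSpace (𝓡 2) p, ‖w‖ = 1 ∧
      fderiv ℝ (fun y : ℝ × ℝ => extChartAt (𝓡 2) p (Φ y.1 y.2)) (0, θ) (0, 1) = 0 ∧
      HasDerivAt (fun r => fderiv ℝ (fun y : ℝ × ℝ => extChartAt (𝓡 2) p (Φ y.1 y.2)) (r, θ) (0, 1))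
        (chartComp p p w) 0 := by
  obtain ⟨e₁, e₂, h1, h2, h12, hinit⟩ := hΦ.initial
  set ψ : ℝ × ℝ → EuclideanSpace ℝ (Fin 2) := fun y => extChartAt (𝓡 2) p (Φ y.1 y.2) with hψ
  have hsrc (t : ℝ) : Φ 0 t ∈ (extChartAt (𝓡 2) p).source := by
    rw [hΦ.apply_zero]; exact mem_extChartAt_source p
  have hs (t : ℝ) : ContDiffAt ℝ ∞ ψ (0, t) :=
    contDiffAt_extChartAt_comp (f := fun y : ℝ × ℝ => Φ y.1 y.2) hΦ.smooth.contMDiffAt (hsrc t)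
  have hf (t : ℝ) : DifferentiableAt ℝ (fderiv ℝ ψ) (0, t) :=
    ((hs t).fderiv_right (m := 1) (by norm_cast)).differentiableAt (by simp)
  have hvert (t : ℝ) : HasDerivAt (fun s : ℝ => ((0 : ℝ), s)) (0, 1) t :=
    (hasDerivAt_const t 0).prodMk (hasDerivAt_id t)
  have hhor : HasDerivAt (fun s : ℝ => (s, θ)) (1, 0) 0 :=
    (hasDerivAt_id (0 : ℝ)).prodMk (hasDerivAt_const 0 θ)
  refine ⟨-Real.sin θ • e₁ + Real.cos θ • e₂, ?_, ?_, ?_⟩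
  · have h : ‖-Real.sin θ • e₁ + Real.cos θ • e₂‖ ^ 2 = 1 := by
      rw [norm_add_sq_real, norm_smul, norm_smul, real_inner_smul_left, real_inner_smul_right, h12,
        h1, h2]
      simp
    exact (pow_eq_one_iff_of_nonneg (norm_nonneg _) two_ne_zero).1 h
  · have h3 := ((hs θ).differentiableAt (by simp)).hasFDerivAt.comp_hasDerivAt θ (hvert θ)
    refine h3.unique ?_
    refine (hasDerivAt_const θ (extChartAt (𝓡 2) p p)).congr_of_eventuallyEq
      (Eventually.of_forall fun t => ?_)
    simp [hψ, hΦ.apply_zero]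
  · have h3 : HasDerivAt (fun r => fderiv ℝ ψ (r, θ) (0, 1))
        (fderiv ℝ (fderiv ℝ ψ) (0, θ) (1, 0) (0, 1)) 0 := by
      have h := ((hf θ).hasFDerivAt.comp_hasDerivAt (0 : ℝ) hhor).clm_apply
        (hasDerivAt_const (0 : ℝ) ((0, 1) : ℝ × ℝ))
      simpa using h
    have h4 : HasDerivAt (fun t => fderiv ℝ ψ (0, t) (1, 0))
        (fderiv ℝ (fderiv ℝ ψ) (0, θ) (0, 1) (1, 0)) θ := by
      have h := ((hf θ).hasFDerivAt.comp_hasDerivAt θ (hvert θ)).clm_apply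
        (hasDerivAt_const θ ((1, 0) : ℝ × ℝ))
      simpa using h
    have h5 (t : ℝ) : fderiv ℝ ψ (0, t) (1, 0) =
        Real.cos t • chartComp p p e₁ + Real.sin t • chartComp p p e₂ := by
      have h := fderiv_extChartAt_comp (f := fun y : ℝ × ℝ => Φ y.1 y.2) (z := (0, t))
        (hΦ.smooth.mdifferentiable (by simp) _) (hsrc t) (1, 0)
      have h' := congrArg (fun z : TangentBundle (𝓡 2) M => chartComp p z.1 z.2) (hinit t)
      simp only [← polarDeriv_radial hΦ.smooth, chartComp_add, chartComp_smul] at h'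
      exact h.trans h'
    have h6 : HasDerivAt (fun t => fderiv ℝ ψ (0, t) (1, 0))
        (-Real.sin θ • chartComp p p e₁ + Real.cos θ • chartComp p p e₂) θ := by
      simp only [h5]
      exact ((Real.hasDerivAt_cos θ).smul_const _).add ((Real.hasDerivAt_sin θ).smul_const _)
    have hsym := ((hs θ).isSymmSndFDerivAt (by
      rw [minSmoothness_of_isRCLikeNormedField]; norm_cast)) (1, 0) (0, 1)
    rw [chartComp_add, chartComp_smul, chartComp_smul, ← h4.unique h6, ← hsym]
    exact h3

variable [IsContMDiffRiemannianBundle (𝓡 2) ∞ (EuclideanSpace ℝ (Fin 2))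
    (fun x : M => TangentSpace (𝓡 2) x)]

/-- The quotient is the metric evaluated on the slope of ∂_θ between 0 and r, and this slope tends
to a unit vector. -/
theorem tendsto_norm_angularVec_sq_div (hΦ : IsGeodesicPolar p q a Φ) (θ : ℝ) :
    Tendsto (fun r => ‖angularVec Φ r θ‖ ^ 2 / r ^ 2) (𝓝[≠] 0) (𝓝 1) := by
  obtain ⟨w, hw, h0, hd⟩ := hΦ.exists_hasDerivAt_angular θ
  have hsl := hasDerivAt_iff_tendsto_slope.1 hd
  have hsrc : Φ 0 θ ∈ (extChartAt (𝓡 2) p).source := by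
    rw [hΦ.apply_zero]; exact mem_extChartAt_source p
  have hcurve : Continuous (fun r => Φ r θ) :=
    hΦ.smooth.continuous.comp (f := fun r => (r, θ)) (by fun_prop)
  have hcont : ContinuousAt (fun r => metricForm (chartMetric p) (extChartAt (𝓡 2) p (Φ r θ))) 0 := by
    refine ContinuousAt.comp (g := metricForm (chartMetric p)) ?_
      (ContinuousAt.comp (g := extChartAt (𝓡 2) p) (continuousAt_extChartAt' hsrc)
        hcurve.continuousAt)
    exact ((isMetricCoeff_chartMetric p).differentiableAt_metricForm
      ((extChartAt (𝓡 2) p).map_source hsrc)).continuousAt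
  have hlim := Filter.Tendsto.continuousLinearMap_apply (Filter.Tendsto.continuousLinearMap_apply
    (hcont.tendsto.mono_left (nhdsWithin_le_nhds (s := {0}ᶜ))) hsl) hsl
  rw [hΦ.apply_zero, inner_eq_metricForm (mem_extChartAt_source p), real_inner_self_eq_norm_sq, hw,
    one_pow] at hlim
  refine hlim.congr' ?_
  have hev : ∀ᶠ r in 𝓝[≠] (0 : ℝ), Φ r θ ∈ (extChartAt (𝓡 2) p).source :=
    nhdsWithin_le_nhds (hcurve.continuousAt.eventually_mem
      ((isOpen_extChartAt_source p).mem_nhds hsrc))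
  filter_upwards [hev, self_mem_nhdsWithin] with r hr hr0
  have hr0' : r ≠ 0 := hr0
  have h1 := fderiv_extChartAt_comp (f := fun y : ℝ × ℝ => Φ y.1 y.2) (z := (r, θ))
        (hΦ.smooth.mdifferentiable (by simp) _) hr (0, 1)
  have h2 : chartComp p (Φ r θ) (mfderiv 𝓘(ℝ, ℝ × ℝ) (𝓡 2) (fun y : ℝ × ℝ => Φ y.1 y.2) (r, θ) (0, 1)) =
      chartComp p (Φ r θ) (angularVec Φ r θ) := by
    rw [← polarDeriv_angular hΦ.smooth]; rfl
  rw [slope_def_module, h0, sub_zero, sub_zero, h1]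
  simp only [map_smul, smul_apply, smul_eq_mul]
  rw [h2, inner_eq_metricForm hr, real_inner_self_eq_norm_sq]
  field_simp

variable [IsRiemannianManifold (𝓡 2) M]

/-- The isometry taking one point to the other gives m²(s, θ₁) = c m²(s, θ₂) for all s; dividing by
s² and letting s tend to 0 forces c = 1. -/
theorem norm_angularVec_eq (hΦ : IsGeodesicPolar p q a Φ) (hM : IsSphereOfRevolution p) {r : ℝ}
    (hr : r ∈ Set.Ioo 0 (2 * a)) (θ₁ θ₂ : ℝ) : ‖angularVec Φ r θ₁‖ = ‖angularVec Φ r θ₂‖ := by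
  have hr' : r ∈ Set.Icc 0 (2 * a) := ⟨hr.1.le, hr.2.le⟩
  obtain ⟨f, hn, hp, hf⟩ := hM.exists_isometry (Φ r θ₁) (Φ r θ₂) (by
    rw [hΦ.minimizing r hr', hΦ.minimizing r hr'])
  obtain ⟨c, hc⟩ := hΦ.exists_norm_angularVec_sq_eq_mul f.contMDiff hn (fun x => by
    have := f.dist_eq_of_norm_mfderiv_eq hn p x
    rwa [hp] at this) hr hf
  have hle : 𝓝[>] (0 : ℝ) ≤ 𝓝[≠] 0 := nhdsGT_le_nhdsNE 0
  have h1 := (hΦ.tendsto_norm_angularVec_sq_div θ₁).mono_left hle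
  have h2 := ((hΦ.tendsto_norm_angularVec_sq_div θ₂).mono_left hle).const_mul c
  have h3 : Tendsto (fun r => ‖angularVec Φ r θ₁‖ ^ 2 / r ^ 2) (𝓝[>] 0) (𝓝 (c * 1)) := by
    refine h2.congr' ?_
    filter_upwards [Ioo_mem_nhdsGT (hr.1.trans hr.2)] with s hs
    rw [hc s hs, mul_div_assoc]
  have h4 : c = 1 := by rw [← mul_one c]; exact tendsto_nhds_unique h3 h1
  have h5 := hc r hr
  rw [h4, one_mul] at h5
  exact (sq_eq_sq₀ (norm_nonneg _) (norm_nonneg _)).1 h5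

end IsGeodesicPolar

/-! ### Lie derivative of the metric along the field -/

section ChartField

variable {n : ℕ} {M : Type*} [TopologicalSpace M] [ChartedSpace (EuclideanSpace ℝ (Fin n)) M]

/-- The components, in the preferred chart at `x₀`, of the vector field `W`. -/
noncomputable def chartField (W : (x : M) → TangentSpace (𝓡 n) x) (x₀ : M)
    (u : EuclideanSpace ℝ (Fin n)) : EuclideanSpace ℝ (Fin n) :=
  chartComp x₀ _ (W ((extChartAt (𝓡 n) x₀).symm u))

theorem chartField_extChartAt (W : (x : M) → TangentSpace (𝓡 n) x) {x₀ y : M}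
    (hy : y ∈ (extChartAt (𝓡 n) x₀).source) :
    chartField W x₀ (extChartAt (𝓡 n) x₀ y) = chartComp x₀ y (W y) := by
  rw [chartField, (extChartAt (𝓡 n) x₀).left_inv hy]

end ChartField

section Killing

open Filter Topology

noncomputable local instance {V V' : Type*} [NormedAddCommGroup V] [NormedSpace ℝ V]
    [NormedAddCommGroup V'] [NormedSpace ℝ V'] : NormedAddCommGroup (V →L[ℝ] V →L[ℝ] V') :=
  ContinuousLinearMap.toNormedAddCommGroup
noncomputable local instance {V V' : Type*} [NormedAddCommGroup V] [NormedSpace ℝ V]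
    [NormedAddCommGroup V'] [NormedSpace ℝ V'] : NormedSpace ℝ (V →L[ℝ] V →L[ℝ] V') :=
  ContinuousLinearMap.toNormedSpace

/-- The Lie derivative along `W` of the family `B` of bilinear forms, evaluated at two vectors. -/
noncomputable def lieDerivForm {V : Type*} [NormedAddCommGroup V] [NormedSpace ℝ V]
    (B : V → V →L[ℝ] V →L[ℝ] ℝ) (W : V → V) (u a b : V) : ℝ :=
  fderiv ℝ B u (W u) a b + B u (fderiv ℝ W u a) b + B u a (fderiv ℝ W u b)

theorem continuousOn_lieDerivForm {V : Type*} [NormedAddCommGroup V] [NormedSpace ℝ V]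
    {B : V → V →L[ℝ] V →L[ℝ] ℝ} {W : V → V} {U : Set V} (hU : IsOpen U)
    (hB : ContDiffOn ℝ ∞ B U) (hW : ContDiffOn ℝ ∞ W U) (a b : V) :
    ContinuousOn (fun u => lieDerivForm B W u a b) U := by
  have h1 : ContinuousOn (fderiv ℝ B) U := hB.continuousOn_fderiv_of_isOpen hU (by simp)
  have h2 : ContinuousOn (fderiv ℝ W) U := hW.continuousOn_fderiv_of_isOpen hU (by simp)
  have hB' := hB.continuousOn
  have hW' := hW.continuousOn
  have hc (v : V) : ContinuousOn (fun _ : V => v) U := continuousOn_const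
  exact ((((h1.clm_apply hW').clm_apply (hc a)).clm_apply (hc b)).add
    ((hB'.clm_apply (h2.clm_apply (hc a))).clm_apply (hc b))).add
    ((hB'.clm_apply (hc a)).clm_apply (h2.clm_apply (hc b)))

/-- If the pull-back of `B` by `ψ` does not change along the direction `e`, and if `W` is the
image of `μ • e`, then the Lie derivative of `B` along `W` vanishes on the image of `ψ`. -/
theorem lieDerivForm_eq_zero_of_pullback {V V' : Type*} [NormedAddCommGroup V] [NormedSpace ℝ V]
    [NormedAddCommGroup V'] [NormedSpace ℝ V'] {B : V → V →L[ℝ] V →L[ℝ] ℝ} {W : V → V}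
    {ψ : V' → V} {z e : V'} {μ : ℝ} (hψ : ContDiffAt ℝ ∞ ψ z) (hB : DifferentiableAt ℝ B (ψ z))
    (hW : DifferentiableAt ℝ W (ψ z))
    (hWe : ∀ᶠ y in 𝓝 z, W (ψ y) = μ • fderiv ℝ ψ y e)
    (hinv : ∀ α β, ∀ᶠ t in 𝓝 (0 : ℝ), B (ψ (z + t • e)) (fderiv ℝ ψ (z + t • e) α)
      (fderiv ℝ ψ (z + t • e) β) = B (ψ z) (fderiv ℝ ψ z α) (fderiv ℝ ψ z β)) (α β : V') :
    lieDerivForm B W (ψ z) (fderiv ℝ ψ z α) (fderiv ℝ ψ z β) = 0 := by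
  have hψd : DifferentiableAt ℝ ψ z := hψ.differentiableAt (by simp)
  have hψ2 : DifferentiableAt ℝ (fderiv ℝ ψ) z :=
    (hψ.fderiv_right (m := 1) (by norm_cast)).differentiableAt (by simp)
  have hline : HasDerivAt (fun t : ℝ => z + t • e) e 0 := by
    simpa using ((hasDerivAt_id (0 : ℝ)).smul_const e).const_add z
  have hz : z + (0 : ℝ) • e = z := by simp
  have hA (γ : V') : HasDerivAt (fun t : ℝ => fderiv ℝ ψ (z + t • e) γ)
      (fderiv ℝ (fderiv ℝ ψ) z e γ) 0 := by
    have h := (hψ2.hasDerivAt_comp_line e).clm_apply (hasDerivAt_const (0 : ℝ) γ)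
    simpa using h
  have hBψ : HasDerivAt (fun t : ℝ => B (ψ (z + t • e))) (fderiv ℝ B (ψ z) (fderiv ℝ ψ z e)) 0 := by
    have h1 : HasFDerivAt B (fderiv ℝ B (ψ z)) (ψ (z + (0 : ℝ) • e)) := by
      rw [hz]; exact hB.hasFDerivAt
    exact h1.comp_hasDerivAt (0 : ℝ) (hψd.hasDerivAt_comp_line e)
  have hsum := ((hBψ.clm_apply (hA α)).clm_apply (hA β)).unique
    ((hasDerivAt_const (0 : ℝ) _).congr_of_eventuallyEq (hinv α β))
  simp only [zero_smul, add_zero, add_apply] at hsum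
  -- Differentiating W ∘ ψ = μ ∂_e ψ along γ and exchanging the order of the second derivatives. The
  -- Lie derivative thereby becomes μ times the e-derivative of the pull-back, which is zero by
  -- `hsum`.
  have hsym (γ : V') : fderiv ℝ W (ψ z) (fderiv ℝ ψ z γ) = μ • fderiv ℝ (fderiv ℝ ψ) z e γ := by
    have h1 : HasFDerivAt (fun y => W (ψ y)) ((fderiv ℝ W (ψ z)).comp (fderiv ℝ ψ z)) z :=
      hW.hasFDerivAt.comp z hψd.hasFDerivAt
    have h2 : HasFDerivAt (fun y => μ • fderiv ℝ ψ y e)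
        (μ • (fderiv ℝ (fderiv ℝ ψ) z).flip e) z := by
      refine HasFDerivAt.const_smul ?_ μ
      have := hψ2.hasFDerivAt.clm_apply (hasFDerivAt_const e z)
      refine this.congr_fderiv ?_
      ext; simp
    have h3 := h1.unique (h2.congr_of_eventuallyEq hWe)
    have h4 := DFunLike.congr_fun h3 γ
    have h5 := (hψ.isSymmSndFDerivAt (by
      rw [minSmoothness_of_isRCLikeNormedField]; norm_cast)) γ e
    simp only [ContinuousLinearMap.comp_apply, smul_apply, ContinuousLinearMap.flip_apply] at h4
    rw [h4, h5]
  rw [lieDerivForm, hsym, hsym, hWe.self_of_nhds]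
  simp only [map_smul, smul_apply, smul_eq_mul]
  rw [← mul_add, ← mul_add, hsum, mul_zero]

end Killing

/-! ### The rotation field is Killing, and the theorem -/

namespace IsGeodesicPolar

open Filter Topology

variable {M : Type*} [MetricSpace M] [ChartedSpace (EuclideanSpace ℝ (Fin 2)) M]
  [RiemannianBundle (fun x : M => TangentSpace (𝓡 2) x)]
  {p q : M} {a : ℝ} {Φ : ℝ → ℝ → M}

theorem exists_apply_eq (hΦ : IsGeodesicPolar p q a Φ) (x : M) :
    ∃ r ∈ Set.Icc 0 (2 * a), ∃ θ : ℝ, Φ r θ = x := by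
  have ha := hΦ.pos
  by_cases hp : x = p
  · exact ⟨0, ⟨le_rfl, by linarith⟩, 0, by rw [hΦ.apply_zero, hp]⟩
  by_cases hq : x = q
  · exact ⟨2 * a, ⟨by linarith, le_rfl⟩, 0, by rw [hΦ.endpoint, hq]⟩
  obtain ⟨r, hr, θ, h⟩ := hΦ.surj x hp hq
  exact ⟨r, ⟨hr.1.le, hr.2.le⟩, θ, h⟩

variable [IsManifold (𝓡 2) ∞ M]
  [IsContMDiffRiemannianBundle (𝓡 2) ∞ (EuclideanSpace ℝ (Fin 2))
    (fun x : M => TangentSpace (𝓡 2) x)]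
  {W : (x : M) → TangentSpace (𝓡 2) x} {μ : ℝ}

/-- Nothing prescribes W directly at the poles; there the equality of its norm with |μ| m follows by
continuity along a meridian. -/
theorem norm_lt_one (hΦ : IsGeodesicPolar p q a Φ)
    (hμ : ∀ r ∈ Set.Icc 0 (2 * a), ∀ θ : ℝ, |μ| * ‖angularVec Φ r θ‖ < 1)
    (hW : ContMDiff (𝓡 2) (𝓡 2).tangent ∞ (fun x => (⟨x, W x⟩ : TangentBundle (𝓡 2) M)))
    (hWθ : ∀ r ∈ Set.Ioo 0 (2 * a), ∀ θ : ℝ, W (Φ r θ) = μ • angularVec Φ r θ) (x : M) :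
    ‖W x‖ < 1 := by
  obtain ⟨r, hr, θ, rfl⟩ := hΦ.exists_apply_eq x
  have ha := hΦ.pos
  have hWc : Continuous (fun x => ‖W x‖) := by
    simp only [norm_eq_sqrt_real_inner]
    exact (hW.inner_bundle hW).continuous.sqrt
  have hline : Continuous (fun s : ℝ => (s, θ)) := by fun_prop
  have h1 : Continuous (fun s => ‖W (Φ s θ)‖) :=
    hWc.comp (hΦ.smooth.continuous.comp hline)
  have h2 : Continuous (fun s => |μ| * ‖angularVec Φ s θ‖) :=
    continuous_const.mul (hΦ.continuous_norm_angularVec.comp hline)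
  have heq : Set.EqOn (fun s => ‖W (Φ s θ)‖) (fun s => |μ| * ‖angularVec Φ s θ‖)
      (Set.Ioo 0 (2 * a)) := fun s hs => by
    simp only [hWθ s hs, norm_smul, Real.norm_eq_abs]
  have h3 := heq.closure h1 h2
  rw [closure_Ioo (by linarith)] at h3
  exact (h3 hr).trans_lt (hμ r hr θ)

variable [IsRiemannianManifold (𝓡 2) M]

theorem lieDerivForm_eq_zero_of_mem_Ioo (hΦ : IsGeodesicPolar p q a Φ)
    (hM : IsSphereOfRevolution p)
    (hW : ContMDiff (𝓡 2) (𝓡 2).tangent ∞ (fun x => (⟨x, W x⟩ : TangentBundle (𝓡 2) M)))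
    (hWθ : ∀ r ∈ Set.Ioo 0 (2 * a), ∀ θ : ℝ, W (Φ r θ) = μ • angularVec Φ r θ) (x₀ : M)
    {r θ : ℝ} (hr : r ∈ Set.Ioo 0 (2 * a)) (hs : Φ r θ ∈ (extChartAt (𝓡 2) x₀).source)
    (b c : EuclideanSpace ℝ (Fin 2)) :
    lieDerivForm (metricForm (chartMetric x₀)) (chartField W x₀) (extChartAt (𝓡 2) x₀ (Φ r θ)) b c
      = 0 := by
  set ψ : ℝ × ℝ → EuclideanSpace ℝ (Fin 2) := fun y => extChartAt (𝓡 2) x₀ (Φ y.1 y.2) with hψ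
  have hU := (extChartAt (𝓡 2) x₀).map_source hs
  have hfd {y : ℝ × ℝ} (hy : Φ y.1 y.2 ∈ (extChartAt (𝓡 2) x₀).source) (α : ℝ × ℝ) :
      fderiv ℝ ψ y α = chartComp x₀ (Φ y.1 y.2) (polarDeriv Φ y α) :=
    fderiv_extChartAt_comp (f := fun y : ℝ × ℝ => Φ y.1 y.2) (hΦ.smooth.mdifferentiable (by simp) _)
      hy α
  have hψs : ContDiffAt ℝ ∞ ψ (r, θ) :=
    contDiffAt_extChartAt_comp (f := fun y : ℝ × ℝ => Φ y.1 y.2) hΦ.smooth.contMDiffAt hs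
  have hinj : Function.Injective (fderiv ℝ ψ (r, θ)) := fun α β h => by
    rw [hfd hs, hfd hs] at h
    exact hΦ.polarDeriv_injective hr (chartComp_injective hs h)
  -- The differential of polar coordinates is onto, so it is enough to test the Lie derivative on
  -- images of polar vectors.
  have hsurj : Function.Surjective (fderiv ℝ ψ (r, θ)).toLinearMap :=
    (LinearMap.injective_iff_surjective_of_finrank_eq_finrank (by simp)).1 hinj
  obtain ⟨α, rfl⟩ := hsurj b
  obtain ⟨β, rfl⟩ := hsurj c
  have hev : ∀ᶠ y : ℝ × ℝ in 𝓝 (r, θ), Φ y.1 y.2 ∈ (extChartAt (𝓡 2) x₀).source :=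
    hΦ.smooth.continuous.continuousAt.eventually_mem ((isOpen_extChartAt_source x₀).mem_nhds hs)
  have hIoo : ∀ᶠ y : ℝ × ℝ in 𝓝 (r, θ), y.1 ∈ Set.Ioo 0 (2 * a) :=
    continuousAt_fst.eventually_mem (isOpen_Ioo.mem_nhds hr)
  have hinner {y : ℝ × ℝ} (hy : Φ y.1 y.2 ∈ (extChartAt (𝓡 2) x₀).source)
      (hy' : y.1 ∈ Set.Ioo 0 (2 * a)) (α β : ℝ × ℝ) :
      metricForm (chartMetric x₀) (ψ y) (fderiv ℝ ψ y α) (fderiv ℝ ψ y β) =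
        α.1 * β.1 + α.2 * β.2 * ‖angularVec Φ y.1 y.2‖ ^ 2 := by
    rw [hfd hy, hfd hy, inner_eq_metricForm hy, hΦ.inner_polarDeriv hy']
  refine lieDerivForm_eq_zero_of_pullback (W := chartField W x₀) (e := (0, 1)) (μ := μ) hψs
    ((isMetricCoeff_chartMetric x₀).differentiableAt_metricForm hU)
    (((contDiffOn_chartComp hW).contDiffAt ((isOpen_extChartAt_target x₀).mem_nhds
      hU)).differentiableAt (by simp)) ?_ ?_ α β
  · filter_upwards [hev, hIoo] with y hy hy'
    rw [hfd hy, hψ, chartField_extChartAt W hy, hWθ y.1 hy', chartComp_smul,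
      ← polarDeriv_angular hΦ.smooth]
  -- The pull-back dr² + m² dθ² is invariant under shifts of θ because m depends on r only.
  · intro α β
    have hline : ContinuousAt (fun t : ℝ => (r, θ) + t • ((0, 1) : ℝ × ℝ)) 0 := by fun_prop
    have hline' : Tendsto (fun t : ℝ => (r, θ) + t • ((0, 1) : ℝ × ℝ)) (𝓝 0) (𝓝 (r, θ)) := by
      simpa using hline.tendsto
    filter_upwards [hline'.eventually hev] with t ht
    rw [hinner ht (by simpa using hr), hinner hs hr]
    have ht' : (r, θ) + t • ((0, 1) : ℝ × ℝ) = (r, θ + t) := by ext <;> simp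
    rw [ht', hΦ.norm_angularVec_eq hM hr _ θ]

/-- Every point, the poles included, is a limit along a meridian of points with 0 < r < 2a, and in a
fixed chart the Lie derivative is continuous. -/
theorem lieDerivForm_eq_zero (hΦ : IsGeodesicPolar p q a Φ)
    (hM : IsSphereOfRevolution p)
    (hW : ContMDiff (𝓡 2) (𝓡 2).tangent ∞ (fun x => (⟨x, W x⟩ : TangentBundle (𝓡 2) M)))
    (hWθ : ∀ r ∈ Set.Ioo 0 (2 * a), ∀ θ : ℝ, W (Φ r θ) = μ • angularVec Φ r θ) (x₀ : M)
    {u : EuclideanSpace ℝ (Fin 2)} (hu : u ∈ (extChartAt (𝓡 2) x₀).target)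
    (b c : EuclideanSpace ℝ (Fin 2)) :
    lieDerivForm (metricForm (chartMetric x₀)) (chartField W x₀) u b c = 0 := by
  have ha := hΦ.pos
  obtain ⟨r, hr, θ, h⟩ := hΦ.exists_apply_eq ((extChartAt (𝓡 2) x₀).symm u)
  have hs : Φ r θ ∈ (extChartAt (𝓡 2) x₀).source := by
    rw [h]; exact (extChartAt (𝓡 2) x₀).map_target hu
  have hu' : extChartAt (𝓡 2) x₀ (Φ r θ) = u := by rw [h, (extChartAt (𝓡 2) x₀).right_inv hu]
  have hcurve : Continuous (fun s => Φ s θ) :=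
    hΦ.smooth.continuous.comp (f := fun s => (s, θ)) (by fun_prop)
  have hc : ContinuousAt (fun s => lieDerivForm (metricForm (chartMetric x₀)) (chartField W x₀)
      (extChartAt (𝓡 2) x₀ (Φ s θ)) b c) r := by
    refine ContinuousAt.comp (g := fun u => lieDerivForm (metricForm (chartMetric x₀))
      (chartField W x₀) u b c) ?_
      (ContinuousAt.comp (g := extChartAt (𝓡 2) x₀) (continuousAt_extChartAt' hs)
        hcurve.continuousAt)
    rw [hu']
    exact (continuousOn_lieDerivForm (isOpen_extChartAt_target x₀)
      (isMetricCoeff_chartMetric x₀).contDiffOn_metricForm (contDiffOn_chartComp hW) b c).continuousAt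
      ((isOpen_extChartAt_target x₀).mem_nhds hu)
  have hne : (𝓝[Set.Ioo 0 (2 * a)] r).NeBot := by
    rw [← mem_closure_iff_nhdsWithin_neBot, closure_Ioo (by linarith)]
    exact hr
  have h0 : Tendsto (fun s => lieDerivForm (metricForm (chartMetric x₀)) (chartField W x₀)
      (extChartAt (𝓡 2) x₀ (Φ s θ)) b c) (𝓝[Set.Ioo 0 (2 * a)] r) (𝓝 0) := by
    refine tendsto_const_nhds.congr' ?_
    filter_upwards [self_mem_nhdsWithin, nhdsWithin_le_nhds (hcurve.continuousAt.eventually_mem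
      ((isOpen_extChartAt_source x₀).mem_nhds hs))] with s hs1 hs2
    exact (hΦ.lieDerivForm_eq_zero_of_mem_Ioo hM hW hWθ x₀ hs1 hs2 b c).symm
  have h1 := tendsto_nhds_unique (hc.tendsto.mono_left nhdsWithin_le_nhds) h0
  rwa [hu'] at h1

end IsGeodesicPolar

theorem randersMetric_chartVec {n : ℕ} {M : Type*} [TopologicalSpace M]
    [ChartedSpace (EuclideanSpace ℝ (Fin n)) M] [IsManifold (𝓡 n) ∞ M]
    [RiemannianBundle (fun x : M => TangentSpace (𝓡 n) x)]
    (W : (x : M) → TangentSpace (𝓡 n) x) {x₀ : M} {u : EuclideanSpace ℝ (Fin n)}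
    (hu : u ∈ (extChartAt (𝓡 n) x₀).target) (w : EuclideanSpace ℝ (Fin n)) :
    randersMetric W ((extChartAt (𝓡 n) x₀).symm u) (chartVec x₀ u w) =
      (√((1 - metricForm (chartMetric x₀) u (chartField W x₀ u) (chartField W x₀ u)) *
          metricForm (chartMetric x₀) u w w +
          (metricForm (chartMetric x₀) u (chartField W x₀ u) w) ^ 2)
        - metricForm (chartMetric x₀) u (chartField W x₀ u) w) /
      (1 - metricForm (chartMetric x₀) u (chartField W x₀ u) (chartField W x₀ u)) := by
  have h : chartVec x₀ u (chartField W x₀ u) = W ((extChartAt (𝓡 n) x₀).symm u) :=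
    chartVec_chartComp hu _
  rw [metricForm_chartMetric, metricForm_chartMetric, metricForm_chartMetric, h, randersMetric,
    real_inner_self_eq_norm_sq, real_inner_self_eq_norm_sq]

theorem mainTheorem5 {M : Type*} [MetricSpace M] [CompactSpace M]
    [ChartedSpace (EuclideanSpace ℝ (Fin 2)) M] [IsManifold (𝓡 2) ∞ M]
    [RiemannianBundle (fun x : M => TangentSpace (𝓡 2) x)]
    [IsContMDiffRiemannianBundle (𝓡 2) ∞ (EuclideanSpace ℝ (Fin 2))
      (fun x : M => TangentSpace (𝓡 2) x)]
    [IsRiemannianManifold (𝓡 2) M]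
    (p q : M) (hM : IsSphereOfRevolution p)
    (a : ℝ) (Φ : ℝ → ℝ → M) (hΦ : IsGeodesicPolar p q a Φ)
    (μ : ℝ) (hμ : ∀ r ∈ Set.Icc 0 (2 * a), ∀ θ : ℝ, |μ| * ‖angularVec Φ r θ‖ < 1)
    (W : (x : M) → TangentSpace (𝓡 2) x)
    (hW : ContMDiff (𝓡 2) (𝓡 2).tangent ∞ (fun x => (⟨x, W x⟩ : TangentBundle (𝓡 2) M)))
    (hWθ : ∀ r ∈ Set.Ioo 0 (2 * a), ∀ θ : ℝ, W (Φ r θ) = μ • angularVec Φ r θ)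
    (x : M) (y v : TangentSpace (𝓡 2) x) (hyv : LinearIndependent ℝ ![y, v]) :
    flagCurvature (randersMetric W) x y v = gaussCurvature x := by
  have hU : extChartAt (𝓡 2) x x ∈ (extChartAt (𝓡 2) x).target := mem_extChartAt_target x
  refine (isMetricCoeff_chartMetric x).flagCurvature_eq (W := chartField W x)
    (contDiffOn_chartComp hW) (fun u hu b c => hΦ.lieDerivForm_eq_zero hM hW hWθ x hu b c)
    (fun u hu => ?_) (fun u hu w => randersMetric_chartVec W hu w) hU ?_
  · rw [chartField, metricForm_chartMetric_comp hu, real_inner_self_eq_norm_sq]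
    exact pow_lt_one₀ (norm_nonneg _) (hΦ.norm_lt_one hμ hW hWθ _) two_ne_zero
  · rw [LinearIndependent.pair_iff] at hyv ⊢
    intro s t hst
    refine hyv s t (chartComp_injective (mem_extChartAt_source x) ?_)
    rw [chartComp_add, chartComp_smul, chartComp_smul]
    exact hst.trans (map_zero _).symm
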